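/- **Setting.** Let $H^2=\mathbb Z H\oplus\mathbb Z e_1\oplus\dots\oplus\mathbb Z e_9$ with $(H,H)=1$, $(e_i,e_i)=-1$ and all other products of basis vectors $0$ (the second cohomology lattice of a rational elliptic surface), and put $F=3H-e_1-\dots-e_9$. Let $\alpha_0=e_8-e_9$, $\alpha_i=e_i-e_{i+1}$ ($1\le i\le 7$), $\alpha_8=H-e_1-e_2-e_3$, and let $W$ be the affine $E_8$ Weyl group generated by $s_i(x)=x+(\alpha_i,x)\alpha_i$ ($0\le i\le 8$). Put $g_\beta=\frac12\{(\beta,\beta)+2-(\beta,F)\}$. A class $\beta=dH-\sum a_ie_i$ is called *admissible of level $n$* if $g_\beta\ge 0$ and, when $n\ge2$, $d\ge1$ and $a_1,\dots,a_9\ge0$. A *minimal dominant weight of level $n$* is an admissible $\lambda$ with $(\lambda,\alpha_i)\ge0$ for all $i$ and $(\lambda,F)=n$ that has the least $g$ among the admissible classes of $\lambda+\mathbb Z F$. Throughout $\tau\in\mathbb H$ (the upper half plane), $q^r=e^{2\pi i r\tau}$, $\eta=\eta(\tau)$ is the Dedekind eta function, and $E_k=E_k(\tau)$ is the level-one Eisenstein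 series normalised to have constant term $1$. For $G\ge 0$, a *solution up to genus $G$ and level $2$* is a family of rational numbers $N_g(\beta)$ ($g\ge0$, $\beta\in H^2$) that satisfies the following for all $g\le G$. 1. $N_g(w\beta)=N_g(\beta)$ for all $w\in W$ and $\beta\in H^2$. 2. (Holomorphic anomaly equation.) For $n=1,2$ and $u\in\langle e_9,F\rangle^\perp\otimes\mathbb C$, the series $\sum_{(\beta,F)=n}N_g(\beta)\,e^{2\pi i(\beta,\,\tau(e_9+F)+u)}$ converges absolutely, and its sum is $\frac{q^{n/2}}{\eta^{12n}}\Phi_{g,n}$. Here $\Phi_{g,n}=\sum_k\varphi_{g,n,k}(\tau,u)E_2(\tau)^k$ is a polynomial in $E_2$ whose coefficients satisfy $$\varphi_{g,n,k}(\tau+1,u)=\varphi_{g,n,k}(\tau,u),\qquad \varphi_{g,n,k}(-1/\tau,u/\tau)=\tau^{2g+6n-2-2k}\,e^{-\pi i n(u,u)/\tau}\,\varphi_{g,n,k}(\tau,u).$$ With $\Phi_{-1,n}=0$ and the formal derivative with respect to $E_2$, $$\frac{\partial\Phi_{g,n}}{\partial E_2}=\frac1{24}\sum_{g'+g''=g}\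 \sum_{s=1}^{n-1}s(n-s)\,\Phi_{g',s}\Phi_{g'',n-s}+\frac{n(n+1)}{24}\,\Phi_{g-1,n}.$$ The initial condition is $\sum_{(\beta,F)=1}N_0(\beta)\,q^{(\beta,e_9+F)}=q^{1/2}E_4/\eta^{12}$. 3. (Vanishing conditions.) Define the BPS numbers $n_h(\beta)$, for $h\le G$ and $1\le(\beta,F)\le2$, by $N_g(\beta)=\sum_{k\mid\beta}\sum_{h=0}^{g}C(h,g-h)\,k^{2g-3}\,n_h(\beta/k)$, where $\left(\frac{\sin(t/2)}{t/2}\right)^{2g-2}=\sum_{h\ge 0} C(g,h)t^{2h}$. Then $n_h(\beta)=0$ unless $h\le g_\beta$ and either $d\ge1$, $a_1,\dots,a_9\ge0$ for $\beta=dH-\sum a_ie_i$, or else $(\beta,F)=1$ and $\beta\in\{e_1,\dots,e_9\}$. Put $$Z_{g,\lambda}=\sum_{a\in\mathbb Z}N_g(\lambda+aF)\,q^{(\lambda+aF,\,e_9+F)},\qquad P_\lambda=\sum_{\mu\in W\lambda}q^{(\mu-\lambda,\,e_9+F)},$$ which are the orbit character and the multiplicity function of $\lambda$ evaluated at $\tau(e_9+F)$.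 Let $\theta_2=\sum_{n\in\mathbb Z}q^{(n+1/2)^2/2}$, $\theta_3=\sum_{n\in\mathbb Z}q^{n^2/2}$, $\theta_4=\sum_{n\in\mathbb Z}(-1)^nq^{n^2/2}$, and let $G_2=\theta_3^4+\theta_4^4$ and $G_4=\theta_2^8$, the generators of the ring of modular forms for $\Gamma_1(2)$; write $G_4^{1/2}=\theta_2^4$. **Proposition.** The minimal dominant weights of level $2$ are exactly $2\lambda_0:=6H-2(e_1+\dots+e_8)$, $\lambda_1:=H-e_1$ and $\lambda_7:=F+e_8+e_9$. Write $\lambda_0=e_9$. For every solution up to genus $G$ and level $2$, every $g\le G$ and each of these three weights $\lambda$, there is a polynomial $Q_{g,\lambda}\in\mathbb Q[E_2,G_2,G_4]$ such that for all $\tau\in\mathbb H$ (with absolute convergence of $Z_{g,\lambda}$) $$Z_{g,\lambda}=p_\lambda\,Q_{g,\lambda}(E_2,G_2,G_4),\qquad p_{2\lambda_0}=\frac{q}{\eta^{24}},\quad p_{\lambda_1}=\frac{q^2}{\eta^{24}}G_4,\quad p_{\lambda_7}=\frac{q^{3/2}}{\eta^{24}}G_4^{1/2},$$ and the orbit-wise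 holomorphic anomaly equation holds: $$p_\lambda\,\frac{\partial Q_{g,\lambda}}{\partial E_2}(E_2,G_2,G_4)=\frac{C_\lambda}{24}\sum_{g'+g''=g}Z_{g',\lambda_0}Z_{g'',\lambda_0}\,P_\lambda+\frac14Z_{g-1,\lambda},$$ with $C_{2\lambda_0}=1$, $C_{\lambda_1}=q^2/135$, $C_{\lambda_7}=q/120$ and $Z_{-1,\lambda}=0$. For $g\le3$ (and $g\le G$) the polynomials are as follows. For $2\lambda_0$: - $Q_0=\frac1{24}\{\frac1{16}(4G_2^2-3G_4)E_2+\frac18(2G_2^2-3G_4)G_2\}$ - $Q_1=\frac1{24^2\,64}\{20(4G_2^2-3G_4)E_2^2+48(2G_2^3-3G_2G_4)E_2+28G_2^4-27G_2^2G_4+27G_4^2\}$ - $Q_2=\frac1{24^4\,20}\{380(4G_2^2-3G_4)E_2^3+1080(2G_2^3-3G_2G_4)E_2^2+3(428G_2^4-387G_2^2G_4+387G_4^2)E_2+356G_2^5-636G_2^3G_4-432G_2G_4^2\}$ - $Q_3=\frac1{24^5\,1120}\{36400(4G_2^2-3G_4)E_2^4+120960(2G_2^3-3G_2G_4)E_2^3+4200(52G_2^4-45G_2^2G_4+45G_4^2)E_2^2+64(1873G_2^5-3378G_2^3G_4-2241G_2G_4^2)E_2+30444G_2^6-54117G_2^4G_4+113454G_2^2G_4^2+31995G_4^3\}$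 For $\lambda_1$: - $Q_0=\frac1{24}\{\frac1{16}E_2-\frac18G_2\}$ - $Q_1=\frac1{24^2\,64}\{20E_2^2-48G_2E_2+13G_2^2+15G_4\}$ - $Q_2=\frac1{24^4\,20}\{380E_2^3-1080G_2E_2^2+3(197G_2^2+231G_4)E_2-4(25G_2^3+153G_2G_4)\}$ - $Q_3=\frac1{24^5\,1120}\{36400E_2^4-120960G_2E_2^3+840(119G_2^2+141G_4)E_2^2-128(262G_2^3+1611G_2G_4)E_2+3(1301G_2^4+27726G_2^2G_4+11565G_4^2)\}$ For $\lambda_7$: - $Q_0=\frac1{24}\{\frac1{16}G_2E_2-\frac1{32}(G_2^2+3G_4)\}$ - $Q_1=\frac1{24^2\,64}\{20G_2E_2^2-12(G_2^2+3G_4)E_2+G_2^3+27G_2G_4\}$ - $Q_2=\frac1{24^4\,40}\{760G_2E_2^3-540(G_2^2+3G_4)E_2^2+6(17G_2^3+411G_2G_4)E_2-11G_2^4-846G_2^2G_4-567G_4^2\}$ - $Q_3=\frac1{24^5\,1120}\{36400G_2E_2^4-30240(G_2^2+3G_4)E_2^3+840(11G_2^3+249G_2G_4)E_2^2-8(223G_2^4+17838G_2^2G_4+11907G_4^2)E_2+3(29G_2^5+10206G_2^3G_4+30357G_2G_4^2)\}$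 -/

import Mathlib

/-! The second cohomology lattice of a rational elliptic surface, its affine `E₈` Weyl group,
the orbit characters of a system of numbers `N_g(β)`, and the holomorphic anomaly equation. -/

open UpperHalfPlane

noncomputable section

namespace HalfK3

/-! ### The lattice `H²(S, ℤ)` -/

/-- `H²(S, ℤ) = ℤ H ⊕ ℤ e₁ ⊕ ⋯ ⊕ ℤ e₉`; coordinate `0` is the coefficient of `H` and coordinate
`i = 1, …, 9` is the coefficient of `eᵢ`. -/
abbrev H2 : Type := Fin 10 → ℤ

/-- The cup product, extended to any coefficient ring:
`(H, H) = 1`, `(eᵢ, eᵢ) = -1`, all other products of basis vectors vanish. -/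
def pair {R : Type} [CommRing R] (x y : Fin 10 → R) : R :=
  x 0 * y 0 - ∑ i : Fin 9, x i.succ * y i.succ

/-- The class `H` of the pullback of a line. -/
def hyp : H2 := Pi.single 0 1

/-- The exceptional class `eᵢ`, for `i = 1, …, 9`. -/
def e (i : Fin 10) : H2 := Pi.single i 1

/-- The fibre class `F = 3H - e₁ - ⋯ - e₉`. -/
def fib : H2 := 3 • hyp - ∑ i : Fin 9, e i.succ

/-- The simple roots `α₀ = e₈ - e₉`, `αᵢ = eᵢ - eᵢ₊₁` for `1 ≤ i ≤ 7`,
and `α₈ = H - e₁ - e₂ - e₃`. -/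
def root : Fin 9 → H2 :=
  ![e 8 - e 9, e 1 - e 2, e 2 - e 3, e 3 - e 4, e 4 - e 5, e 5 - e 6, e 6 - e 7, e 7 - e 8,
    hyp - e 1 - e 2 - e 3]

/-- The fundamental reflection `sᵢ(x) = x + (αᵢ, x) αᵢ`. -/
def reflFun (i : Fin 9) (x : H2) : H2 := x + pair (root i) x • root i

theorem pair_root_root (i : Fin 9) : pair (root i) (root i) = -2 := by
  fin_cases i <;> decide

theorem reflFun_involutive (i : Fin 9) : Function.Involutive (reflFun i) := by
  intro x
  have h : pair (root i) (reflFun i x) = - pair (root i) x := by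
    have h2 := pair_root_root i
    have h3 : pair (root i) (reflFun i x)
        = pair (root i) x + pair (root i) x * pair (root i) (root i) := by
      simp only [pair, reflFun, Pi.add_apply, Pi.smul_apply, smul_eq_mul, Fin.sum_univ_succ,
        Finset.univ_eq_empty, Finset.sum_empty]
      ring
    rw [h3, h2]; ring
  have h' : reflFun i (reflFun i x) = reflFun i x + pair (root i) (reflFun i x) • root i := rfl
  rw [h', h]
  funext j
  simp only [reflFun, Pi.add_apply, Pi.smul_apply, smul_eq_mul]
  ring

/-- The fundamental reflection as a permutation of `H²(S, ℤ)`. -/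
def refl (i : Fin 9) : Equiv.Perm H2 := (reflFun_involutive i).toPerm

/-- The affine Weyl group of type `E₈`, acting on `H²(S, ℤ)`. -/
def weyl : Subgroup (Equiv.Perm H2) := Subgroup.closure (Set.range refl)

/-! ### Minimal dominant weights -/

/-- `d ≥ 1` and `a₁, …, a₉ ≥ 0`, where `β = d H - a₁ e₁ - ⋯ - a₉ e₉`. -/
def NonnegCoeffs (β : H2) : Prop := 1 ≤ β 0 ∧ ∀ i : Fin 9, β i.succ ≤ 0

/-- Twice the arithmetic genus, `2 g_β = (β, β) + 2 - (β, F)`. -/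
def twiceGenus (β : H2) : ℤ := pair β β + 2 - pair β fib

/-- The conditions a minimal dominant weight of level `n` has to meet
(besides having least genus). -/
def Admissible (n : ℕ) (β : H2) : Prop := 0 ≤ twiceGenus β ∧ (2 ≤ n → NonnegCoeffs β)

/-- The minimal dominant weights of level `n`: dominant integral weights `β` with `(β, F) = n`
that have the least arithmetic genus among the admissible classes of `β + ℤ F`. -/
def minimalDominant (n : ℕ) : Set H2 :=
  {β | (∀ i, 0 ≤ pair β (root i)) ∧ pair β fib = n ∧ Admissible n β ∧
    ∀ a : ℤ, Admissible n (β + a • fib) → twiceGenus β ≤ twiceGenus (β + a • fib)}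

/-- The weights `2λ₀ = 6H - 2(e₁ + ⋯ + e₈)`, `λ₁ = H - e₁` and `λ₇ = F + e₈ + e₉`. -/
def levelTwoWeight : Fin 3 → H2 :=
  ![![6, -2, -2, -2, -2, -2, -2, -2, -2, 0], hyp - e 1, fib + e 8 + e 9]

/-! ### Characters -/

/-- Extension of scalars `H²(S, ℤ) → H²(S, ℤ) ⊗ ℂ`. -/
def toC (β : H2) : Fin 10 → ℂ := fun i => (β i : ℂ)

/-- The character `e^{2πi β}`, that is `c ↦ e^{2πi (β, c)}`. -/
def chi (β : H2) (c : Fin 10 → ℂ) : ℂ := Complex.exp (2 * Real.pi * Complex.I * pair (toC β) c)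

/-- The point `τ (e₉ + F)` of `H²(S, ℤ) ⊗ ℂ`. -/
def basePoint (τ : ℍ) : Fin 10 → ℂ := (τ : ℂ) • toC (e 9 + fib)

/-- `⟨e₉, F⟩^⊥ ⊗ ℂ`, the complexification of the lattice `E₈(-1)`. -/
def E8C : Submodule ℂ (Fin 10 → ℂ) where
  carrier := {u | pair (toC (e 9)) u = 0 ∧ pair (toC fib) u = 0}
  add_mem' := by
    rintro u v ⟨h1, h2⟩ ⟨h3, h4⟩
    have key : ∀ w : Fin 10 → ℂ, pair w (u + v) = pair w u + pair w v := by
      intro w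
      simp only [pair, Pi.add_apply, mul_add, Finset.sum_add_distrib]
      ring
    exact ⟨by rw [key, h1, h3, add_zero], by rw [key, h2, h4, add_zero]⟩
  zero_mem' := by simp [pair]
  smul_mem' := by
    rintro c u ⟨h1, h2⟩
    have key : ∀ w : Fin 10 → ℂ, pair w (c • u) = c * pair w u := by
      intro w
      simp only [pair, Pi.smul_apply, smul_eq_mul, mul_sub, Finset.mul_sum]
      congr 1
      · ring
      · exact Finset.sum_congr rfl fun i _ => by ring
    exact ⟨by rw [key, h1, mul_zero], by rw [key, h2, mul_zero]⟩

/-- The `a`-th term of the orbit character `Z_{g,λ}`, evaluated at `τ (e₉ + F)`. -/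
def orbitTerm (N : ℕ → H2 → ℚ) (g : ℕ) (lam : H2) (τ : ℍ) (a : ℤ) : ℂ :=
  (N g (lam + a • fib) : ℂ) * chi (lam + a • fib) (basePoint τ)

/-- The orbit character `Z_{g,λ} = ∑_a N_g(λ + aF) e^{2πi(λ + aF)}`,
evaluated at `τ (e₉ + F)`. -/
def orbitChar (N : ℕ → H2 → ℚ) (g : ℕ) (lam : H2) (τ : ℍ) : ℂ := ∑' a : ℤ, orbitTerm N g lam τ a

/-- The multiplicity function `P_λ = ∑ e^{2πi(μ - λ)}`, `μ` in the Weyl orbit of `λ`,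
evaluated at `τ (e₉ + F)`. -/
def orbitMult (lam : H2) (τ : ℍ) : ℂ :=
  ∑' μ : MulAction.orbit weyl lam, chi (μ.1 - lam) (basePoint τ)

/-! ### The holomorphic anomaly equation -/

/-- Functions of `τ ∈ ℍ` and of `u ∈ E₈ ⊗ ℂ`. -/
abbrev Fun : Type := ℍ → E8C → ℂ

/-- `f` transforms under `SL₂(ℤ)` (on the generators `T`, `S`) as a Jacobi form of weight `w` and
index `n` for the lattice `E₈`. The cup product is negative definite on `E₈(-1)`, hence the sign
in the exponential factor. -/
def ModularLaw (w : ℤ) (n : ℕ) (f : Fun) : Prop :=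
  (∀ τ u, f ((1 : ℝ) +ᵥ τ) u = f τ u) ∧
  ∀ (τ : ℍ) (u : E8C), f (ModularGroup.S • τ) ((τ : ℂ)⁻¹ • u) =
    (τ : ℂ) ^ w * Complex.exp (-(Real.pi * Complex.I * n * pair u.1 u.1 / τ)) * f τ u

/-- `q^r = e^{2πi r τ}` for rational `r`. -/
def qPow (r : ℚ) (τ : ℍ) : ℂ := Complex.exp (2 * Real.pi * Complex.I * r * τ)

/-- The Taylor series of `sin(t/2) / (t/2)` at `t = 0`. -/
def sincHalf : PowerSeries ℚ :=
  PowerSeries.mk fun m => if Even m then (-1) ^ (m / 2) / (2 ^ m * (m + 1).factorial) else 0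

/-- The numbers `C(g, h)` in `(sin(t/2) / (t/2))^{2g-2} = ∑_h C(g, h) t^{2h}`. -/
def gvC (g h : ℕ) : ℚ :=
  PowerSeries.coeff (2 * h) (if g = 0 then sincHalf⁻¹ ^ 2 else sincHalf ^ (2 * g - 2))

/-- `nb` is the system of BPS numbers of `N` in genus `≤ G` and level `1, …, M`:
`N_g(β) = ∑_{k ∣ β} ∑_{h ≤ g} C(h, g - h) k^{2g-3} n_h(β/k)`. A positive integer `k` that divides
the class `β` divides `(β, F) > 0`. -/
def IsBPS (G M : ℕ) (N nb : ℕ → H2 → ℚ) : Prop :=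
  ∀ g ≤ G, ∀ β : H2, 1 ≤ pair β fib → pair β fib ≤ M →
    N g β = ∑ k ∈ (pair β fib).toNat.divisors with ∀ i, ((k : ℕ) : ℤ) ∣ β i,
      ∑ h ∈ Finset.range (g + 1),
        gvC h (g - h) * (k : ℚ) ^ (2 * (g : ℤ) - 3) * nb h (fun i => β i / (k : ℤ))

/-- The vanishing conditions on BPS numbers in genus `≤ G` and level `1, …, M`. -/
def Vanishing (G M : ℕ) (nb : ℕ → H2 → ℚ) : Prop :=
  ∀ h ≤ G, ∀ β : H2, 1 ≤ pair β fib → pair β fib ≤ M → nb h β ≠ 0 →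
    (2 ≤ pair β fib → NonnegCoeffs β) ∧
    (pair β fib = 1 → (∃ i : Fin 9, β = e i.succ) ∨ NonnegCoeffs β) ∧
    2 * (h : ℤ) ≤ twiceGenus β

/-- The terms of the character `∑_{(β,F)=n} N_g(β) e^{2πi β}` at the point `τ (e₉ + F) + u`. -/
def genTerm (N : ℕ → H2 → ℚ) (g n : ℕ) (τ : ℍ) (u : E8C) (β : {β : H2 // pair β fib = n}) : ℂ :=
  (N g β.1 : ℂ) * chi β.1 (basePoint τ + u.1)

/-- A Weyl invariant solution `N_g(β)` of the holomorphic anomaly equation in genus `g ≤ G` and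
level `1 ≤ n ≤ M` that satisfies the vanishing conditions. In `Φ g n` the polynomial variable
stands for `E₂`, so that `Polynomial.derivative` is `∂/∂E₂`; the prefactor `q^{n/2} / η^{12 n}`
is multiplicative in `n` and cancels from the anomaly equation. -/
structure IsSolution (G M : ℕ) (N : ℕ → H2 → ℚ) : Prop where
  weyl_inv : ∀ g ≤ G, ∀ w ∈ weyl, ∀ β : H2, N g (w β) = N g β
  anomaly : ∃ Φ : ℕ → ℕ → Polynomial Fun, ∀ g ≤ G, ∀ n : ℕ, 1 ≤ n → n ≤ M →
    (∀ k : ℕ, ModularLaw (2 * g + 6 * n - 2 - 2 * k) n ((Φ g n).coeff k)) ∧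
    (∀ τ u, HasSum (genTerm N g n τ u)
      (qPow (n / 2) τ / ModularForm.eta τ ^ (12 * n)
        * (Φ g n).eval (fun τ' _ => EisensteinSeries.E2 τ') τ u)) ∧
    Polynomial.derivative (Φ g n) =
      ∑ p ∈ Finset.HasAntidiagonal.antidiagonal g, ∑ s ∈ Finset.Ico 1 n,
        (((s * (n - s) : ℕ) : ℂ) / 24) • (Φ p.1 s * Φ p.2 (n - s))
      + if g = 0 then 0 else (((n * (n + 1) : ℕ) : ℂ) / 24) • Φ (g - 1) n
  initial : ∀ τ, HasSum (genTerm N 0 1 τ 0)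
    (qPow (1 / 2) τ * ModularForm.E₄ τ / ModularForm.eta τ ^ 12)
  vanishing : ∃ nb : ℕ → H2 → ℚ, IsBPS G M N nb ∧ Vanishing G M nb

/-! ### Modular forms for `Γ₁(2)` -/

/-- `θ₂(τ) = ∑ q^{(n + 1/2)²/2}`. -/
def theta2 (τ : ℍ) : ℂ := ∑' n : ℤ, Complex.exp (Real.pi * Complex.I * ((n : ℂ) + 1 / 2) ^ 2 * τ)

/-- `θ₃(τ) = ∑ q^{n²/2}`. -/
def theta3 (τ : ℍ) : ℂ := ∑' n : ℤ, Complex.exp (Real.pi * Complex.I * (n : ℂ) ^ 2 * τ)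

/-- `θ₄(τ) = ∑ (-1)ⁿ q^{n²/2}`. -/
def theta4 (τ : ℍ) : ℂ :=
  ∑' n : ℤ, (-1 : ℂ) ^ n * Complex.exp (Real.pi * Complex.I * (n : ℂ) ^ 2 * τ)

/-- `G₂ = θ₃⁴ + θ₄⁴`. -/
def gTwo (τ : ℍ) : ℂ := theta3 τ ^ 4 + theta4 τ ^ 4

/-- `G₄ = θ₂⁸`. -/
def gFour (τ : ℍ) : ℂ := theta2 τ ^ 8

/-- `G₄^{1/2}`, the square root `θ₂⁴ = 16 q^{1/2} + ⋯` of `G₄`. -/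
def gFourSqrt (τ : ℍ) : ℂ := theta2 τ ^ 4

/-- The value of a polynomial at `(E₂(τ), G₂(τ), G₄(τ))`. -/
def evalAt (Q : MvPolynomial (Fin 3) ℚ) (τ : ℍ) : ℂ :=
  MvPolynomial.aeval ![EisensteinSeries.E2 τ, gTwo τ, gFour τ] Q

/-- The prefactors `q/η²⁴`, `(q²/η²⁴) G₄`, `(q^{3/2}/η²⁴) G₄^{1/2}` for `2λ₀`, `λ₁`, `λ₇`. -/
def prefactor : Fin 3 → ℍ → ℂ :=
  ![fun τ => qPow 1 τ / ModularForm.eta τ ^ 24,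
    fun τ => qPow 2 τ / ModularForm.eta τ ^ 24 * gFour τ,
    fun τ => qPow (3 / 2) τ / ModularForm.eta τ ^ 24 * gFourSqrt τ]

/-- The coefficients `C_λ = 1, q²/135, q/120` for `2λ₀`, `λ₁`, `λ₇`. -/
def anomalyCoeff : Fin 3 → ℍ → ℂ := ![fun _ => 1, fun τ => qPow 2 τ / 135, fun τ => qPow 1 τ / 120]

section Explicit

open MvPolynomial

/-- The variable that stands for `E₂`. -/
abbrev x2 : MvPolynomial (Fin 3) ℚ := X 0
/-- The variable that stands for `G₂`. -/
abbrev g2 : MvPolynomial (Fin 3) ℚ := X 1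
/-- The variable that stands for `G₄`. -/
abbrev g4 : MvPolynomial (Fin 3) ℚ := X 2

/-- The polynomials in `E₂`, `G₂`, `G₄` for the weight `2λ₀` and genus `0, 1, 2, 3`. -/
def explicitZero : Fin 4 → MvPolynomial (Fin 3) ℚ :=
  ![C (1 / 24) * (C (1 / 16) * (4 * g2 ^ 2 - 3 * g4) * x2 + C (1 / 8) * (2 * g2 ^ 2 - 3 * g4) * g2),
    C (1 / (24 ^ 2 * 64)) * (20 * (4 * g2 ^ 2 - 3 * g4) * x2 ^ 2
      + 48 * (2 * g2 ^ 3 - 3 * g2 * g4) * x2 + 28 * g2 ^ 4 - 27 * g2 ^ 2 * g4 + 27 * g4 ^ 2),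
    C (1 / (24 ^ 4 * 20)) * (380 * (4 * g2 ^ 2 - 3 * g4) * x2 ^ 3
      + 1080 * (2 * g2 ^ 3 - 3 * g2 * g4) * x2 ^ 2
      + 3 * (428 * g2 ^ 4 - 387 * g2 ^ 2 * g4 + 387 * g4 ^ 2) * x2
      + 356 * g2 ^ 5 - 636 * g2 ^ 3 * g4 - 432 * g2 * g4 ^ 2),
    C (1 / (24 ^ 5 * 1120)) * (36400 * (4 * g2 ^ 2 - 3 * g4) * x2 ^ 4
      + 120960 * (2 * g2 ^ 3 - 3 * g2 * g4) * x2 ^ 3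
      + 4200 * (52 * g2 ^ 4 - 45 * g2 ^ 2 * g4 + 45 * g4 ^ 2) * x2 ^ 2
      + 64 * (1873 * g2 ^ 5 - 3378 * g2 ^ 3 * g4 - 2241 * g2 * g4 ^ 2) * x2
      + 30444 * g2 ^ 6 - 54117 * g2 ^ 4 * g4 + 113454 * g2 ^ 2 * g4 ^ 2 + 31995 * g4 ^ 3)]

/-- The polynomials in `E₂`, `G₂`, `G₄` for the weight `λ₁` and genus `0, 1, 2, 3`. -/
def explicitEven : Fin 4 → MvPolynomial (Fin 3) ℚ :=
  ![C (1 / 24) * (C (1 / 16) * x2 - C (1 / 8) * g2),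
    C (1 / (24 ^ 2 * 64)) * (20 * x2 ^ 2 - 48 * g2 * x2 + 13 * g2 ^ 2 + 15 * g4),
    C (1 / (24 ^ 4 * 20)) * (380 * x2 ^ 3 - 1080 * g2 * x2 ^ 2
      + 3 * (197 * g2 ^ 2 + 231 * g4) * x2 - 4 * (25 * g2 ^ 3 + 153 * g2 * g4)),
    C (1 / (24 ^ 5 * 1120)) * (36400 * x2 ^ 4 - 120960 * g2 * x2 ^ 3
      + 840 * (119 * g2 ^ 2 + 141 * g4) * x2 ^ 2
      - 128 * (262 * g2 ^ 3 + 1611 * g2 * g4) * x2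
      + 3 * (1301 * g2 ^ 4 + 27726 * g2 ^ 2 * g4 + 11565 * g4 ^ 2))]

/-- The polynomials in `E₂`, `G₂`, `G₄` for the weight `λ₇` and genus `0, 1, 2, 3`. -/
def explicitOdd : Fin 4 → MvPolynomial (Fin 3) ℚ :=
  ![C (1 / 24) * (C (1 / 16) * g2 * x2 - C (1 / 32) * (g2 ^ 2 + 3 * g4)),
    C (1 / (24 ^ 2 * 64)) * (20 * g2 * x2 ^ 2 - 12 * (g2 ^ 2 + 3 * g4) * x2
      + g2 ^ 3 + 27 * g2 * g4),
    C (1 / (24 ^ 4 * 40)) * (760 * g2 * x2 ^ 3 - 540 * (g2 ^ 2 + 3 * g4) * x2 ^ 2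
      + 6 * (17 * g2 ^ 3 + 411 * g2 * g4) * x2
      - 11 * g2 ^ 4 - 846 * g2 ^ 2 * g4 - 567 * g4 ^ 2),
    C (1 / (24 ^ 5 * 1120)) * (36400 * g2 * x2 ^ 4 - 30240 * (g2 ^ 2 + 3 * g4) * x2 ^ 3
      + 840 * (11 * g2 ^ 3 + 249 * g2 * g4) * x2 ^ 2
      - 8 * (223 * g2 ^ 4 + 17838 * g2 ^ 2 * g4 + 11907 * g4 ^ 2) * x2
      + 3 * (29 * g2 ^ 5 + 10206 * g2 ^ 3 * g4 + 30357 * g2 * g4 ^ 2))]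

/-- The explicit polynomials for `2λ₀`, `λ₁`, `λ₇`. -/
def explicitPoly : Fin 3 → Fin 4 → MvPolynomial (Fin 3) ℚ :=
  ![explicitZero, explicitEven, explicitOdd]

end Explicit

end HalfK3

end

noncomputable section

namespace HalfK3

/-! ### The lattice -/

/-! A class of level n is n e₉ + m F + x with x in the lattice E₈ = ⟨e₉, F⟩^⊥. At level 2 the affine
Weyl group acts on the class of x in E₈/2E₈ through reflections in roots of E₈. Every class of
positive level is conjugate to a dominant one (`exists_weyl_dominant`), and the dominant classes of
level 2 are the three weights shifted by multiples of F. Hence N_g(β) depends only on (β, β) and on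
the type of x modulo 2: zero, half norm even, or half norm odd, with 1, 135 and 120 residue classes.
The series of level 1 is therefore Z · Θ, with Θ the theta function of E₈. The series of level 2 is
a combination of the theta functions θ₀, θ₁, θ₂ of the three types, whose coefficients are the orbit
characters up to powers of q (`level_one_decomposition`, `level_two_decomposition`). Uniqueness of
Fourier coefficients in u makes the θⱼ independent at each τ (`thetaType_independent`), so
statements about series become statements about coefficients.

The functions Θ(2τ, 2u), Θ(τ/2, u) and Θ((τ+1)/2, u) span the same space as the θⱼ, and SL₂(ℤ)
permutes them up to automorphy factors and factors of 16. The coefficients of a Jacobi form of index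
2 thus amount to one modular form for Γ₀(2) together with its two conjugates
(`thetaLaw_of_modularLaw`). Such forms are polynomials in G₂ and G₄: subtract a multiple of a power
of G₂, divide by G₄, and induct on the weight (`Triple.exists_sum_monomial`). The induction stops
because the product of the three conjugates has level one, so that a form of negative weight, or
with too many zeros at the cusps, vanishes (`Triple.eq_zero_of_order`). A ℚ-linear projection of ℂ
onto ℚ makes the coefficients rational.

The square Θ² equals the sum of the θⱼ with coset theta constants as coefficients, and these
constants are polynomials in G₂ and G₄ times 1, G₄, G₄^{1/2} (`thetaE8_sq`, `thetaCoset_weightVec`).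
The anomaly equation therefore becomes a recursion for polynomials, solved by integrating in E₂. The
difference from a particular solution does not involve E₂; its coefficients are modular, hence
polynomials again. This gives Q in every genus, and comparing coefficients of θⱼ gives the
orbit-wise equation.

For g ≤ 3 the stated polynomials are a particular solution, and the remaining difference has weight
2g + 6. The vanishing conditions and the multiple cover formula fix its leading coefficients, and
the valence bound makes it zero (`ThetaLaw.eq_zero`). In genus 3 the weight is 12 and one more
coefficient is needed. It comes from N₀(λ₁) = -2, which is read off from the genus 0 solution
(`N_zero_weight_one`). -/

theorem pair_eq {R : Type} [CommRing R] (x y : Fin 10 → R) :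
    pair x y = x 0 * y 0 - (x 1 * y 1 + x 2 * y 2 + x 3 * y 3 + x 4 * y 4 + x 5 * y 5 + x 6 * y 6
      + x 7 * y 7 + x 8 * y 8 + x 9 * y 9) := by
  simp only [pair, Fin.sum_univ_succ, Finset.univ_eq_empty, Finset.sum_empty]
  simp only [Fin.succ_zero_eq_one, Fin.succ_one_eq_two, Fin.reduceSucc]
  ring

theorem fib_eq : fib = ![3, -1, -1, -1, -1, -1, -1, -1, -1, -1] := by decide

theorem e_nine_eq : e 9 = ![0, 0, 0, 0, 0, 0, 0, 0, 0, 1] := by decide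

theorem root_eq : root = ![![0, 0, 0, 0, 0, 0, 0, 0, 1, -1], ![0, 1, -1, 0, 0, 0, 0, 0, 0, 0],
    ![0, 0, 1, -1, 0, 0, 0, 0, 0, 0], ![0, 0, 0, 1, -1, 0, 0, 0, 0, 0],
    ![0, 0, 0, 0, 1, -1, 0, 0, 0, 0], ![0, 0, 0, 0, 0, 1, -1, 0, 0, 0],
    ![0, 0, 0, 0, 0, 0, 1, -1, 0, 0], ![0, 0, 0, 0, 0, 0, 0, 1, -1, 0],
    ![1, -1, -1, -1, 0, 0, 0, 0, 0, 0]] := by decide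

theorem levelTwoWeight_eq : levelTwoWeight = ![![6, -2, -2, -2, -2, -2, -2, -2, -2, 0],
    ![1, -1, 0, 0, 0, 0, 0, 0, 0, 0], ![3, -1, -1, -1, -1, -1, -1, -1, 0, 0]] := by decide

theorem pair_comm' {R : Type} [CommRing R] (x y : Fin 10 → R) : pair x y = pair y x := by
  simp only [pair_eq]; ring

theorem pair_add_left {R : Type} [CommRing R] (x y z : Fin 10 → R) :
    pair (x + y) z = pair x z + pair y z := by
  simp only [pair_eq, Pi.add_apply]; ring

theorem pair_add_right {R : Type} [CommRing R] (x y z : Fin 10 → R) :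
    pair x (y + z) = pair x y + pair x z := by
  simp only [pair_eq, Pi.add_apply]; ring

theorem pair_smul_left {R : Type} [CommRing R] (c : R) (x y : Fin 10 → R) :
    pair (c • x) y = c * pair x y := by
  simp only [pair_eq, Pi.smul_apply, smul_eq_mul]; ring

theorem pair_smul_right {R : Type} [CommRing R] (c : R) (x y : Fin 10 → R) :
    pair x (c • y) = c * pair x y := by
  simp only [pair_eq, Pi.smul_apply, smul_eq_mul]; ring

theorem pair_sub_left {R : Type} [CommRing R] (x y z : Fin 10 → R) :
    pair (x - y) z = pair x z - pair y z := by
  simp only [pair_eq, Pi.sub_apply]; ring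

theorem pair_sub_right {R : Type} [CommRing R] (x y z : Fin 10 → R) :
    pair x (y - z) = pair x y - pair x z := by
  simp only [pair_eq, Pi.sub_apply]; ring

theorem pair_root_fib (i : Fin 9) : pair (root i) fib = 0 := by
  fin_cases i <;> decide

theorem pair_fib_fib : pair fib fib = 0 := by decide

theorem pair_e_nine_fib : pair (e 9) fib = 1 := by decide

theorem pair_e_nine_self : pair (e 9) (e 9) = -1 := by decide

theorem pair_reflFun_fib (i : Fin 9) (β : H2) : pair (reflFun i β) fib = pair β fib := by
  rw [reflFun, pair_add_left, pair_smul_left, pair_root_fib]; ring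

theorem pair_reflFun_self (i : Fin 9) (β : H2) :
    pair (reflFun i β) (reflFun i β) = pair β β := by
  have h := pair_root_root i
  have hc := pair_comm' (root i) β
  simp only [reflFun, pair_add_left, pair_add_right, pair_smul_left, pair_smul_right, h, hc]
  ring

/-- A function that is invariant under the fundamental reflections on a given level is invariant
under the Weyl group on that level. -/
theorem weyl_invariant_on_level {X : Type*} {n : ℤ} {f : H2 → X}
    (hf : ∀ i β, pair β fib = n → f (reflFun i β) = f β) {w : Equiv.Perm H2} (hw : w ∈ weyl)
    {β : H2} (hβ : pair β fib = n) : pair (w β) fib = n ∧ f (w β) = f β := by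
  induction hw using Subgroup.closure_induction generalizing β with
  | mem x hx =>
    obtain ⟨i, rfl⟩ := hx
    exact ⟨(pair_reflFun_fib i β).trans hβ, hf i β hβ⟩
  | one => exact ⟨hβ, rfl⟩
  | mul x y _ _ hx hy =>
    have h1 := hy hβ
    have h2 := hx h1.1
    exact ⟨h2.1, h2.2.trans h1.2⟩
  | inv x hxw hx =>
    -- The induction hypothesis for x can be used at x⁻¹ β only after x⁻¹ β is known to have level
    -- n, so preservation of the level is proved first for all of W.
    have hlev : pair (x⁻¹ β) fib = n := by
      have key : ∀ y ∈ weyl, ∀ γ, pair (y γ) fib = pair γ fib := by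
        intro y hy
        induction hy using Subgroup.closure_induction with
        | mem x hx => obtain ⟨i, rfl⟩ := hx; exact pair_reflFun_fib i
        | one => intro γ; rfl
        | mul x y _ _ hx hy => intro γ; exact (hx _).trans (hy _)
        | inv x _ hx => intro γ; rw [← hx (x⁻¹ γ)]; simp
      rw [key x⁻¹ (inv_mem hxw), hβ]
    refine ⟨hlev, ?_⟩
    have := (hx hlev).2
    simpa using this.symm

theorem pair_weyl_fib {w : Equiv.Perm H2} (hw : w ∈ weyl) (β : H2) :
    pair (w β) fib = pair β fib :=
  (weyl_invariant_on_level (f := fun _ => ()) (fun _ _ _ => rfl) hw rfl).1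

theorem pair_weyl_self {w : Equiv.Perm H2} (hw : w ∈ weyl) (β : H2) :
    pair (w β) (w β) = pair β β :=
  (weyl_invariant_on_level (f := fun β => pair β β) (fun i β _ => pair_reflFun_self i β) hw rfl).2

/-- A class that pairs to `1` with every simple root. -/
def weylVector : H2 := ![22, -8, -7, -6, -5, -4, -3, -2, -1, 0]

theorem pair_root_weylVector (i : Fin 9) : pair (root i) weylVector = 1 := by
  fin_cases i <;> decide

/-- Cauchy–Schwarz: orthogonality to F says 3 z₀ = -(z₁ + ⋯ + z₉), so 9 z₀² is at most 9 (z₁² + ⋯ +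
z₉²). -/
theorem pair_self_nonpos_of_pair_fib {z : H2} (hz : pair z fib = 0) : pair z z ≤ 0 := by
  rw [pair_eq, fib_eq] at hz
  simp at hz
  have h : 3 * z 0 = -(z 1 + z 2 + z 3 + z 4 + z 5 + z 6 + z 7 + z 8 + z 9) := by linarith
  have h2 : 9 * (z 0 * z 0) = (z 1 + z 2 + z 3 + z 4 + z 5 + z 6 + z 7 + z 8 + z 9) ^ 2 := by
    linear_combination (3 * z 0 - (z 1 + z 2 + z 3 + z 4 + z 5 + z 6 + z 7 + z 8 + z 9)) * h
  have h3 := sq_sum_le_card_mul_sum_sq (s := (Finset.univ : Finset (Fin 9)))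
    (f := fun i => z i.succ)
  simp only [Fin.sum_univ_succ, Finset.univ_eq_empty, Finset.sum_empty] at h3
  simp [Fin.succ_zero_eq_one, Fin.succ_one_eq_two, Fin.reduceSucc] at h3
  rw [pair_eq]
  nlinarith

/-- Descent: reflecting in a simple root α with (β, α) < 0 lowers the pairing with the Weyl vector ρ
by |(β, α)| and keeps (β, β) and the level n. Since 30 β - n ρ is orthogonal to F, where 30 = (ρ,
F), its square is non-positive, and this bounds (β, ρ) from below. -/
theorem exists_weyl_dominant (β : H2) (hβ : 0 < pair β fib) :
    ∃ w ∈ weyl, ∀ i, 0 ≤ pair (w β) (root i) := by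
  -- The measure is minus the square of 30 β - n ρ, with (ρ, F) = 30 and (ρ, ρ) = 280.
  obtain ⟨k, hk⟩ : ∃ k : ℕ, 60 * pair β fib * pair β weylVector - 900 * pair β β
      - 280 * pair β fib ^ 2 = k := by
    refine ⟨_, (Int.toNat_of_nonneg ?_).symm⟩
    have h1 : pair weylVector fib = 30 := by decide
    have h2 : pair weylVector weylVector = 280 := by decide
    have h := pair_self_nonpos_of_pair_fib (z := (30 : ℤ) • β - pair β fib • weylVector) (by
      rw [pair_sub_left, pair_smul_left, pair_smul_left, h1]; ring)
    simp only [pair_sub_left, pair_sub_right, pair_smul_left, pair_smul_right, h2,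
      pair_comm' weylVector β] at h
    linarith
  induction k using Nat.strong_induction_on generalizing β with
  | _ k ih =>
    by_cases hd : ∀ i, 0 ≤ pair β (root i)
    · exact ⟨1, one_mem _, hd⟩
    push Not at hd
    obtain ⟨i, hi⟩ := hd
    have hlt : pair (reflFun i β) weylVector = pair β weylVector + pair β (root i) := by
      rw [reflFun, pair_add_left, pair_smul_left, pair_root_weylVector, pair_comm' (root i) β,
        mul_one]
    have hl := pair_reflFun_fib i β
    have hs := pair_reflFun_self i β
    have hdec : 60 * pair β fib * pair (reflFun i β) weylVector
        < 60 * pair β fib * pair β weylVector := by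
      rw [hlt]; nlinarith
    have hnn : 0 ≤ 60 * pair (reflFun i β) fib * pair (reflFun i β) weylVector
        - 900 * pair (reflFun i β) (reflFun i β) - 280 * pair (reflFun i β) fib ^ 2 := by
      have h1 : pair weylVector fib = 30 := by decide
      have h2 : pair weylVector weylVector = 280 := by decide
      have h := pair_self_nonpos_of_pair_fib
        (z := (30 : ℤ) • reflFun i β - pair (reflFun i β) fib • weylVector) (by
        rw [pair_sub_left, pair_smul_left, pair_smul_left, h1]; ring)
      simp only [pair_sub_left, pair_sub_right, pair_smul_left, pair_smul_right, h2,
        pair_comm' weylVector (reflFun i β)] at h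
      linarith
    obtain ⟨w, hw, hwd⟩ := ih _ (by
        have : ((60 * pair (reflFun i β) fib * pair (reflFun i β) weylVector
          - 900 * pair (reflFun i β) (reflFun i β) - 280 * pair (reflFun i β) fib ^ 2).toNat : ℤ)
          < k := by
          rw [Int.toNat_of_nonneg hnn, hl, hs]; linarith
        exact_mod_cast this) (reflFun i β) (by rw [hl]; exact hβ) (Int.toNat_of_nonneg hnn).symm
    exact ⟨w * refl i, mul_mem hw (Subgroup.subset_closure ⟨i, rfl⟩), hwd⟩

/-! ### Dominant classes of levels one and two -/

theorem dominant_coords {β : H2} (hd : ∀ i, 0 ≤ pair β (root i)) :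
    β 8 ≤ β 9 ∧ β 1 ≤ β 2 ∧ β 2 ≤ β 3 ∧ β 3 ≤ β 4 ∧ β 4 ≤ β 5 ∧ β 5 ≤ β 6 ∧ β 6 ≤ β 7 ∧
      β 7 ≤ β 8 ∧ 0 ≤ β 0 + β 1 + β 2 + β 3 := by
  rw [root_eq] at hd
  have h0 := hd 0
  have h1 := hd 1
  have h2 := hd 2
  have h3 := hd 3
  have h4 := hd 4
  have h5 := hd 5
  have h6 := hd 6
  have h7 := hd 7
  have h8 := hd 8
  simp only [pair_eq] at h0 h1 h2 h3 h4 h5 h6 h7 h8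
  simp at h0 h1 h2 h3 h4 h5 h6 h7 h8
  refine ⟨?_, ?_, ?_, ?_, ?_, ?_, ?_, ?_, ?_⟩ <;> linarith

theorem pair_fib_coords (β : H2) : pair β fib =
    3 * β 0 + (β 1 + β 2 + β 3 + β 4 + β 5 + β 6 + β 7 + β 8 + β 9) := by
  rw [pair_eq, fib_eq]; simp; ring

theorem ext_ten {β γ : H2} (h : β 0 = γ 0 ∧ β 1 = γ 1 ∧ β 2 = γ 2 ∧ β 3 = γ 3 ∧ β 4 = γ 4 ∧
    β 5 = γ 5 ∧ β 6 = γ 6 ∧ β 7 = γ 7 ∧ β 8 = γ 8 ∧ β 9 = γ 9) : β = γ := by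
  obtain ⟨h0, h1, h2, h3, h4, h5, h6, h7, h8, h9⟩ := h
  funext i
  fin_cases i <;> assumption

/-- F is the null root α₀ + 2α₇ + 3α₆ + 4α₅ + 5α₄ + 6α₃ + 4α₂ + 2α₁ + 3α₈, so the level is the sum
of the pairings with the simple roots weighted by these marks. Level 1 leaves only (β, α₀) = 1. -/
theorem dominant_level_one {β : H2} (hd : ∀ i, 0 ≤ pair β (root i)) (hl : pair β fib = 1) :
    ∃ a : ℤ, β = e 9 + a • fib := by
  obtain ⟨h0, h1, h2, h3, h4, h5, h6, h7, h8⟩ := dominant_coords hd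
  rw [pair_fib_coords] at hl
  have e2 : β 3 = β 2 := le_antisymm (by linarith) h2
  have e3 : β 4 = β 3 := le_antisymm (by linarith) h3
  have e4 : β 5 = β 4 := le_antisymm (by linarith) h4
  have e5 : β 6 = β 5 := le_antisymm (by linarith) h5
  have e6 : β 7 = β 6 := le_antisymm (by linarith) h6
  have e8 : β 0 + β 1 + β 2 + β 3 = 0 := le_antisymm (by linarith) h8
  have e1 : β 2 = β 1 := le_antisymm (by linarith) h1
  have e7 : β 8 = β 7 := le_antisymm (by linarith) h7
  refine ⟨1 - β 9, ext_ten ?_⟩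
  rw [e_nine_eq, fib_eq]
  simp
  omega

/-- With the same marks, level 2 allows the value 2 on α₀, or the value 1 on one of the two roots
with mark 2. These roots are α₁ and α₇. The case distinction below separates the three
possibilities, and the coordinate β 9 determines the multiple of F. -/
theorem dominant_level_two {β : H2} (hd : ∀ i, 0 ≤ pair β (root i)) (hl : pair β fib = 2) :
    ∃ (j : Fin 3) (a : ℤ), β = levelTwoWeight j + a • fib := by
  obtain ⟨h0, h1, h2, h3, h4, h5, h6, h7, h8⟩ := dominant_coords hd
  rw [pair_fib_coords] at hl
  have e2 : β 3 = β 2 := le_antisymm (by linarith) h2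
  have e3 : β 4 = β 3 := le_antisymm (by linarith) h3
  have e4 : β 5 = β 4 := le_antisymm (by linarith) h4
  have e5 : β 6 = β 5 := le_antisymm (by linarith) h5
  have e6 : β 7 = β 6 := le_antisymm (by linarith) h6
  have e8 : β 0 + β 1 + β 2 + β 3 = 0 := le_antisymm (by linarith) h8
  rw [levelTwoWeight_eq, fib_eq]
  rcases lt_or_ge (β 8) (β 9) with h | h
  · refine ⟨0, -β 9, ext_ten ?_⟩
    simp
    omega
  rcases lt_or_ge (β 1) (β 2) with h' | h'
  · refine ⟨1, -β 9, ext_ten ?_⟩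
    simp
    omega
  · refine ⟨2, -β 9, ext_ten ?_⟩
    simp
    omega

theorem twiceGenus_levelTwoWeight (j : Fin 3) (a : ℤ) :
    twiceGenus (levelTwoWeight j + a • fib) = ![4, 0, 2] j + 4 * a := by
  rw [twiceGenus]
  simp only [pair_add_left, pair_add_right, pair_smul_left, pair_smul_right]
  have h1 : pair (levelTwoWeight j) (levelTwoWeight j) = ![4, 0, 2] j := by
    fin_cases j <;> decide
  have h2 : pair (levelTwoWeight j) fib = 2 := by fin_cases j <;> decide
  rw [pair_fib_fib, pair_comm' fib, h1, h2]
  ring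

theorem nonnegCoeffs_levelTwoWeight (j : Fin 3) {a : ℤ} (ha : 0 ≤ a) :
    NonnegCoeffs (levelTwoWeight j + a • fib) := by
  rw [NonnegCoeffs, levelTwoWeight_eq, fib_eq]
  constructor
  · fin_cases j <;> simp <;> omega
  · intro i
    fin_cases j <;> fin_cases i <;> simp <;> omega

theorem nonneg_of_nonnegCoeffs_levelTwoWeight (j : Fin 3) {a : ℤ}
    (ha : NonnegCoeffs (levelTwoWeight j + a • fib)) : 0 ≤ a := by
  rw [NonnegCoeffs, levelTwoWeight_eq, fib_eq] at ha
  have := ha.2 8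
  fin_cases j <;> simpa using this

theorem dominant_levelTwoWeight (j : Fin 3) (a : ℤ) (i : Fin 9) :
    0 ≤ pair (levelTwoWeight j + a • fib) (root i) := by
  rw [pair_add_left, pair_smul_left, pair_comm' fib, pair_root_fib, mul_zero, add_zero]
  fin_cases j <;> fin_cases i <;> decide

theorem pair_levelTwoWeight_fib (j : Fin 3) : pair (levelTwoWeight j) fib = 2 := by
  fin_cases j <;> decide

/-- Adding F raises twice the genus by 4, so the genus is strictly increasing along λ + ℤ F. The
coordinate of e₉, which is zero for all three weights, bounds the admissible multiples of F below by
0, and the multiple 0 is admissible. -/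
theorem minimalDominant_two : minimalDominant 2 = Set.range levelTwoWeight := by
  ext β
  constructor
  · rintro ⟨hd, hl, hadm, hmin⟩
    obtain ⟨j, a, rfl⟩ := dominant_level_two hd hl
    refine ⟨j, ?_⟩
    have ha := nonneg_of_nonnegCoeffs_levelTwoWeight j (hadm.2 le_rfl)
    have h := hmin (-a)
    rw [add_assoc, ← add_smul, add_neg_cancel] at h
    have h2 := h ⟨by
      rw [twiceGenus_levelTwoWeight]; fin_cases j <;> decide,
      fun _ => nonnegCoeffs_levelTwoWeight j le_rfl⟩
    rw [twiceGenus_levelTwoWeight, twiceGenus_levelTwoWeight] at h2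
    have : a = 0 := by linarith
    rw [this]; simp
  · rintro ⟨j, rfl⟩
    have h0 : levelTwoWeight j + (0 : ℤ) • fib = levelTwoWeight j := by simp
    refine ⟨fun i => by rw [← h0]; exact dominant_levelTwoWeight j 0 i,
      by rw [pair_levelTwoWeight_fib]; rfl, ⟨?_, fun _ => ?_⟩, ?_⟩
    · rw [← h0, twiceGenus_levelTwoWeight]; fin_cases j <;> decide
    · rw [← h0]; exact nonnegCoeffs_levelTwoWeight j le_rfl
    · intro a ha
      have := nonneg_of_nonnegCoeffs_levelTwoWeight j (ha.2 le_rfl)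
      nth_rewrite 1 [← h0]
      rw [twiceGenus_levelTwoWeight, twiceGenus_levelTwoWeight]
      linarith

/-! ### The sublattice `E₈ = ⟨e₉, F⟩^⊥` -/

/-- The lattice `E₈` in coordinates. -/
abbrev E8 : Type := Fin 8 → ℤ

/-- The embedding of `E₈` as `⟨e₉, F⟩^⊥`. -/
def emb : E8 →+ H2 where
  toFun x := ![x 0, x 1, x 2, x 3, x 4, x 5, x 6, x 7,
    -(3 * x 0 + x 1 + x 2 + x 3 + x 4 + x 5 + x 6 + x 7), 0]
  map_zero' := by decide
  map_add' x y := by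
    refine ext_ten ?_
    simp
    ring

theorem emb_apply (x : E8) : emb x = ![x 0, x 1, x 2, x 3, x 4, x 5, x 6, x 7,
    -(3 * x 0 + x 1 + x 2 + x 3 + x 4 + x 5 + x 6 + x 7), 0] := rfl

/-- Half the norm of a vector of `E₈`. -/
def qE (x : E8) : ℤ :=
  4 * x 0 ^ 2 + 3 * x 0 * (x 1 + x 2 + x 3 + x 4 + x 5 + x 6 + x 7)
    + (x 1 ^ 2 + x 2 ^ 2 + x 3 ^ 2 + x 4 ^ 2 + x 5 ^ 2 + x 6 ^ 2 + x 7 ^ 2)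
    + (x 1 * (x 2 + x 3 + x 4 + x 5 + x 6 + x 7) + x 2 * (x 3 + x 4 + x 5 + x 6 + x 7)
      + x 3 * (x 4 + x 5 + x 6 + x 7) + x 4 * (x 5 + x 6 + x 7) + x 5 * (x 6 + x 7) + x 6 * x 7)

/-- The inner product of `E₈`. -/
def bE (x y : E8) : ℤ := -pair (emb x) (emb y)

theorem pair_emb_emb (x y : E8) : pair (emb x) (emb y) = -bE x y := by rw [bE, neg_neg]

theorem bE_self (x : E8) : bE x x = 2 * qE x := by
  rw [bE, pair_eq, emb_apply, qE]; simp; ring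

theorem pair_emb_self (x : E8) : pair (emb x) (emb x) = -2 * qE x := by
  rw [pair_emb_emb, bE_self]; ring

theorem bE_comm (x y : E8) : bE x y = bE y x := by rw [bE, pair_comm', bE]

theorem bE_add_left (x y z : E8) : bE (x + y) z = bE x z + bE y z := by
  simp only [bE, map_add, pair_add_left]; ring

theorem bE_add_right (x y z : E8) : bE x (y + z) = bE x y + bE x z := by
  simp only [bE, map_add, pair_add_right]; ring

theorem bE_zsmul_right (c : ℤ) (x y : E8) : bE x (c • y) = c * bE x y := by
  simp only [bE, map_zsmul, pair_smul_right]; ring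

theorem bE_zsmul_left (c : ℤ) (x y : E8) : bE (c • x) y = c * bE x y := by
  simp only [bE, map_zsmul, pair_smul_left]; ring

theorem qE_add (x y : E8) : qE (x + y) = qE x + qE y + bE x y := by
  have h := bE_self (x + y)
  rw [bE_add_left, bE_add_right, bE_add_right, bE_self, bE_self, bE_comm y x] at h
  linarith

theorem qE_zsmul (c : ℤ) (x : E8) : qE (c • x) = c ^ 2 * qE x := by
  have h := bE_self (c • x)
  rw [bE_zsmul_left, bE_zsmul_right, bE_self] at h
  linarith

theorem qE_zero : qE 0 = 0 := by decide

theorem pair_emb_fib (x : E8) : pair (emb x) fib = 0 := by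
  rw [pair_fib_coords, emb_apply]; simp

theorem qE_nonneg (x : E8) : 0 ≤ qE x := by
  have h : pair (emb x) fib = 0 := pair_emb_fib x
  have h2 := pair_self_nonpos_of_pair_fib h
  rw [pair_emb_self] at h2
  linarith

theorem pair_emb_e_nine (x : E8) : pair (emb x) (e 9) = 0 := by
  rw [pair_eq, emb_apply, e_nine_eq]; simp

/-- The class `n e₉ + m F + x`. -/
def cls (n m : ℤ) (x : E8) : H2 := n • e 9 + m • fib + emb x

/-- The orthogonal projection to `E₈`. -/
def proj (β : H2) : E8 := fun i => β (i.castAdd 2) - (pair β (e 9) + pair β fib) * fib (i.castAdd 2)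

theorem pair_cls_fib (n m : ℤ) (x : E8) : pair (cls n m x) fib = n := by
  rw [cls, pair_add_left, pair_add_left, pair_smul_left, pair_smul_left, pair_emb_fib, pair_fib_fib,
    pair_e_nine_fib]; ring

theorem pair_fib_e_nine : pair fib (e 9) = 1 := by decide

theorem pair_cls_e_nine (n m : ℤ) (x : E8) : pair (cls n m x) (e 9) = m - n := by
  rw [cls, pair_add_left, pair_add_left, pair_smul_left, pair_smul_left, pair_emb_e_nine,
    pair_fib_e_nine, pair_e_nine_self]; ring

theorem pair_cls_self (n m : ℤ) (x : E8) :
    pair (cls n m x) (cls n m x) = -n ^ 2 + 2 * n * m - 2 * qE x := by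
  conv_lhs => rw [cls]
  simp only [pair_add_left, pair_add_right, pair_smul_left, pair_smul_right, pair_emb_self,
    pair_emb_fib, pair_emb_e_nine, pair_comm' (e 9) (emb x), pair_comm' fib (emb x),
    pair_fib_e_nine, pair_e_nine_self, pair_e_nine_fib, pair_fib_fib]
  ring

theorem proj_cls (n m : ℤ) (x : E8) : proj (cls n m x) = x := by
  funext i
  rw [proj, pair_cls_fib, pair_cls_e_nine, cls, emb_apply, fib_eq, e_nine_eq]
  fin_cases i <;> simp

/-- As e₉ has square -1 and (F, e₉) = 1, pairing with e₉ gives m - n. This is why the coefficient of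
F is recovered as (β, e₉) + (β, F). -/
theorem cls_proj (β : H2) :
    cls (pair β fib) (pair β (e 9) + pair β fib) (proj β) = β := by
  refine ext_ten ?_
  rw [cls, emb_apply]
  simp only [proj, fib_eq, e_nine_eq, pair_eq]
  simp
  refine ⟨?_, ?_⟩ <;> ring

/-- Classes of level `n` in the coordinates `(m, x)`. -/
def levelEquiv (n : ℤ) : ℤ × E8 ≃ {β : H2 // pair β fib = n} where
  toFun p := ⟨cls n p.1 p.2, pair_cls_fib n p.1 p.2⟩
  invFun β := (pair β.1 (e 9) + n, proj β.1)
  left_inv p := by simp [pair_cls_e_nine, proj_cls]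
  right_inv β := by
    obtain ⟨β, rfl⟩ := β
    exact Subtype.ext (cls_proj β)

/-! ### Types of vectors of `E₈` modulo `2` -/

open Classical in
/-- The orbit in `E₈ / 2 E₈` of a vector: `0`, norm `4`, norm `2`. -/
def vecType (x : E8) : Fin 3 :=
  if Odd (qE x) then 2 else if ∃ y, x = (2 : ℤ) • y then 0 else 1

/-- The half norm modulo 2 therefore descends to E₈/2E₈, which makes the type well defined on
residue classes. -/
theorem qE_add_two_smul (x z : E8) :
    qE (x + (2 : ℤ) • z) = qE x + 2 * (bE x z + 2 * qE z) := by
  rw [qE_add, qE_zsmul, bE_zsmul_right]; ring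

open Classical in
theorem vecType_congr {x y : E8} (h : ∃ z, y = x + (2 : ℤ) • z) : vecType y = vecType x := by
  obtain ⟨z, rfl⟩ := h
  have h1 : Odd (qE (x + (2 : ℤ) • z)) ↔ Odd (qE x) := by
    rw [qE_add_two_smul, Int.odd_add]
    simp
  have h2 : (∃ y, x + (2 : ℤ) • z = (2 : ℤ) • y) ↔ ∃ y, x = (2 : ℤ) • y := by
    constructor
    · rintro ⟨y, hy⟩
      exact ⟨y - z, by rw [smul_sub, ← hy]; simp⟩
    · rintro ⟨y, rfl⟩
      exact ⟨y + z, by rw [smul_add]⟩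
  exact if_congr h1 rfl (if_congr h2 rfl rfl)

/-- The reflection of `E₈` in `a`. -/
def reflE (a x : E8) : E8 := x - bE x a • a

theorem qE_neg (x : E8) : qE (-x) = qE x := by
  have := qE_zsmul (-1) x
  simpa using this

theorem qE_reflE {a : E8} (ha : qE a = 1) (x : E8) : qE (reflE a x) = qE x := by
  rw [reflE, sub_eq_add_neg, ← neg_zsmul, qE_add, qE_zsmul, bE_zsmul_right, ha]; ring

theorem reflE_reflE {a : E8} (ha : qE a = 1) (x : E8) : reflE a (reflE a x) = x := by
  have h : bE (reflE a x) a = - bE x a := by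
    rw [reflE, sub_eq_add_neg, bE_add_left, ← neg_zsmul, bE_zsmul_left, bE_self, ha]; ring
  rw [reflE, h, reflE]; simp

theorem reflE_add (a x y : E8) : reflE a (x + y) = reflE a x + reflE a y := by
  simp only [reflE, bE_add_left, add_smul]; abel

theorem reflE_zsmul (a x : E8) (c : ℤ) : reflE a (c • x) = c • reflE a x := by
  simp only [reflE, bE_zsmul_left, smul_sub, mul_smul]

open Classical in
theorem vecType_reflE {a : E8} (ha : qE a = 1) (x : E8) : vecType (reflE a x) = vecType x := by
  have h2 : (∃ y, reflE a x = (2 : ℤ) • y) ↔ ∃ y, x = (2 : ℤ) • y := by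
    constructor
    · rintro ⟨y, hy⟩
      exact ⟨reflE a y, by rw [← reflE_zsmul, ← hy, reflE_reflE ha]⟩
    · rintro ⟨y, rfl⟩
      exact ⟨reflE a y, reflE_zsmul a y 2⟩
  exact if_congr (by rw [qE_reflE ha]) rfl (if_congr h2 rfl rfl)

theorem qE_proj_root (i : Fin 9) : qE (proj (root i)) = 1 := by
  fin_cases i <;> decide

theorem proj_add (β γ : H2) : proj (β + γ) = proj β + proj γ := by
  funext i
  simp only [proj, pair_add_left, Pi.add_apply]; ring

theorem proj_zsmul (c : ℤ) (β : H2) : proj (c • β) = c • proj β := by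
  funext i
  simp only [proj, pair_smul_left, Pi.smul_apply, smul_eq_mul]; ring

/-- The e₉-part of a class of level 2 contributes an even number to the pairing with a root, and F
contributes nothing. Modulo 2 the affine reflection is thus the reflection of E₈ in the projected
root. -/
theorem pair_root_level_two (i : Fin 9) {β : H2} (hβ : pair β fib = 2) :
    ∃ k : ℤ, pair (root i) β = 2 * k - bE (proj β) (proj (root i)) := by
  refine ⟨pair (root i) (e 9), ?_⟩
  conv_lhs => rw [← cls_proj β, ← cls_proj (root i), pair_root_fib, hβ]
  simp only [cls, pair_add_left, pair_add_right, pair_smul_left, pair_smul_right, pair_emb_emb,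
    pair_emb_fib, pair_emb_e_nine, pair_comm' (e 9) (emb _), pair_comm' fib (emb _),
    pair_fib_e_nine, pair_e_nine_self, pair_e_nine_fib, pair_fib_fib]
  rw [bE_comm]; ring

theorem proj_reflFun (i : Fin 9) {β : H2} (hβ : pair β fib = 2) :
    ∃ z, proj (reflFun i β) = reflE (proj (root i)) (proj β) + (2 : ℤ) • z := by
  obtain ⟨k, hk⟩ := pair_root_level_two i hβ
  refine ⟨k • proj (root i), ?_⟩
  rw [reflFun, proj_add, proj_zsmul, hk, reflE, sub_smul, mul_smul]
  abel

/-- A function on `E₈ / 2 E₈` that is invariant under reflections in roots is invariant under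
the action of the affine Weyl group on classes of level `2`. -/
theorem proj_weyl {X : Type*} {f : E8 → X} (h2 : ∀ x z, f (x + (2 : ℤ) • z) = f x)
    (hr : ∀ a x, qE a = 1 → f (reflE a x) = f x) {w : Equiv.Perm H2} (hw : w ∈ weyl) {β : H2}
    (hβ : pair β fib = 2) : f (proj (w β)) = f (proj β) := by
  refine (weyl_invariant_on_level (f := fun β => f (proj β)) ?_ hw hβ).2
  intro i β hβ
  obtain ⟨z, hz⟩ := proj_reflFun i hβ
  simp only [hz, h2]
  exact hr _ _ (qE_proj_root i)

theorem vecType_proj_weyl {w : Equiv.Perm H2} (hw : w ∈ weyl) {β : H2}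
    (hβ : pair β fib = 2) : vecType (proj (w β)) = vecType (proj β) :=
  proj_weyl (fun _ z => vecType_congr ⟨z, rfl⟩) (fun _ _ ha => vecType_reflE ha _) hw hβ

/-- The projections of the weights `2λ₀, λ₁, λ₇`. -/
def weightVec (j : Fin 3) : E8 := proj (levelTwoWeight j)

/-- Half the norms of the projections of the weights. -/
def weightNorm : Fin 3 → ℤ := ![0, 2, 1]

theorem qE_weightVec (j : Fin 3) : qE (weightVec j) = weightNorm j := by
  fin_cases j <;> decide

theorem levelTwoWeight_add (j : Fin 3) (a : ℤ) :
    levelTwoWeight j + a • fib = cls 2 (2 + a) (weightVec j) := by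
  have h : levelTwoWeight j = cls 2 2 (weightVec j) := by fin_cases j <;> decide
  rw [h, cls, cls, add_smul]; abel

theorem vecType_weightVec (j : Fin 3) : vecType (weightVec j) = j := by
  fin_cases j
  · have h : weightVec 0 = 0 := by decide
    have h2 : ∃ y : E8, (0 : E8) = (2 : ℤ) • y := ⟨0, by simp⟩
    simp only [Fin.zero_eta, h, vecType, qE_zero, h2, if_true]
    simp
  · have h : ¬ Odd (qE (weightVec 1)) := by decide
    have h2 : ¬ ∃ y, weightVec 1 = (2 : ℤ) • y := by
      rintro ⟨y, hy⟩
      have h0 : weightVec 1 0 = 2 * y 0 := by rw [hy]; rfl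
      have h1 : weightVec 1 0 = -5 := by decide
      omega
    simp only [Fin.mk_one, vecType, h, h2, if_false]
  · have h : Odd (qE (weightVec 2)) := by decide
    simp only [Fin.reduceFinMk, vecType, h, if_true]

theorem two_dvd_qE_sub (x : E8) : 2 ∣ qE x - weightNorm (vecType x) := by
  rw [vecType]
  split_ifs with h h'
  · have : Odd (weightNorm 2) := by decide
    exact (h.sub_odd this).two_dvd
  · have : Even (weightNorm 0) := by decide
    exact ((Int.not_odd_iff_even.mp h).sub this).two_dvd
  · have : Even (weightNorm 1) := by decide
    exact ((Int.not_odd_iff_even.mp h).sub this).two_dvd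

/-- Half the difference of the half norms of `x` and of the weight of its type. -/
def normShift (x : E8) : ℤ := (qE x - weightNorm (vecType x)) / 2

theorem two_mul_normShift (x : E8) : 2 * normShift x = qE x - weightNorm (vecType x) :=
  Int.mul_ediv_cancel' (two_dvd_qE_sub x)

/-- The dominant representative of the class on the right is a weight λⱼ + bF. Invariance of the
type forces j to be the type of x, and invariance of the self-intersection then forces b = a. -/
theorem exists_weyl_level_two (a : ℤ) (x : E8) :
    ∃ w ∈ weyl, w (levelTwoWeight (vecType x) + a • fib) = cls 2 (2 + a + normShift x) x := by
  obtain ⟨w, hw, hd⟩ := exists_weyl_dominant (cls 2 (2 + a + normShift x) x)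
    (by rw [pair_cls_fib]; norm_num)
  obtain ⟨j, b, hj⟩ := dominant_level_two hd (by rw [pair_weyl_fib hw, pair_cls_fib])
  have ht := vecType_proj_weyl hw (pair_cls_fib 2 (2 + a + normShift x) x)
  rw [hj, levelTwoWeight_add, proj_cls, proj_cls, vecType_weightVec] at ht
  have hs := pair_weyl_self hw (cls 2 (2 + a + normShift x) x)
  rw [hj, levelTwoWeight_add, pair_cls_self, pair_cls_self, qE_weightVec, ht] at hs
  have h2 := two_mul_normShift x
  have hb : b = a := by linarith
  refine ⟨w⁻¹, inv_mem hw, ?_⟩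
  rw [← ht, ← hb, ← hj, show ∀ y, w⁻¹ (w y) = y from w.symm_apply_apply]
  rw [hb]

/-- At level 1 there is a single family of dominant classes, so the self-intersection alone
determines the orbit. -/
theorem exists_weyl_level_one (a : ℤ) (x : E8) :
    ∃ w ∈ weyl, w (e 9 + a • fib) = cls 1 (a + qE x) x := by
  obtain ⟨w, hw, hd⟩ := exists_weyl_dominant (cls 1 (a + qE x) x)
    (by rw [pair_cls_fib]; norm_num)
  obtain ⟨b, hj⟩ := dominant_level_one hd (by rw [pair_weyl_fib hw, pair_cls_fib])
  have he : ∀ b : ℤ, e 9 + b • fib = cls 1 b 0 := by intro b; simp [cls]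
  have hs := pair_weyl_self hw (cls 1 (a + qE x) x)
  rw [hj, he, pair_cls_self, pair_cls_self, qE_zero] at hs
  have hb : b = a := by linarith
  refine ⟨w⁻¹, inv_mem hw, ?_⟩
  rw [← hb, ← hj, show ∀ y, w⁻¹ (w y) = y from w.symm_apply_apply]
  rw [hb]

/-- The Weyl orbits of the three weights. -/
theorem mem_orbit_levelTwoWeight_iff (j : Fin 3) (β : H2) :
    β ∈ MulAction.orbit weyl (levelTwoWeight j) ↔
      ∃ x, vecType x = j ∧ β = cls 2 (2 + normShift x) x := by
  constructor
  · rintro ⟨w, rfl⟩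
    have hl : pair (w • levelTwoWeight j) fib = 2 :=
      (pair_weyl_fib w.2 _).trans (pair_levelTwoWeight_fib j)
    have ht : vecType (proj (w • levelTwoWeight j)) = j :=
      (vecType_proj_weyl w.2 (pair_levelTwoWeight_fib j)).trans (vecType_weightVec j)
    refine ⟨proj (w • levelTwoWeight j), ht, ?_⟩
    have hc := cls_proj (w • levelTwoWeight j)
    rw [hl] at hc
    have hs : pair (w • levelTwoWeight j) (w • levelTwoWeight j) = _ := pair_weyl_self w.2 _
    have h0 := levelTwoWeight_add j 0
    rw [zero_smul, add_zero, add_zero] at h0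
    rw [← hc, h0, pair_cls_self, pair_cls_self, qE_weightVec] at hs
    have h2 := two_mul_normShift (proj (w • levelTwoWeight j))
    rw [ht] at h2
    have : 2 + normShift (proj (w • levelTwoWeight j))
        = pair (w • levelTwoWeight j) (e 9) + 2 := by
      simp only [h0] at h2 hs ⊢
      linarith
    rw [this]
    exact hc.symm
  · rintro ⟨x, rfl, rfl⟩
    obtain ⟨w, hw, h⟩ := exists_weyl_level_two 0 x
    refine ⟨⟨w, hw⟩, ?_⟩
    rw [zero_smul, add_zero, add_zero] at h
    exact h

/-! ### Theta functions with characteristics -/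

theorem norm_summable {ι : Type*} {f : ι → ℂ} {a : ℂ} (h : HasSum f a) :
    Summable fun x => ‖f x‖ := h.summable.norm

/-- A product of absolutely convergent series as a sum over tuples. -/
theorem hasSum_pi_prod {n : ℕ} {f : Fin n → ℤ → ℂ} {s : Fin n → ℂ}
    (hf : ∀ i, HasSum (f i) (s i)) :
    HasSum (fun x : Fin n → ℤ => ∏ i, f i (x i)) (∏ i, s i) := by
  induction n with
  | zero => simp
  | succ n ih =>
    have h1 : HasSum (fun x : Fin n → ℤ => ∏ i : Fin n, f i.succ (x i)) (∏ i : Fin n, s i.succ) :=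
      ih fun i => hf i.succ
    have n0 : Summable fun m => ‖f 0 m‖ := norm_summable (hf 0)
    generalize hg : (fun x : Fin n → ℤ => ∏ i : Fin n, f i.succ (x i)) = g at h1
    have n1 : Summable fun x => ‖g x‖ := norm_summable h1
    have h2 := (hf 0).mul h1 (summable_mul_of_summable_norm n0 n1)
    rw [Fin.prod_univ_succ]
    refine ((Fin.consEquiv fun _ : Fin (n + 1) => ℤ).hasSum_iff
      (f := fun x : Fin (n + 1) → ℤ => ∏ i, f i (x i))).mp (h2.congr_fun fun p => ?_)
    simp [← hg, Fin.prod_univ_succ, Fin.consEquiv]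

/-- The terms of the theta function with half characteristics `ε/2, δ/2`. -/
def thetaTerm (ε δ z τ : ℂ) (n : ℤ) : ℂ :=
  Complex.exp (Real.pi * Complex.I * (n + ε / 2) ^ 2 * τ + 2 * Real.pi * Complex.I * (n + ε / 2) * z
    + Real.pi * Complex.I * δ * n)

/-- The theta function with half characteristics `ε/2, δ/2`. -/
def thetaChar (ε δ z τ : ℂ) : ℂ :=
  Complex.exp (Real.pi * Complex.I * ε ^ 2 * τ / 4 + Real.pi * Complex.I * ε * z)
    * jacobiTheta₂ (z + ε * τ / 2 + δ / 2) τ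

theorem thetaTerm_eq (ε δ z τ : ℂ) (n : ℤ) : thetaTerm ε δ z τ n =
    Complex.exp (Real.pi * Complex.I * ε ^ 2 * τ / 4 + Real.pi * Complex.I * ε * z)
    * jacobiTheta₂_term n (z + ε * τ / 2 + δ / 2) τ := by
  rw [thetaTerm, jacobiTheta₂_term, ← Complex.exp_add]
  congr 1
  ring

theorem hasSum_thetaTerm (ε δ z : ℂ) {τ : ℂ} (hτ : 0 < τ.im) :
    HasSum (thetaTerm ε δ z τ) (thetaChar ε δ z τ) := by
  simp only [funext (thetaTerm_eq ε δ z τ), thetaChar]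
  exact (hasSum_jacobiTheta₂_term _ hτ).mul_left _

/-- Jacobi's inversion formula at the shifted argument. Completing the square exchanges the shift by
ετ/2 with the shift by δ/2, so the characteristic (ε, δ) becomes (-δ, ε). -/
theorem thetaChar_functional_equation (ε δ z : ℂ) {τ : ℂ} (hτ : τ ≠ 0) :
    thetaChar ε δ z τ = 1 / (-Complex.I * τ) ^ (1 / 2 : ℂ) *
      Complex.exp (-Real.pi * Complex.I * z ^ 2 / τ) *
      Complex.exp (-Real.pi * Complex.I * (ε * δ) / 2) * thetaChar (-δ) ε (z / τ) (-1 / τ) := by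
  rw [thetaChar, thetaChar, jacobiTheta₂_functional_equation]
  have h1 : (z + ε * τ / 2 + δ / 2) / τ = z / τ + -δ * (-1 / τ) / 2 + ε / 2 := by
    field_simp
    ring
  rw [h1]
  have h2 : Complex.exp (Real.pi * Complex.I * ε ^ 2 * τ / 4 + Real.pi * Complex.I * ε * z) *
      Complex.exp (-Real.pi * Complex.I * (z + ε * τ / 2 + δ / 2) ^ 2 / τ) =
      Complex.exp (-Real.pi * Complex.I * z ^ 2 / τ) *
      Complex.exp (-Real.pi * Complex.I * (ε * δ) / 2) *
      Complex.exp (Real.pi * Complex.I * (-δ) ^ 2 * (-1 / τ) / 4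
        + Real.pi * Complex.I * (-δ) * (z / τ)) := by
    simp only [← Complex.exp_add]
    congr 1
    field_simp
    ring
  linear_combination (1 / (-Complex.I * τ) ^ (1 / 2 : ℂ) *
    jacobiTheta₂ (z / τ + -δ * (-1 / τ) / 2 + ε / 2) (-1 / τ)) * h2

/-- Quasi-periodicity in the direction τ. It brings the characteristic -1 produced by inversion back
to 1. -/
theorem thetaChar_neg_one (δ z τ : ℂ) :
    thetaChar (-1) δ z τ = Complex.exp (Real.pi * Complex.I * δ) * thetaChar 1 δ z τ := by
  have h := jacobiTheta₂_add_left' (z + -1 * τ / 2 + δ / 2) τ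
  have h' : z + -1 * τ / 2 + δ / 2 + τ = z + 1 * τ / 2 + δ / 2 := by ring
  rw [h'] at h
  rw [thetaChar, thetaChar, h]
  simp only [← mul_assoc, ← Complex.exp_add]
  congr 2
  ring

/-! ### The theta function of `E₈` -/

/-- The pairing of `E₈` with its complexification. -/
def ell (x : E8) (u : E8C) : ℂ := pair (toC (emb x)) u.1

theorem toC_add (β γ : H2) : toC (β + γ) = toC β + toC γ := by
  funext i; simp [toC]

theorem toC_zsmul (c : ℤ) (β : H2) : toC (c • β) = (c : ℂ) • toC β := by
  funext i; simp [toC]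

theorem pair_toC (β γ : H2) : pair (toC β) (toC γ) = (pair β γ : ℤ) := by
  simp [pair_eq, toC]

theorem ell_add_left (x y : E8) (u : E8C) : ell (x + y) u = ell x u + ell y u := by
  rw [ell, map_add, toC_add, pair_add_left]; rfl

theorem ell_add_right (x : E8) (u v : E8C) : ell x (u + v) = ell x u + ell x v :=
  pair_add_right _ _ _

theorem ell_smul_right (x : E8) (c : ℂ) (u : E8C) : ell x (c • u) = c * ell x u :=
  pair_smul_right _ _ _

theorem ell_zsmul_left (c : ℤ) (x : E8) (u : E8C) : ell (c • x) u = c * ell x u := by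
  rw [ell, map_zsmul, toC_zsmul, pair_smul_left]; rfl

theorem ell_zero_right (x : E8) : ell x 0 = 0 := by simp [ell, pair_eq]

theorem chi_cls (n m : ℤ) (x : E8) (τ : ℍ) (u : E8C) :
    chi (cls n m x) (basePoint τ + u.1) =
      Complex.exp (2 * Real.pi * Complex.I * (m * τ + ell x u)) := by
  have h1 : pair (toC (cls n m x)) u.1 = ell x u := by
    rw [cls, toC_add, toC_add, toC_zsmul, toC_zsmul, pair_add_left, pair_add_left, pair_smul_left,
      pair_smul_left, u.2.1, u.2.2, ell]
    ring
  have h2 : pair (cls n m x) (e 9 + fib) = m := by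
    rw [pair_add_right, pair_cls_fib, pair_cls_e_nine]; ring
  rw [chi, pair_add_right, h1, basePoint, pair_smul_right, pair_toC, h2]
  ring_nf

/-- The terms of the theta function of `E₈`. -/
def thetaE8Term (τ : ℂ) (u : E8C) (x : E8) : ℂ :=
  Complex.exp (2 * Real.pi * Complex.I * (qE x * τ + ell x u))

/-- The theta function of `E₈`. -/
def thetaE8 (τ : ℂ) (u : E8C) : ℂ := ∑' x, thetaE8Term τ u x

/-- Coordinates of `E₈ ⊗ ℂ` in which `E₈` is the union of two cosets of `D₈`. -/
def orthoCoord (u : E8C) : Fin 8 → ℂ :=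
  ![(u.1 0 + u.1 1) / 2, -u.1 2 - (u.1 0 + u.1 1) / 2, -u.1 3 - (u.1 0 + u.1 1) / 2,
    -u.1 4 - (u.1 0 + u.1 1) / 2, -u.1 5 - (u.1 0 + u.1 1) / 2, -u.1 6 - (u.1 0 + u.1 1) / 2,
    -u.1 7 - (u.1 0 + u.1 1) / 2, -u.1 8 - (u.1 0 + u.1 1) / 2]

theorem E8C_coords (u : E8C) : u.1 9 = 0 ∧ 3 * u.1 0 + (u.1 1 + u.1 2 + u.1 3 + u.1 4 + u.1 5 +
    u.1 6 + u.1 7 + u.1 8) = 0 := by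
  obtain ⟨h1, h2⟩ := u.2
  rw [e_nine_eq, pair_eq] at h1
  rw [fib_eq, pair_eq] at h2
  simp [toC] at h1 h2
  refine ⟨h1, ?_⟩
  rw [h1] at h2
  linear_combination h2

/-- The coordinates are orthonormal for the negative of the pairing. The quadratic exponents of
eight one-variable theta functions therefore add up to (u, u). -/
theorem sum_sq_orthoCoord (u : E8C) : ∑ i, orthoCoord u i ^ 2 = -pair u.1 u.1 := by
  obtain ⟨h1, h2⟩ := E8C_coords u
  rw [pair_eq, h1]
  simp only [Fin.sum_univ_succ, Finset.univ_eq_empty, Finset.sum_empty, orthoCoord]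
  simp
  linear_combination (u.1 0 + u.1 1) * h2

theorem orthoCoord_smul (c : ℂ) (u : E8C) (i : Fin 8) :
    orthoCoord (c • u) i = c * orthoCoord u i := by
  fin_cases i <;> simp [orthoCoord] <;> ring

/-- `E₈` is the union of two copies of `D₈`. -/
def toD8 (x : E8) : (Fin 8 → ℤ) ⊕ (Fin 8 → ℤ) :=
  if (x 0 + x 1) % 2 = 0 then
    Sum.inl ((fun i => ![0, x 2, x 3, x 4, x 5, x 6, x 7,
      -(3 * x 0 + x 1 + x 2 + x 3 + x 4 + x 5 + x 6 + x 7)] i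
      + ![-1, 1, 1, 1, 1, 1, 1, 1] i * ((x 0 + x 1) / 2)))
  else
    Sum.inr ((fun i => ![-1, x 2, x 3, x 4, x 5, x 6, x 7,
      -(3 * x 0 + x 1 + x 2 + x 3 + x 4 + x 5 + x 6 + x 7)] i
      + ![-1, 1, 1, 1, 1, 1, 1, 1] i * ((x 0 + x 1) / 2)))

/-- Twice the sum over `D₈` and its shifted coset. -/
def d8Term (τ : ℂ) (z : Fin 8 → ℂ) : (Fin 8 → ℤ) ⊕ (Fin 8 → ℤ) → ℂ :=
  Sum.elim (fun n => ∏ i, thetaTerm 0 0 (z i) τ (n i) + ∏ i, thetaTerm 0 1 (z i) τ (n i))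
    (fun n => ∏ i, thetaTerm 1 0 (z i) τ (n i) + ∏ i, thetaTerm 1 1 (z i) τ (n i))

theorem hasSum_d8Term {τ : ℂ} (hτ : 0 < τ.im) (z : Fin 8 → ℂ) : HasSum (d8Term τ z)
    (∏ i, thetaChar 0 0 (z i) τ + ∏ i, thetaChar 0 1 (z i) τ
      + (∏ i, thetaChar 1 0 (z i) τ + ∏ i, thetaChar 1 1 (z i) τ)) := by
  refine HasSum.sum ?_ ?_
  · exact (hasSum_pi_prod fun i => hasSum_thetaTerm 0 0 (z i) hτ).add
      (hasSum_pi_prod fun i => hasSum_thetaTerm 0 1 (z i) hτ)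
  · exact (hasSum_pi_prod fun i => hasSum_thetaTerm 1 0 (z i) hτ).add
      (hasSum_pi_prod fun i => hasSum_thetaTerm 1 1 (z i) hτ)

theorem prod_thetaTerm_one (ε τ : ℂ) (z : Fin 8 → ℂ) (n : Fin 8 → ℤ) :
    ∏ i, thetaTerm ε 1 (z i) τ (n i) = (-1) ^ (∑ i, n i) * ∏ i, thetaTerm ε 0 (z i) τ (n i) := by
  have h : ∀ i, thetaTerm ε 1 (z i) τ (n i) = (-1) ^ n i * thetaTerm ε 0 (z i) τ (n i) := by
    intro i
    rw [thetaTerm, thetaTerm, ← Complex.exp_pi_mul_I, ← Complex.exp_int_mul, ← Complex.exp_add]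
    congr 1
    ring
  rw [Finset.prod_congr rfl fun i _ => h i, Finset.prod_mul_distrib]
  congr 1
  simp only [Fin.prod_univ_succ, Fin.sum_univ_succ, Finset.univ_eq_empty, Finset.prod_empty,
    Finset.sum_empty]
  simp [zpow_add₀]

theorem prod_thetaTerm_zero (ε τ : ℂ) (z : Fin 8 → ℂ) (n : Fin 8 → ℤ) :
    ∏ i, thetaTerm ε 0 (z i) τ (n i) = Complex.exp (2 * Real.pi * Complex.I *
      ((∑ i, (n i + ε / 2) ^ 2) / 2 * τ + ∑ i, (n i + ε / 2) * z i)) := by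
  simp only [thetaTerm]
  rw [← Complex.exp_sum]
  congr 1
  simp only [Fin.sum_univ_eight]
  ring

theorem even_neg_one_zpow_add {m : ℤ} (h : Even m) (P : ℂ) : P + (-1) ^ m * P = 2 * P := by
  rw [h.neg_one_zpow]; ring

theorem odd_neg_one_zpow_add {m : ℤ} (h : ¬ Even m) (P : ℂ) : P + (-1) ^ m * P = 0 := by
  rw [(Int.not_even_iff_odd.mp h).neg_one_zpow]; ring

theorem qE_of_sum_eq {x : E8} {k : ℤ} {ε : ℤ} (h : x 0 + x 1 = 2 * k + ε) :
    (qE x : ℂ) = ((-k - ε / 2) ^ 2 + (x 2 + k + ε / 2) ^ 2 + (x 3 + k + ε / 2) ^ 2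
      + (x 4 + k + ε / 2) ^ 2 + (x 5 + k + ε / 2) ^ 2 + (x 6 + k + ε / 2) ^ 2
      + (x 7 + k + ε / 2) ^ 2
      + (-(3 * x 0 + x 1 + x 2 + x 3 + x 4 + x 5 + x 6 + x 7) + k + ε / 2) ^ 2) / 2 := by
  have h' : (x 1 : ℂ) = 2 * k + ε - x 0 := by
    have : x 1 = 2 * k + ε - x 0 := by linarith
    rw [this]; push_cast; ring
  rw [qE]
  push_cast
  rw [h']
  ring

theorem ell_of_sum_eq {x : E8} {k : ℤ} {ε : ℤ} (h : x 0 + x 1 = 2 * k + ε) (u : E8C) :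
    ell x u = (-k - ε / 2) * orthoCoord u 0 + (x 2 + k + ε / 2) * orthoCoord u 1
      + (x 3 + k + ε / 2) * orthoCoord u 2
      + (x 4 + k + ε / 2) * orthoCoord u 3 + (x 5 + k + ε / 2) * orthoCoord u 4
      + (x 6 + k + ε / 2) * orthoCoord u 5 + (x 7 + k + ε / 2) * orthoCoord u 6
      + (-(3 * x 0 + x 1 + x 2 + x 3 + x 4 + x 5 + x 6 + x 7) + k + ε / 2) * orthoCoord u 7 := by
  have h' : (x 1 : ℂ) = 2 * k + ε - x 0 := by
    have : x 1 = 2 * k + ε - x 0 := by linarith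
    rw [this]; push_cast; ring
  obtain ⟨h1, h2⟩ := E8C_coords u
  rw [ell, emb_apply, pair_eq, h1]
  simp [toC, orthoCoord]
  rw [h']
  linear_combination (k + ε / 2 : ℂ) * h2

/-- Adding the products with δ = 0 and δ = 1 inserts the factor 1 + (-1)^{∑ nᵢ}, which is 2 when the
coordinate sum is even and 0 otherwise. The coordinates of a vector of E₈ have even sum, both in D₈
and in the shifted coset. -/
theorem d8Term_toD8 (τ : ℂ) (u : E8C) (x : E8) :
    d8Term τ (orthoCoord u) (toD8 x) = 2 * thetaE8Term τ u x := by
  rw [toD8, thetaE8Term]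
  split_ifs with h
  · have hk : x 0 + x 1 = 2 * ((x 0 + x 1) / 2) + 0 := by omega
    rw [d8Term, Sum.elim_inl, prod_thetaTerm_one, even_neg_one_zpow_add, prod_thetaTerm_zero,
      qE_of_sum_eq hk, ell_of_sum_eq hk]
    · generalize (x 0 + x 1) / 2 = k
      congr 2
      simp only [Fin.sum_univ_eight]
      simp
    · simp only [Fin.sum_univ_eight]
      simp
      rw [Int.even_iff]
      omega
  · have hk : x 0 + x 1 = 2 * ((x 0 + x 1) / 2) + 1 := by omega
    rw [d8Term, Sum.elim_inr, prod_thetaTerm_one, even_neg_one_zpow_add, prod_thetaTerm_zero,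
      qE_of_sum_eq hk, ell_of_sum_eq hk]
    · generalize (x 0 + x 1) / 2 = k
      congr 2
      simp only [Fin.sum_univ_eight]
      simp
      ring
    · simp only [Fin.sum_univ_eight]
      simp
      rw [Int.even_iff]
      omega

theorem ext_eight {x y : E8} (h : x 0 = y 0 ∧ x 1 = y 1 ∧ x 2 = y 2 ∧ x 3 = y 3 ∧ x 4 = y 4 ∧
    x 5 = y 5 ∧ x 6 = y 6 ∧ x 7 = y 7) : x = y := by
  obtain ⟨h0, h1, h2, h3, h4, h5, h6, h7⟩ := h
  funext i
  fin_cases i <;> assumption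

theorem toD8_injective : Function.Injective toD8 := by
  intro x y h
  rw [toD8, toD8] at h
  split_ifs at h with h1 h2 h2
  · have h := Sum.inl_injective h
    have e0 := congrFun h 0
    have e1 := congrFun h 1
    have e2 := congrFun h 2
    have e3 := congrFun h 3
    have e4 := congrFun h 4
    have e5 := congrFun h 5
    have e6 := congrFun h 6
    have e7 := congrFun h 7
    simp at e0 e1 e2 e3 e4 e5 e6 e7
    refine ext_eight ?_
    omega
  · have h := Sum.inr_injective h
    have e0 := congrFun h 0
    have e1 := congrFun h 1
    have e2 := congrFun h 2
    have e3 := congrFun h 3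
    have e4 := congrFun h 4
    have e5 := congrFun h 5
    have e6 := congrFun h 6
    have e7 := congrFun h 7
    simp at e0 e1 e2 e3 e4 e5 e6 e7
    refine ext_eight ?_
    omega

theorem mem_range_toD8_inl {n : Fin 8 → ℤ} (h : Even (∑ i, n i)) :
    Sum.inl n ∈ Set.range toD8 := by
  simp only [Fin.sum_univ_eight, Int.even_iff] at h
  -- Half of x₀ + x₁ is -n₀, which gives the middle coordinates of x. The last equation then gives 2
  -- x₀, and its divisibility by 2 is the parity of the sum of the nᵢ.
  refine ⟨![-(-2 * n 0 + n 1 + n 2 + n 3 + n 4 + n 5 + n 6 + n 7 + 7 * n 0) / 2,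
    -2 * n 0 - -(-2 * n 0 + n 1 + n 2 + n 3 + n 4 + n 5 + n 6 + n 7 + 7 * n 0) / 2,
    n 1 + n 0, n 2 + n 0, n 3 + n 0, n 4 + n 0, n 5 + n 0, n 6 + n 0], ?_⟩
  rw [toD8, if_pos (by simp)]
  congr 1
  refine ext_eight ?_
  simp
  omega

theorem mem_range_toD8_inr {n : Fin 8 → ℤ} (h : Even (∑ i, n i)) :
    Sum.inr n ∈ Set.range toD8 := by
  simp only [Fin.sum_univ_eight, Int.even_iff] at h
  refine ⟨![-(-2 * n 0 - 1 + n 1 + n 2 + n 3 + n 4 + n 5 + n 6 + n 7 + 7 * (n 0 + 1)) / 2,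
    -2 * n 0 - 1 - -(-2 * n 0 - 1 + n 1 + n 2 + n 3 + n 4 + n 5 + n 6 + n 7 + 7 * (n 0 + 1)) / 2,
    n 1 + n 0 + 1, n 2 + n 0 + 1, n 3 + n 0 + 1, n 4 + n 0 + 1, n 5 + n 0 + 1, n 6 + n 0 + 1], ?_⟩
  rw [toD8, if_neg (by simp; omega)]
  congr 1
  refine ext_eight ?_
  simp
  omega

/-- The classical formula for the theta function of E₈ as half the sum over the four half
characteristics. Index tuples with odd sum lie outside the image of `toD8`, and their terms cancel.
-/
theorem hasSum_thetaE8Term_prod {τ : ℂ} (hτ : 0 < τ.im) (u : E8C) : HasSum (thetaE8Term τ u)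
    ((∏ i, thetaChar 0 0 (orthoCoord u i) τ + ∏ i, thetaChar 0 1 (orthoCoord u i) τ
      + (∏ i, thetaChar 1 0 (orthoCoord u i) τ + ∏ i, thetaChar 1 1 (orthoCoord u i) τ)) / 2) := by
  have h := hasSum_d8Term hτ (orthoCoord u)
  rw [← toD8_injective.hasSum_iff] at h
  · refine (h.div_const 2).congr_fun fun x => ?_
    rw [Function.comp_apply, d8Term_toD8]
    ring
  · rintro (n | n) hn
    · rw [d8Term, Sum.elim_inl, prod_thetaTerm_one]
      exact odd_neg_one_zpow_add (fun hev => hn (mem_range_toD8_inl hev)) _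
    · rw [d8Term, Sum.elim_inr, prod_thetaTerm_one]
      exact odd_neg_one_zpow_add (fun hev => hn (mem_range_toD8_inr hev)) _

theorem hasSum_thetaE8Term {τ : ℂ} (hτ : 0 < τ.im) (u : E8C) :
    HasSum (thetaE8Term τ u) (thetaE8 τ u) :=
  (hasSum_thetaE8Term_prod hτ u).summable.hasSum

theorem thetaE8_eq {τ : ℂ} (hτ : 0 < τ.im) (u : E8C) : thetaE8 τ u =
    (∏ i, thetaChar 0 0 (orthoCoord u i) τ + ∏ i, thetaChar 0 1 (orthoCoord u i) τ
      + (∏ i, thetaChar 1 0 (orthoCoord u i) τ + ∏ i, thetaChar 1 1 (orthoCoord u i) τ)) / 2 :=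
  (hasSum_thetaE8Term_prod hτ u).tsum_eq

theorem thetaE8_add_one (τ : ℂ) (u : E8C) : thetaE8 (τ + 1) u = thetaE8 τ u := by
  refine tsum_congr fun x => ?_
  rw [thetaE8Term, thetaE8Term, show 2 * Real.pi * Complex.I * (qE x * (τ + 1) + ell x u)
    = 2 * Real.pi * Complex.I * (qE x * τ + ell x u) + qE x * (2 * Real.pi * Complex.I) by ring,
    Complex.exp_add, Complex.exp_int_mul_two_pi_mul_I, mul_one]

/-- Eight factors (-iτ)^{1/2} multiply to τ⁴, so the branch of the square root disappears. -/
theorem prod_thetaChar_functional_equation (ε δ : ℂ) (u : E8C) {τ : ℂ} (hτ : τ ≠ 0) :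
    τ ^ 4 * ∏ i, thetaChar ε δ (orthoCoord u i) τ =
      Complex.exp (Real.pi * Complex.I * pair u.1 u.1 / τ) *
      Complex.exp (-Real.pi * Complex.I * (ε * δ) / 2) ^ 8 *
      ∏ i, thetaChar (-δ) ε (orthoCoord (τ⁻¹ • u) i) (-1 / τ) := by
  have h4 : (1 / (-Complex.I * τ) ^ (1 / 2 : ℂ)) ^ 8 * τ ^ 4 = 1 := by
    have hne : -Complex.I * τ ≠ 0 := mul_ne_zero (neg_ne_zero.mpr Complex.I_ne_zero) hτ
    have h : ((-Complex.I * τ) ^ (1 / 2 : ℂ)) ^ 8 = τ ^ 4 := by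
      rw [← Complex.cpow_nat_mul]
      norm_num
      rw [mul_pow, Complex.I_pow_four, one_mul]
    rw [div_pow, h, one_pow, one_div, inv_mul_cancel₀ (pow_ne_zero _ hτ)]
  have hs : ∏ i, Complex.exp (-Real.pi * Complex.I * orthoCoord u i ^ 2 / τ) =
      Complex.exp (Real.pi * Complex.I * pair u.1 u.1 / τ) := by
    rw [← Complex.exp_sum]
    congr 1
    have h := sum_sq_orthoCoord u
    have h' : ∑ i, -Real.pi * Complex.I * orthoCoord u i ^ 2 / τ =
        -Real.pi * Complex.I / τ * ∑ i, orthoCoord u i ^ 2 := by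
      rw [Finset.mul_sum]
      exact Finset.sum_congr rfl fun i _ => by ring
    rw [h', h]
    ring
  rw [Finset.prod_congr rfl fun i _ => thetaChar_functional_equation ε δ (orthoCoord u i) hτ]
  simp only [Finset.prod_mul_distrib, Finset.prod_const, Finset.card_univ, Fintype.card_fin, hs]
  have h5 : ∏ i, thetaChar (-δ) ε (orthoCoord (τ⁻¹ • u) i) (-1 / τ) =
      ∏ i, thetaChar (-δ) ε (orthoCoord u i / τ) (-1 / τ) :=
    Finset.prod_congr rfl fun i _ => by
      rw [orthoCoord_smul, inv_mul_eq_div]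
  rw [h5]
  linear_combination (Complex.exp (Real.pi * Complex.I * pair u.1 u.1 / τ) *
    Complex.exp (-Real.pi * Complex.I * (ε * δ) / 2) ^ 8 *
    ∏ i, thetaChar (-δ) ε (orthoCoord u i / τ) (-1 / τ)) * h4

/-- Inversion fixes the characteristics (0,0) and (1,1) and exchanges (0,1) with (1,0). The roots of
unity that occur are raised to the eighth power and become 1, so the sum of the four products is
preserved. -/
theorem thetaE8_inversion {τ : ℂ} (hτ : 0 < τ.im) (u : E8C) :
    thetaE8 (-1 / τ) (τ⁻¹ • u) =
      τ ^ 4 * Complex.exp (-(Real.pi * Complex.I * pair u.1 u.1 / τ)) * thetaE8 τ u := by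
  have h0 : τ ≠ 0 := by rintro rfl; simp at hτ
  have him : 0 < (-1 / τ).im := by
    have := (ModularGroup.S • (⟨τ, hτ⟩ : ℍ)).im_pos
    rw [UpperHalfPlane.modular_S_smul] at this
    simpa [neg_div] using this
  have hE : Complex.exp (-(Real.pi * Complex.I * pair u.1 u.1 / τ)) *
      Complex.exp (Real.pi * Complex.I * pair u.1 u.1 / τ) = 1 := by
    rw [← Complex.exp_add, neg_add_cancel, Complex.exp_zero]
  have e1 : Complex.exp (-Real.pi * Complex.I * (1 * 1) / 2) ^ 8 = 1 := by
    have h := Complex.exp_int_mul_two_pi_mul_I (-2)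
    rw [← Complex.exp_nat_mul]
    refine Eq.trans (congrArg _ ?_) h
    push_cast; ring
  have e2 : Complex.exp (Real.pi * Complex.I * 1) ^ 8 = 1 := by
    rw [mul_one, Complex.exp_pi_mul_I]; norm_num
  have e3 : Complex.exp (Real.pi * Complex.I * 0) ^ 8 = 1 := by simp
  have f00 := prod_thetaChar_functional_equation 0 0 u h0
  have f01 := prod_thetaChar_functional_equation 0 1 u h0
  have f10 := prod_thetaChar_functional_equation 1 0 u h0
  have f11 := prod_thetaChar_functional_equation 1 1 u h0
  simp only [thetaChar_neg_one, Finset.prod_mul_distrib, Finset.prod_const, Finset.card_univ,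
    Fintype.card_fin, e1, e2, e3, neg_zero] at f00 f01 f10 f11
  simp only [mul_zero, zero_div, Complex.exp_zero, one_pow, mul_one, one_mul]
    at f00 f01 f10 f11
  rw [thetaE8_eq hτ, thetaE8_eq him]
  linear_combination (-(∏ i, thetaChar 0 0 (orthoCoord (τ⁻¹ • u) i) (-1 / τ)
    + ∏ i, thetaChar 0 1 (orthoCoord (τ⁻¹ • u) i) (-1 / τ)
    + (∏ i, thetaChar 1 0 (orthoCoord (τ⁻¹ • u) i) (-1 / τ)
    + ∏ i, thetaChar 1 1 (orthoCoord (τ⁻¹ • u) i) (-1 / τ))) / 2) * hE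
    - Complex.exp (-(Real.pi * Complex.I * pair u.1 u.1 / τ)) / 2 * (f00 + f01 + f10 + f11)

/-! ### Uniqueness of Fourier coefficients -/

/-- Removing finitely many frequencies from a vanishing Fourier series with a difference
operator. -/
theorem exists_remove_frequencies {ι V : Type*} [AddMonoid V] {χ : ι → V → ℂ}
    (hadd : ∀ i u v, χ i (u + v) = χ i u * χ i v) {i₀ : ι}
    (hsep : ∀ i, i ≠ i₀ → ∃ y, (∀ j, ‖χ j y‖ = 1) ∧ χ i₀ y = -χ i y)
    {c : ι → ℂ} (hc : ∀ u, HasSum (fun i => c i * χ i u) 0) (s : Finset ι) (hs : i₀ ∉ s) :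
    ∃ c' : ι → ℂ, (∀ u, HasSum (fun i => c' i * χ i u) 0) ∧ (∀ i ∈ s, c' i = 0) ∧
      (∀ i, ‖c' i‖ ≤ 2 ^ s.card * ‖c i‖) ∧ ‖c' i₀‖ = 2 ^ s.card * ‖c i₀‖ := by
  classical
  induction s using Finset.induction_on with
  | empty => exact ⟨c, hc, by simp, by simp, by simp⟩
  | insert i s his ih =>
    rw [Finset.mem_insert, not_or] at hs
    obtain ⟨c', h1, h2, h3, h4⟩ := ih hs.2
    obtain ⟨y, hy1, hy2⟩ := hsep i (Ne.symm hs.1)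
    -- The difference u ↦ f(u + y) - χᵢ(y) f(u) kills the frequency i. It multiplies the coefficient
    -- at i₀ by a number of modulus exactly 2, and every other coefficient by one of modulus at most
    -- 2.
    refine ⟨fun j => c' j * (χ j y - χ i y), fun u => ?_, ?_, fun j => ?_, ?_⟩
    · have h := (h1 (u + y)).sub ((h1 u).mul_left (χ i y))
      rw [mul_zero, sub_zero] at h
      exact h.congr_fun fun j => by rw [hadd]; ring
    · intro j hj
      rcases Finset.mem_insert.mp hj with rfl | hj
      · simp
      · simp [h2 j hj]
    · rw [Finset.card_insert_of_notMem his, norm_mul, pow_succ]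
      have : ‖χ j y - χ i y‖ ≤ 2 := (norm_sub_le _ _).trans (by rw [hy1, hy1]; norm_num)
      calc ‖c' j‖ * ‖χ j y - χ i y‖ ≤ (2 ^ s.card * ‖c j‖) * 2 :=
            mul_le_mul (h3 j) this (norm_nonneg _) (by positivity)
        _ = _ := by ring
    · rw [Finset.card_insert_of_notMem his, norm_mul, pow_succ, h4, hy2,
        show -χ i y - χ i y = -2 * χ i y by ring, norm_mul, hy1]
      simp; ring

/-- An absolutely convergent Fourier series that vanishes identically has zero coefficients. -/
theorem fourier_coeff_eq_zero {ι V : Type*} [AddMonoid V] {χ : ι → V → ℂ}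
    (hadd : ∀ i u v, χ i (u + v) = χ i u * χ i v) (hzero : ∀ i, χ i 0 = 1) {i₀ : ι}
    (hsep : ∀ i, i ≠ i₀ → ∃ y, (∀ j, ‖χ j y‖ = 1) ∧ χ i₀ y = -χ i y)
    {c : ι → ℂ} (hc : ∀ u, HasSum (fun i => c i * χ i u) 0) : c i₀ = 0 := by
  classical
  have hcs : HasSum c 0 := by simpa [hzero] using hc 0
  -- After removing the frequencies of s other than i₀, evaluation at u = 0 bounds the coefficient
  -- at i₀ by the tail outside s. The common factor 2^{|s|-1} cancels, and the tails tend to 0.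
  have key : ∀ s : Finset ι, i₀ ∈ s → ‖c i₀‖ ≤ ∑' i : {i // i ∉ s}, ‖c i‖ := by
    intro s hs
    obtain ⟨c', h1, h2, h3, h4⟩ := exists_remove_frequencies hadd hsep hc (s.erase i₀)
      (Finset.notMem_erase _ _)
    have hcs' : HasSum c' 0 := by simpa [hzero] using h1 0
    have hsum : ∑ i ∈ s, c' i = c' i₀ := by
      rw [← Finset.add_sum_erase _ _ hs, Finset.sum_eq_zero h2, add_zero]
    have htail := hcs'.summable.sum_add_tsum_compl (s := s)
    rw [hcs'.tsum_eq, hsum] at htail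
    have hn : ‖c' i₀‖ ≤ ∑' i : {i // i ∉ s}, ‖c' i‖ := by
      rw [eq_neg_of_add_eq_zero_left htail, norm_neg]
      exact norm_tsum_le_tsum_norm (hcs'.summable.norm.subtype _)
    have hle : ∑' i : {i // i ∉ s}, ‖c' i‖ ≤
        ∑' i : {i // i ∉ s}, 2 ^ (s.erase i₀).card * ‖c i‖ :=
      Summable.tsum_le_tsum (fun i => h3 i) (hcs'.summable.norm.subtype _)
        ((hcs.summable.norm.subtype _).mul_left _)
    rw [tsum_mul_left] at hle
    rw [h4] at hn
    exact le_of_mul_le_mul_left (hn.trans hle) (by positivity)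
  have hlim := tendsto_tsum_compl_atTop_zero fun i => ‖c i‖
  have : ‖c i₀‖ ≤ 0 := ge_of_tendsto hlim (by
    filter_upwards [Filter.eventually_ge_atTop {i₀}] with s hs
    exact key s (by simpa using hs))
  simpa using this

/-! ### The theta functions of the three orbits in `E₈ / 2 E₈` -/

/-- The half norm as a sum of squares of twice the orthonormal coordinates. This shows that the form
is positive definite. -/
theorem eight_mul_qE (x : E8) : 8 * qE x = 2 * (x 0 + x 1) ^ 2 - (x 0 + x 1) ^ 2
    + (2 * x 2 + (x 0 + x 1)) ^ 2 + (2 * x 3 + (x 0 + x 1)) ^ 2 + (2 * x 4 + (x 0 + x 1)) ^ 2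
    + (2 * x 5 + (x 0 + x 1)) ^ 2 + (2 * x 6 + (x 0 + x 1)) ^ 2 + (2 * x 7 + (x 0 + x 1)) ^ 2
    + (2 * (3 * x 0 + x 1 + x 2 + x 3 + x 4 + x 5 + x 6 + x 7) - (x 0 + x 1)) ^ 2 := by
  rw [qE]; ring

theorem eq_zero_of_qE {x : E8} (h : qE x = 0) : x = 0 := by
  have h8 := eight_mul_qE x
  rw [h] at h8
  have e0 : x 0 + x 1 = 0 := pow_eq_zero_iff (two_ne_zero) |>.mp (by nlinarith)
  rw [e0] at h8
  have e2 : x 2 = 0 := pow_eq_zero_iff (two_ne_zero) |>.mp (by nlinarith)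
  have e3 : x 3 = 0 := pow_eq_zero_iff (two_ne_zero) |>.mp (by nlinarith)
  have e4 : x 4 = 0 := pow_eq_zero_iff (two_ne_zero) |>.mp (by nlinarith)
  have e5 : x 5 = 0 := pow_eq_zero_iff (two_ne_zero) |>.mp (by nlinarith)
  have e6 : x 6 = 0 := pow_eq_zero_iff (two_ne_zero) |>.mp (by nlinarith)
  have e7 : x 7 = 0 := pow_eq_zero_iff (two_ne_zero) |>.mp (by nlinarith)
  have e8 : 3 * x 0 + x 1 + x 2 + x 3 + x 4 + x 5 + x 6 + x 7 = 0 :=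
    pow_eq_zero_iff (two_ne_zero) |>.mp (by nlinarith)
  refine ext_eight ?_
  simp only [Pi.zero_apply]
  omega

/-- The element of `E₈ ⊗ ℂ` defined by a vector of `E₈`. -/
def embC (x : E8) : E8C := ⟨toC (emb x), by
  rw [pair_toC, pair_comm', pair_emb_e_nine, Int.cast_zero], by
  rw [pair_toC, pair_comm', pair_emb_fib, Int.cast_zero]⟩

theorem ell_embC (x y : E8) : ell x (embC y) = -(bE x y : ℤ) := by
  rw [ell, embC, pair_toC, pair_emb_emb]; push_cast; ring

/-- The character `e^{2πi(x, u)}`. -/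
def expEll (x : E8) (u : E8C) : ℂ := Complex.exp (2 * Real.pi * Complex.I * ell x u)

/-- Take y to be the real multiple of x₀ - x whose pairing with x₀ - x is 1/2. It exists because the
form is definite, and since y is real all characters are unimodular at y. -/
theorem expEll_separates {x₀ x : E8} (h : x ≠ x₀) :
    ∃ y : E8C, (∀ z, ‖expEll z y‖ = 1) ∧ expEll x₀ y = -expEll x y := by
  have hq : (qE (x₀ - x) : ℝ) ≠ 0 := by
    intro h0
    exact h (sub_eq_zero.mp (eq_zero_of_qE (by exact_mod_cast h0))).symm
  refine ⟨((-1 / (4 * qE (x₀ - x)) : ℝ) : ℂ) • embC (x₀ - x), fun z => ?_, ?_⟩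
  · rw [expEll, ell_smul_right, ell_embC, Complex.norm_exp]
    norm_cast
    simp
  · have hx : x₀ = x + (x₀ - x) := by abel
    have hw : ell (x₀ - x) (((-1 / (4 * qE (x₀ - x)) : ℝ) : ℂ) • embC (x₀ - x)) = 1 / 2 := by
      rw [ell_smul_right, ell_embC, bE_self]
      have hq' : (qE (x₀ - x) : ℂ) ≠ 0 := by exact_mod_cast hq
      push_cast
      field_simp
      norm_num
    nth_rewrite 1 [hx]
    rw [expEll, ell_add_left, hw, expEll, mul_add, Complex.exp_add,
      show 2 * Real.pi * Complex.I * (1 / 2) = Real.pi * Complex.I by ring, Complex.exp_pi_mul_I]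
    ring

theorem fourier_E8 {c : E8 → ℂ} (hc : ∀ u, HasSum (fun x => c x * expEll x u) 0) (x : E8) :
    c x = 0 := by
  refine fourier_coeff_eq_zero (χ := expEll) (fun x u v => ?_) (fun x => ?_)
    (fun y hy => expEll_separates hy) hc
  · rw [expEll, ell_add_right, mul_add, Complex.exp_add]; rfl
  · rw [expEll, ell_zero_right]; simp

theorem thetaE8Term_eq (τ : ℂ) (u : E8C) (x : E8) :
    thetaE8Term τ u x = Complex.exp (2 * Real.pi * Complex.I * (qE x * τ)) * expEll x u := by
  rw [thetaE8Term, expEll, ← Complex.exp_add]; ring_nf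

theorem half_im_pos (τ : ℍ) : 0 < ((τ : ℂ) / 2).im := by
  have := τ.im_pos
  simp
  linarith [this, show (τ : ℂ).im = τ.im from rfl]

/-- The theta function of an orbit in `E₈ / 2 E₈`. -/
def thetaType (j : Fin 3) (τ : ℍ) (u : E8C) : ℂ :=
  ∑' x : {x // vecType x = j}, thetaE8Term (τ / 2) u x

theorem hasSum_thetaType (j : Fin 3) (τ : ℍ) (u : E8C) :
    HasSum (fun x : {x // vecType x = j} => thetaE8Term (τ / 2) u x) (thetaType j τ u) :=
  ((hasSum_thetaE8Term (half_im_pos τ) u).summable.subtype _).hasSum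

theorem hasSum_weighted (w : Fin 3 → ℂ) (τ : ℍ) (u : E8C) :
    HasSum (fun x => w (vecType x) * thetaE8Term (τ / 2) u x)
      (∑ j, w j * thetaType j τ u) := by
  classical
  have h : ∀ j, HasSum ({x | vecType x = j}.indicator (thetaE8Term (τ / 2) u))
      (thetaType j τ u) := fun j => hasSum_subtype_iff_indicator.mp (hasSum_thetaType j τ u)
  refine (hasSum_sum fun j (_ : j ∈ Finset.univ) => (h j).mul_left (w j)).congr_fun fun x => ?_
  rw [Finset.sum_eq_single (vecType x)]
  · simp
  · intro j _ hj
    rw [Set.indicator_of_notMem (by simpa using Ne.symm hj), mul_zero]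
  · simp

/-- The frequency `weightVec j` occurs only in the theta function of type j, with a nonzero
coefficient. -/
theorem thetaType_independent {w : Fin 3 → ℂ} {τ : ℍ}
    (h : ∀ u, ∑ j, w j * thetaType j τ u = 0) (j : Fin 3) : w j = 0 := by
  have := fourier_E8 (c := fun x => w (vecType x) *
      Complex.exp (2 * Real.pi * Complex.I * (qE x * (τ / 2)))) (fun u => by
    have hw := hasSum_weighted w τ u
    rw [h u] at hw
    exact hw.congr_fun fun x => by rw [thetaE8Term_eq]; ring) (weightVec j)
  simpa [vecType_weightVec] using this

theorem thetaE8_half (τ : ℍ) (u : E8C) :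
    thetaE8 (τ / 2) u = thetaType 0 τ u + thetaType 1 τ u + thetaType 2 τ u := by
  have h := hasSum_weighted (fun _ => 1) τ u
  simp only [one_mul, Fin.sum_univ_three] at h
  exact h.tsum_eq

theorem odd_qE_iff (x : E8) : Odd (qE x) ↔ vecType x = 2 := by
  have h := two_mul_normShift x
  constructor
  · intro h; simp [vecType, h]
  · intro ht
    rw [ht] at h
    have : qE x = 2 * normShift x + 1 := by
      simp only [weightNorm] at h
      simp at h
      linarith
    exact ⟨_, this⟩

/-- The translation multiplies the term of x by (-1) to the half norm of x, which is -1 exactly for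
type 2. -/
theorem thetaE8_half_add (τ : ℍ) (u : E8C) :
    thetaE8 ((τ + 1) / 2) u = thetaType 0 τ u + thetaType 1 τ u - thetaType 2 τ u := by
  have h := hasSum_weighted ![1, 1, -1] τ u
  simp only [Fin.sum_univ_three] at h
  have h2 := (h.congr_fun (g := thetaE8Term ((τ + 1) / 2) u) fun x => ?_).tsum_eq
  · rw [thetaE8, h2]; simp; ring
  · have : thetaE8Term ((τ + 1) / 2) u x = (-1) ^ qE x * thetaE8Term (τ / 2) u x := by
      rw [thetaE8Term, thetaE8Term, ← Complex.exp_pi_mul_I, ← Complex.exp_int_mul,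
        ← Complex.exp_add]
      congr 1
      ring
    rw [this]
    congr 1
    by_cases ho : Odd (qE x)
    · rw [ho.neg_one_zpow, (odd_qE_iff x).mp ho]; rfl
    · rw [(Int.not_odd_iff_even.mp ho).neg_one_zpow]
      rw [odd_qE_iff] at ho
      generalize vecType x = j at ho
      fin_cases j <;> simp_all

theorem vecType_two_smul (x : E8) : vecType ((2 : ℤ) • x) = 0 := by
  have h := vecType_congr (x := 0) (y := (2 : ℤ) • x) ⟨x, by simp⟩
  rw [h]
  have := vecType_weightVec 0
  rwa [show weightVec 0 = 0 by decide] at this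

theorem exists_two_smul_of_vecType {x : E8} (h : vecType x = 0) : ∃ y, (2 : ℤ) • y = x := by
  rw [vecType] at h
  split_ifs at h with h1 h2
  · simp at h
  · obtain ⟨y, hy⟩ := h2
    exact ⟨y, hy.symm⟩
  · simp at h

/-- Type 0 is the sublattice 2E₈, on which the half norm is multiplied by 4 and the pairing with u
by 2. -/
theorem thetaE8_double (τ : ℍ) (u : E8C) :
    thetaE8 (2 * τ) ((2 : ℂ) • u) = thetaType 0 τ u := by
  let f : E8 → {x // vecType x = 0} := fun x => ⟨(2 : ℤ) • x, vecType_two_smul x⟩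
  have hf : Function.Bijective f := by
    constructor
    · intro x y hxy
      have := congrArg Subtype.val hxy
      exact smul_right_injective E8 (two_ne_zero (α := ℤ)) this
    · rintro ⟨x, hx⟩
      obtain ⟨y, hy⟩ := exists_two_smul_of_vecType hx
      exact ⟨y, Subtype.ext hy⟩
  rw [thetaType, ← (Equiv.ofBijective f hf).tsum_eq, thetaE8]
  refine tsum_congr fun x => ?_
  simp only [Equiv.ofBijective_apply, f, thetaE8Term, qE_zsmul, ell_zsmul_left, ell_smul_right]
  push_cast
  ring_nf

/-! ### The square of the theta function -/

/-- The theta function of a coset of `2 E₈`. -/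
def thetaCoset (x : E8) (τ : ℍ) : ℂ := ∑' z : E8, thetaE8Term (τ / 2) 0 (x + (2 : ℤ) • z)

theorem hasSum_thetaCoset (x : E8) (τ : ℍ) :
    HasSum (fun z : E8 => thetaE8Term (τ / 2) 0 (x + (2 : ℤ) • z)) (thetaCoset x τ) := by
  refine ((hasSum_thetaE8Term (half_im_pos τ) 0).summable.comp_injective
    (i := fun z : E8 => x + (2 : ℤ) • z) ?_).hasSum
  intro y z h
  exact smul_right_injective E8 (two_ne_zero (α := ℤ)) (add_left_cancel h)

theorem thetaCoset_add (x z : E8) (τ : ℍ) : thetaCoset (x + (2 : ℤ) • z) τ = thetaCoset x τ := by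
  rw [thetaCoset, thetaCoset, ← (Equiv.addLeft z).tsum_eq fun y =>
    thetaE8Term (τ / 2) 0 (x + (2 : ℤ) • y)]
  refine tsum_congr fun y => ?_
  rw [Equiv.coe_addLeft, smul_add, add_assoc]

theorem thetaCoset_reflE {a : E8} (ha : qE a = 1) (x : E8) (τ : ℍ) :
    thetaCoset (reflE a x) τ = thetaCoset x τ := by
  let σ : E8 ≃ E8 := (show Function.Involutive (reflE a) from reflE_reflE ha).toPerm
  rw [thetaCoset, thetaCoset, ← σ.tsum_eq fun y =>
    thetaE8Term (τ / 2) 0 (reflE a x + (2 : ℤ) • y)]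
  refine tsum_congr fun y => ?_
  have h : reflE a x + (2 : ℤ) • σ y = reflE a (x + (2 : ℤ) • y) := by
    rw [reflE_add, reflE_zsmul]; rfl
  rw [h, thetaE8Term, thetaE8Term, qE_reflE ha, ell_zero_right, ell_zero_right]

/-- The coset theta function is invariant under 2E₈ and under reflections in roots, hence constant
along the projections of an affine Weyl orbit of level 2. Each type is such a projection. -/
theorem thetaCoset_eq (x : E8) (τ : ℍ) :
    thetaCoset x τ = thetaCoset (weightVec (vecType x)) τ := by
  obtain ⟨w, hw, h⟩ := exists_weyl_level_two 0 x
  rw [zero_smul, add_zero] at h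
  have := proj_weyl (f := fun x => thetaCoset x τ) (fun x z => thetaCoset_add x z τ)
    (fun a x ha => thetaCoset_reflE ha x τ) hw (pair_levelTwoWeight_fib (vecType x))
  rw [h, proj_cls] at this
  exact this

/-- The change of variables `(x, z) ↦ (x + z, -z)`. -/
def shearEquiv : E8 × E8 ≃ E8 × E8 where
  toFun p := (p.1 + p.2, -p.2)
  invFun p := (p.1 + p.2, -p.2)
  left_inv p := by simp
  right_inv p := by simp

theorem hasSum_mul_self {ι : Type*} {f : ι → ℂ} {a : ℂ} (h : HasSum f a) :
    HasSum (fun p : ι × ι => f p.1 * f p.2) (a * a) :=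
  h.mul h (summable_mul_of_summable_norm (norm_summable h) (norm_summable h))

/-- Group the pairs of vectors x + z and -z by their sum x. The parallelogram law makes the sum of
their half norms equal to half of q(x + 2z) plus half of q(x), where q is the half norm. Summing
over z gives the theta function of the coset of x. -/
theorem thetaE8_sq (τ : ℍ) (u : E8C) :
    thetaE8 τ u ^ 2 = ∑ j, thetaCoset (weightVec j) τ * thetaType j τ u := by
  have h1 := hasSum_thetaE8Term (τ := τ) τ.im_pos u
  have h2 : HasSum (fun p : E8 × E8 => thetaE8Term τ u p.1 * thetaE8Term τ u p.2)
      (thetaE8 τ u * thetaE8 τ u) := hasSum_mul_self h1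
  rw [← shearEquiv.hasSum_iff] at h2
  have h3 := h2.prod_fiberwise (g := fun x => thetaCoset (weightVec (vecType x)) τ *
    thetaE8Term (τ / 2) u x) fun x => by
      have h4 := (hasSum_thetaCoset x τ).mul_right (thetaE8Term (τ / 2) u x)
      rw [thetaCoset_eq] at h4
      refine h4.congr_fun fun z => ?_
      change thetaE8Term τ u (x + z) * thetaE8Term τ u (-z) = _
      simp only [thetaE8Term, ← Complex.exp_add]
      congr 1
      have e1 : ell (-z) u = -ell z u := by
        have := ell_zsmul_left (-1) z u
        simpa using this
      rw [ell_zero_right, ell_add_left, e1, qE_neg, qE_add_two_smul, qE_add]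
      push_cast
      ring
  rw [sq]
  exact h3.unique (hasSum_weighted (fun j => thetaCoset (weightVec j) τ) τ u)

/-- Representatives of `E₈ / 2 E₈`. -/
def bits (b : Fin 8 → Fin 2) : E8 := fun i => ((b i : ℕ) : ℤ)

/-- Division with remainder by `2` on `E₈`. -/
def bitsEquiv : (Fin 8 → Fin 2) × E8 ≃ E8 where
  toFun p := bits p.1 + (2 : ℤ) • p.2
  invFun x := (fun i => ⟨(x i % 2).toNat, by omega⟩, fun i => x i / 2)
  left_inv p := by
    obtain ⟨b, z⟩ := p
    refine Prod.ext (funext fun i => Fin.ext ?_) (funext fun i => ?_)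
    · have := (b i).isLt
      simp [bits]
      omega
    · have := (b i).isLt
      simp [bits]
      omega
  right_inv x := by
    funext i
    simp [bits]
    omega

/-- The type of a representative, in decidable form. -/
def bitsType (b : Fin 8 → Fin 2) : Fin 3 :=
  if qE (bits b) % 2 = 1 then 2 else if b = 0 then 0 else 1

open Classical in
theorem vecType_bits (b : Fin 8 → Fin 2) : vecType (bits b) = bitsType b := by
  refine if_congr Int.odd_iff rfl (if_congr ?_ rfl rfl)
  constructor
  · rintro ⟨y, hy⟩
    funext i
    have h1 : ((b i : ℕ) : ℤ) = 2 * y i := congrFun hy i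
    have := (b i).isLt
    refine Fin.ext ?_
    simp
    omega
  · rintro rfl
    exact ⟨0, by funext i; simp [bits]⟩

/-- The sizes of the three orbits in `E₈ / 2 E₈`. -/
def orbitCard : Fin 3 → ℕ := ![1, 135, 120]

theorem card_bitsType (j : Fin 3) :
    (Finset.univ.filter fun b => bitsType b = j).card = orbitCard j := by
  revert j
  decide +kernel

/-- At u = 0 all cosets of one type contribute equally, so only their number matters. -/
theorem thetaType_zero (j : Fin 3) (τ : ℍ) :
    thetaType j τ 0 = orbitCard j * thetaCoset (weightVec j) τ := by
  have h := hasSum_weighted (Pi.single j 1) τ 0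
  rw [Finset.sum_eq_single j (fun i _ hi => by rw [Pi.single_eq_of_ne hi, zero_mul]) (by simp),
    Pi.single_eq_same, one_mul, ← bitsEquiv.hasSum_iff] at h
  have h2 := h.prod_fiberwise (g := fun b => if bitsType b = j then
    thetaCoset (weightVec j) τ else 0) fun b => by
      have ht : ∀ z, vecType (bits b + (2 : ℤ) • z) = bitsType b := fun z =>
        (vecType_congr ⟨z, rfl⟩).trans (vecType_bits b)
      change HasSum (fun z : E8 => (Pi.single j 1 : Fin 3 → ℂ) (vecType (bits b + (2 : ℤ) • z)) *
        thetaE8Term (τ / 2) 0 (bits b + (2 : ℤ) • z)) _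
      simp only [ht]
      split_ifs with hb
      · rw [hb, Pi.single_eq_same]
        simp only [one_mul]
        have := hasSum_thetaCoset (bits b) τ
        rwa [thetaCoset_eq, vecType_bits, hb] at this
      · rw [Pi.single_eq_of_ne hb]
        simp
  have h3 := h2.unique (hasSum_fintype _)
  rw [h3, Finset.sum_ite, Finset.sum_const, Finset.sum_const_zero, add_zero, card_bitsType,
    nsmul_eq_mul]

/-! ### Decomposition of the generating series into orbit characters -/

/-- `e^{2πi r τ}` for integral `r`. -/
theorem orbitTerm_cls (N : ℕ → H2 → ℚ) (g : ℕ) (lam : H2) (τ : ℍ) (a : ℤ) {n m : ℤ} {x : E8}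
    (h : lam + a • fib = cls n m x) :
    orbitTerm N g lam τ a = (N g (lam + a • fib) : ℂ) *
      Complex.exp (2 * Real.pi * Complex.I * (m * τ)) := by
  have := chi_cls n m x τ 0
  rw [ell_zero_right, add_zero, show basePoint τ + ((0 : E8C) : Fin 10 → ℂ) = basePoint τ by simp]
    at this
  rw [orbitTerm, h, this]

theorem e_nine_add (a : ℤ) : e 9 + a • fib = cls 1 a 0 := by simp [cls]

theorem orbitTerm_e_nine (N : ℕ → H2 → ℚ) (g : ℕ) (τ : ℍ) (a : ℤ) :
    orbitTerm N g (e 9) τ a = (N g (e 9 + a • fib) : ℂ) *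
      Complex.exp (2 * Real.pi * Complex.I * (a * τ)) :=
  orbitTerm_cls N g (e 9) τ a (e_nine_add a)

theorem orbitTerm_levelTwoWeight (N : ℕ → H2 → ℚ) (g : ℕ) (j : Fin 3) (τ : ℍ) (a : ℤ) :
    orbitTerm N g (levelTwoWeight j) τ a = (N g (levelTwoWeight j + a • fib) : ℂ) *
      Complex.exp (2 * Real.pi * Complex.I * ((2 + a) * τ)) := by
  rw [orbitTerm_cls N g _ τ a (levelTwoWeight_add j a)]
  push_cast; rfl

/-- The change of variables `(x, a) ↦ (a + f x, x)`. -/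
def shiftEquiv (f : E8 → ℤ) : E8 × ℤ ≃ ℤ × E8 where
  toFun p := (p.2 + f p.1, p.1)
  invFun p := (p.2, p.1 - f p.2)
  left_inv p := by simp
  right_inv p := by simp

theorem genTerm_levelEquiv (N : ℕ → H2 → ℚ) (g n : ℕ) (τ : ℍ) (u : E8C) (m : ℤ) (x : E8) :
    genTerm N g n τ u (levelEquiv n (m, x)) = (N g (cls n m x) : ℂ) *
      Complex.exp (2 * Real.pi * Complex.I * (m * τ + ell x u)) := by
  rw [genTerm, ← chi_cls n m x τ u]; rfl

/-- All classes e₉ + m F + x with m = a + q(x) are conjugate to e₉ + aF, where q is the half norm.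
In the variables (x, a) the term therefore factorises. -/
theorem genTerm_level_one {N : ℕ → H2 → ℚ} {g : ℕ} (hN : ∀ w ∈ weyl, ∀ β, N g (w β) = N g β)
    (τ : ℍ) (u : E8C) (x : E8) (a : ℤ) :
    genTerm N g 1 τ u (levelEquiv ((1 : ℕ) : ℤ) (shiftEquiv qE (x, a))) =
      orbitTerm N g (e 9) τ a * thetaE8Term τ u x := by
  obtain ⟨w, hw, h⟩ := exists_weyl_level_one a x
  have h1 := hN w hw (e 9 + a • fib)
  rw [h] at h1
  have h2 := genTerm_levelEquiv N g 1 τ u (a + qE x) x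
  refine h2.trans ?_
  rw [Nat.cast_one, h1, orbitTerm_e_nine, thetaE8Term, mul_assoc ((N g (e 9 + a • fib) : ℚ) : ℂ),
    ← Complex.exp_add]
  push_cast
  ring_nf

/-- The shift of m is half the difference between the half norm of x and that of the weight. The
half norm of x yields the theta term at τ/2, and that of the weight yields the correcting
exponential. -/
theorem genTerm_level_two {N : ℕ → H2 → ℚ} {g : ℕ} (hN : ∀ w ∈ weyl, ∀ β, N g (w β) = N g β)
    (τ : ℍ) (u : E8C) (x : E8) (a : ℤ) :
    genTerm N g 2 τ u (levelEquiv ((2 : ℕ) : ℤ) (shiftEquiv (fun x => 2 + normShift x) (x, a))) =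
      orbitTerm N g (levelTwoWeight (vecType x)) τ a *
        (Complex.exp (-(Real.pi * Complex.I * weightNorm (vecType x) * τ))
          * thetaE8Term (τ / 2) u x) := by
  obtain ⟨w, hw, h⟩ := exists_weyl_level_two a x
  have h1 := hN w hw (levelTwoWeight (vecType x) + a • fib)
  rw [h] at h1
  have h2 := genTerm_levelEquiv N g 2 τ u (a + (2 + normShift x)) x
  refine h2.trans ?_
  rw [Nat.cast_ofNat, show a + (2 + normShift x) = 2 + a + normShift x by ring, h1,
    orbitTerm_levelTwoWeight, thetaE8Term,
    mul_assoc ((N g (levelTwoWeight (vecType x) + a • fib) : ℚ) : ℂ),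
    ← Complex.exp_add, ← Complex.exp_add]
  congr 2
  have h3 : (2 * normShift x : ℂ) = qE x - weightNorm (vecType x) := by
    exact_mod_cast two_mul_normShift x
  push_cast
  linear_combination (Real.pi * Complex.I * τ) * h3

/-- Fubini for an absolutely convergent double series. Each coefficient sequence is summable because
it occurs, up to a nonzero factor, along a fibre. -/
theorem decompose_hasSum {ι J : Type*} (φ : E8 × ℤ ≃ ι) {F : ι → ℂ} {S : ℂ} (hS : HasSum F S)
    (ty : E8 → J) (hty : Function.Surjective ty) (c : J → ℤ → ℂ) (t : E8 → ℂ) (ht : ∀ x, t x ≠ 0)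
    (hF : ∀ x a, F (φ (x, a)) = c (ty x) a * t x) :
    (∀ j, Summable (c j)) ∧ HasSum (fun x => (∑' a, c (ty x) a) * t x) S := by
  have h1 : HasSum (fun p : E8 × ℤ => c (ty p.1) p.2 * t p.1) S := by
    refine HasSum.congr_fun ((Equiv.hasSum_iff φ).mpr hS) fun p => ?_
    exact (hF p.1 p.2).symm
  have hs : ∀ j, Summable (c j) := by
    intro j
    obtain ⟨x, rfl⟩ := hty j
    have h2 : Summable fun a => c (ty x) a * t x :=
      h1.summable.comp_injective (i := fun b => (x, b)) fun _ _ hab => (Prod.ext_iff.mp hab).2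
    exact (summable_mul_right_iff (ht x)).mp h2
  exact ⟨hs, h1.prod_fiberwise fun x => (hs (ty x)).hasSum.mul_right (t x)⟩

theorem level_one_decomposition {N : ℕ → H2 → ℚ} {g : ℕ}
    (hN : ∀ w ∈ weyl, ∀ β, N g (w β) = N g β) {τ : ℍ} {u : E8C} {S : ℂ}
    (hS : HasSum (genTerm N g 1 τ u) S) :
    Summable (orbitTerm N g (e 9) τ) ∧ S = orbitChar N g (e 9) τ * thetaE8 τ u := by
  obtain ⟨hs, h⟩ := decompose_hasSum ((shiftEquiv qE).trans (levelEquiv ((1 : ℕ) : ℤ))) hS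
    (fun _ => ()) (fun _ => ⟨0, rfl⟩) (fun _ => orbitTerm N g (e 9) τ) (thetaE8Term τ u)
    (fun x => Complex.exp_ne_zero _) (genTerm_level_one hN τ u)
  refine ⟨hs (), ?_⟩
  have h2 : HasSum (fun x => (∑' a, orbitTerm N g (e 9) τ a) * thetaE8Term τ u x)
    ((∑' a, orbitTerm N g (e 9) τ a) * thetaE8 τ u) :=
    (hasSum_thetaE8Term τ.im_pos u).mul_left (∑' a, orbitTerm N g (e 9) τ a)
  exact h.unique h2

theorem vecType_surjective : Function.Surjective vecType := fun j =>
  ⟨weightVec j, vecType_weightVec j⟩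

/-- The contribution of an orbit to the generating series of level `2`. -/
theorem level_two_decomposition {N : ℕ → H2 → ℚ} {g : ℕ}
    (hN : ∀ w ∈ weyl, ∀ β, N g (w β) = N g β) {τ : ℍ} {u : E8C} {S : ℂ}
    (hS : HasSum (genTerm N g 2 τ u) S) :
    (∀ j, Summable (orbitTerm N g (levelTwoWeight j) τ)) ∧
      S = ∑ j, orbitChar N g (levelTwoWeight j) τ *
        Complex.exp (-(Real.pi * Complex.I * weightNorm j * τ)) * thetaType j τ u := by
  obtain ⟨hs, h⟩ := decompose_hasSum
    ((shiftEquiv fun x => 2 + normShift x).trans (levelEquiv ((2 : ℕ) : ℤ))) hS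
    vecType vecType_surjective (fun j => orbitTerm N g (levelTwoWeight j) τ)
    (fun x => Complex.exp (-(Real.pi * Complex.I * weightNorm (vecType x) * τ))
          * thetaE8Term (τ / 2) u x)
    (fun x => mul_ne_zero (Complex.exp_ne_zero _) (Complex.exp_ne_zero _))
    (genTerm_level_two hN τ u)
  refine ⟨hs, ?_⟩
  have h2 := hasSum_weighted (fun j => orbitChar N g (levelTwoWeight j) τ *
      Complex.exp (-(Real.pi * Complex.I * weightNorm j * τ))) τ u
  refine h.unique (h2.congr_fun fun x => ?_)
  rw [orbitChar]; exact (mul_assoc _ _ _).symm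

theorem orbitMult_levelTwoWeight (j : Fin 3) (τ : ℍ) :
    orbitMult (levelTwoWeight j) τ =
      Complex.exp (-(Real.pi * Complex.I * weightNorm j * τ)) * thetaType j τ 0 := by
  let f : {x // vecType x = j} → MulAction.orbit weyl (levelTwoWeight j) := fun x =>
    ⟨cls 2 (2 + normShift x.1) x.1, (mem_orbit_levelTwoWeight_iff j _).mpr ⟨x.1, x.2, rfl⟩⟩
  have hf : Function.Bijective f := by
    constructor
    · intro x y h
      have := congrArg (fun β => proj β.1) h
      simp only [f, proj_cls] at this
      exact Subtype.ext this
    · rintro ⟨β, hβ⟩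
      obtain ⟨x, hx, rfl⟩ := (mem_orbit_levelTwoWeight_iff j _).mp hβ
      exact ⟨⟨x, hx⟩, rfl⟩
  rw [orbitMult, ← (Equiv.ofBijective f hf).tsum_eq, thetaType, ← tsum_mul_left]
  refine tsum_congr fun x => ?_
  obtain ⟨x, rfl⟩ := x
  have h0 := levelTwoWeight_add (vecType x) 0
  rw [zero_smul, add_zero, add_zero] at h0
  have h1 : cls 2 (2 + normShift x) x - levelTwoWeight (vecType x)
      = cls 0 (normShift x) (x - weightVec (vecType x)) := by
    rw [h0, cls, cls, cls, map_sub, add_smul]; module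
  have h2 := chi_cls 0 (normShift x) (x - weightVec (vecType x)) τ 0
  rw [ell_zero_right, add_zero, show basePoint τ + ((0 : E8C) : Fin 10 → ℂ) = basePoint τ by simp,
    ← h1] at h2
  refine h2.trans ?_
  rw [thetaE8Term, ell_zero_right, ← Complex.exp_add]
  congr 1
  have h3 : (2 * normShift x : ℂ) = qE x - weightNorm (vecType x) := by
    exact_mod_cast two_mul_normShift x
  linear_combination (Real.pi * Complex.I * τ) * h3

/-! ### Consequences of the vanishing conditions -/

theorem constantCoeff_sincHalf : PowerSeries.constantCoeff sincHalf = 1 := by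
  rw [← PowerSeries.coeff_zero_eq_constantCoeff_apply, sincHalf, PowerSeries.coeff_mk]
  simp

theorem gvC_zero_right (g : ℕ) : gvC g 0 = 1 := by
  rw [gvC, mul_zero, PowerSeries.coeff_zero_eq_constantCoeff_apply]
  split_ifs <;> simp [constantCoeff_sincHalf, PowerSeries.constantCoeff_inv]

theorem gvC_zero_left (n : ℕ) : gvC 0 n = PowerSeries.coeff (2 * n) (sincHalf⁻¹ ^ 2) := by
  rw [gvC, if_pos rfl]

theorem sincHalf_inv_mul : sincHalf⁻¹ * sincHalf = 1 :=
  PowerSeries.inv_mul_cancel _ (by rw [constantCoeff_sincHalf]; exact one_ne_zero)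

theorem coeff_sincHalf_inv_one : PowerSeries.coeff 1 sincHalf⁻¹ = 0 ∧
    PowerSeries.coeff 2 sincHalf⁻¹ = 1 / 24 ∧ PowerSeries.coeff 3 sincHalf⁻¹ = 0 ∧
    PowerSeries.coeff 4 sincHalf⁻¹ = 7 / 5760 ∧ PowerSeries.coeff 5 sincHalf⁻¹ = 0 ∧
    PowerSeries.coeff 6 sincHalf⁻¹ = 31 / 967680 := by
  have h : ∀ n, PowerSeries.coeff n (sincHalf⁻¹ * sincHalf) =
      PowerSeries.coeff n (1 : PowerSeries ℚ) := fun n => by rw [sincHalf_inv_mul]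
  have h0 : PowerSeries.coeff 0 sincHalf⁻¹ = 1 := by
    rw [PowerSeries.coeff_zero_eq_constantCoeff_apply, PowerSeries.constantCoeff_inv,
      constantCoeff_sincHalf, inv_one]
  have hs : ∀ n, PowerSeries.coeff n sincHalf =
      if Even n then (-1) ^ (n / 2) / (2 ^ n * (n + 1).factorial : ℚ) else 0 := fun n => by
    rw [sincHalf, PowerSeries.coeff_mk]
  have s0 : PowerSeries.coeff 0 sincHalf = 1 := by rw [hs]; norm_num
  have s1 : PowerSeries.coeff 1 sincHalf = 0 := by rw [hs, if_neg (by decide)]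
  have s2 : PowerSeries.coeff 2 sincHalf = -1 / 24 := by
    rw [hs, if_pos (by decide)]; norm_num [Nat.factorial]
  have s3 : PowerSeries.coeff 3 sincHalf = 0 := by rw [hs, if_neg (by decide)]
  have s4 : PowerSeries.coeff 4 sincHalf = 1 / 1920 := by
    rw [hs, if_pos (by decide)]; norm_num [Nat.factorial]
  have s5 : PowerSeries.coeff 5 sincHalf = 0 := by rw [hs, if_neg (by decide)]
  have s6 : PowerSeries.coeff 6 sincHalf = -1 / 322560 := by
    rw [hs, if_pos (by decide)]; norm_num [Nat.factorial]
  have e1 := h 1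
  have e2 := h 2
  have e3 := h 3
  have e4 := h 4
  have e5 := h 5
  have e6 := h 6
  simp only [PowerSeries.coeff_mul, Finset.Nat.antidiagonal_succ, Finset.Nat.antidiagonal_zero,
    Finset.sum_cons, Finset.map_cons, Finset.sum_singleton, Finset.map_singleton,
    PowerSeries.coeff_one] at e1 e2 e3 e4 e5 e6
  simp [h0, s0, s1, s2, s3, s4, s5, s6] at e1 e2 e3 e4 e5 e6
  have t1 : PowerSeries.coeff 1 sincHalf⁻¹ = 0 := by linarith
  have t2 : PowerSeries.coeff 2 sincHalf⁻¹ = 1 / 24 := by linarith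
  have t3 : PowerSeries.coeff 3 sincHalf⁻¹ = 0 := by linarith
  have t4 : PowerSeries.coeff 4 sincHalf⁻¹ = 7 / 5760 := by linarith
  have t5 : PowerSeries.coeff 5 sincHalf⁻¹ = 0 := by linarith
  exact ⟨t1, t2, t3, t4, t5, by linarith⟩

theorem gvC_values : gvC 0 0 = 1 ∧ gvC 0 1 = 1 / 12 ∧ gvC 0 2 = 1 / 240 ∧ gvC 0 3 = 1 / 6048 := by
  obtain ⟨t1, t2, t3, t4, t5, t6⟩ := coeff_sincHalf_inv_one
  have h0 : PowerSeries.coeff 0 sincHalf⁻¹ = 1 := by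
    rw [PowerSeries.coeff_zero_eq_constantCoeff_apply, PowerSeries.constantCoeff_inv,
      constantCoeff_sincHalf, inv_one]
  refine ⟨gvC_zero_right 0, ?_, ?_, ?_⟩ <;>
  · rw [gvC_zero_left, sq]
    simp only [PowerSeries.coeff_mul, Finset.Nat.antidiagonal_succ, Finset.Nat.antidiagonal_zero,
      Finset.sum_cons, Finset.map_cons, Finset.sum_singleton,
      Finset.map_singleton, Nat.mul_one, Nat.reduceMul]
    simp [h0, t1, t2, t3, t4, t5, t6]
    norm_num

theorem twiceGenus_cls (n m : ℤ) (x : E8) :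
    twiceGenus (cls n m x) = -n ^ 2 + 2 * n * m - 2 * qE x + 2 - n := by
  rw [twiceGenus, pair_cls_self, pair_cls_fib]

theorem bps_level_one {G : ℕ} {N nb : ℕ → H2 → ℚ}
    (hb : IsBPS G 2 N nb) {g : ℕ} (hg : g ≤ G) {β : H2} (hβ : pair β fib = 1) :
    N g β = ∑ h ∈ Finset.range (g + 1), gvC h (g - h) * nb h β := by
  rw [hb g hg β hβ.ge (by rw [hβ]; norm_num), hβ]
  rw [show ((1 : ℤ).toNat).divisors = {1} by decide, Finset.sum_filter, Finset.sum_singleton]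
  simp

theorem bps_level_two {G : ℕ} {N nb : ℕ → H2 → ℚ}
    (hb : IsBPS G 2 N nb) {g : ℕ} (hg : g ≤ G) {β : H2} (hβ : pair β fib = 2) :
    N g β = ∑ h ∈ Finset.range (g + 1), gvC h (g - h) * nb h β +
      if ∀ i, 2 ∣ β i then ∑ h ∈ Finset.range (g + 1),
        gvC h (g - h) * 2 ^ (2 * (g : ℤ) - 3) * nb h (fun i => β i / 2) else 0 := by
  rw [hb g hg β (by rw [hβ]; norm_num) (by rw [hβ]; norm_num), hβ]
  rw [show ((2 : ℤ).toNat).divisors = {1, 2} by decide, Finset.sum_filter,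
    Finset.sum_pair (by norm_num)]
  simp

theorem nb_eq_zero_of_genus {G : ℕ} {nb : ℕ → H2 → ℚ}
    (hv : Vanishing G 2 nb) {h : ℕ} (hh : h ≤ G) {β : H2} (h1 : 1 ≤ pair β fib)
    (h2 : pair β fib ≤ 2) (hlt : twiceGenus β < 2 * h) : nb h β = 0 := by
  by_contra hne
  have := (hv h hh β h1 (by exact_mod_cast h2) hne).2.2
  omega

theorem sum_nb_eq_zero {G : ℕ} {nb : ℕ → H2 → ℚ}
    (hv : Vanishing G 2 nb) {g : ℕ} (hg : g ≤ G) {β : H2} (h1 : 1 ≤ pair β fib)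
    (h2 : pair β fib ≤ 2) (hneg : twiceGenus β < 0) :
    ∑ h ∈ Finset.range (g + 1), gvC h (g - h) * nb h β = 0 := by
  refine Finset.sum_eq_zero fun h hh => ?_
  have hh' := Finset.mem_range.mp hh
  rw [nb_eq_zero_of_genus hv (by omega) h1 h2 (by omega), mul_zero]

theorem sum_nb_eq_single {G : ℕ} {nb : ℕ → H2 → ℚ}
    (hv : Vanishing G 2 nb) {g : ℕ} (hg : g ≤ G) {β : H2} (h1 : 1 ≤ pair β fib)
    (h2 : pair β fib ≤ 2) (hz : twiceGenus β < 2) :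
    ∑ h ∈ Finset.range (g + 1), gvC h (g - h) * nb h β = gvC 0 g * nb 0 β := by
  rw [Finset.sum_eq_single 0]
  · simp
  · intro h hh h0
    have hh' := Finset.mem_range.mp hh
    rw [nb_eq_zero_of_genus hv (by omega) h1 h2 (by omega), mul_zero]
  · simp

/-- The class has genus a < 0, and at level 1 there are no multiple cover contributions. -/
theorem N_e_nine_neg {G : ℕ} {N nb : ℕ → H2 → ℚ}
    (hb : IsBPS G 2 N nb) (hv : Vanishing G 2 nb) {g : ℕ} (hg : g ≤ G)
    {a : ℤ} (ha : a < 0) : N g (e 9 + a • fib) = 0 := by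
  have hl : pair (e 9 + a • fib) fib = 1 := by rw [e_nine_add, pair_cls_fib]
  rw [bps_level_one hb hg hl]
  refine sum_nb_eq_zero hv hg hl.ge (by omega) ?_
  rw [e_nine_add, twiceGenus_cls, qE_zero]; linarith

/-- As e₉ has genus 0, only the BPS number with h = 0 survives, and it equals N₀(e₉). -/
theorem N_e_nine {G : ℕ} {N nb : ℕ → H2 → ℚ}
    (hb : IsBPS G 2 N nb) (hv : Vanishing G 2 nb) {g : ℕ} (hg : g ≤ G) :
    N g (e 9) = gvC 0 g * N 0 (e 9) := by
  have hl : pair (e 9) fib = 1 := pair_e_nine_fib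
  have hgen : twiceGenus (e 9) < 2 := by decide
  rw [bps_level_one hb hg hl, bps_level_one hb (Nat.zero_le G) hl,
    sum_nb_eq_single hv hg hl.ge (by omega) hgen,
    sum_nb_eq_single hv (Nat.zero_le G) hl.ge (by omega) hgen, gvC_zero_right]
  ring

/-- For λ₁ and λ₇ the genus is negative below the weight itself. Two coordinates of opposite parity
show that no translate by a multiple of F is divisible by 2, so there is no multiple cover term
either. -/
theorem N_weight_neg {G : ℕ} {N nb : ℕ → H2 → ℚ}
    (hb : IsBPS G 2 N nb) (hv : Vanishing G 2 nb) {g : ℕ} (hg : g ≤ G)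
    {j : Fin 3} (hj : j ≠ 0) {a : ℤ} (ha : a < 0) :
    N g (levelTwoWeight j + a • fib) = 0 := by
  have hl : pair (levelTwoWeight j + a • fib) fib = 2 := by rw [levelTwoWeight_add, pair_cls_fib]
  rw [bps_level_two hb hg hl, sum_nb_eq_zero hv hg (by omega) (by omega), if_neg, add_zero]
  · intro h
    rw [levelTwoWeight_eq, fib_eq] at h
    have h1 := h 1
    have h2 := h 8
    have h3 := h 2
    fin_cases j
    · exact hj rfl
    · simp at h1 h2 h3; omega
    · simp at h1 h2 h3; omega
  · rw [twiceGenus_levelTwoWeight]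
    fin_cases j
    · exact absurd rfl hj
    · simp; omega
    · simp; omega

theorem N_weight_one {G : ℕ} {N nb : ℕ → H2 → ℚ}
    (hb : IsBPS G 2 N nb) (hv : Vanishing G 2 nb) {g : ℕ} (hg : g ≤ G) :
    N g (levelTwoWeight 1) = gvC 0 g * N 0 (levelTwoWeight 1) := by
  have hl := pair_levelTwoWeight_fib 1
  have hgen : twiceGenus (levelTwoWeight 1) < 2 := by decide
  have hd : ¬ ∀ i, 2 ∣ levelTwoWeight 1 i := by decide
  rw [bps_level_two hb hg hl, bps_level_two hb (Nat.zero_le G) hl, if_neg hd, if_neg hd,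
    sum_nb_eq_single hv hg (by omega) (by omega) hgen,
    sum_nb_eq_single hv (Nat.zero_le G) (by omega) (by omega) hgen, gvC_zero_right]
  ring

/-- Since 2λ₀ = 2(e₉ + F), the translates by even multiples of F carry double cover contributions
from level 1. -/
theorem half_weight_zero (a : ℤ) :
    (fun i => (levelTwoWeight 0 + (2 * a) • fib) i / 2) = e 9 + (1 + a) • fib := by
  rw [levelTwoWeight_eq, fib_eq, e_nine_eq]
  refine ext_ten ?_
  simp
  omega

/-- The primitive part already vanishes for a < -1. The double covers come from e₉ + (1 + a/2) F and
vanish only for a < -2. -/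
theorem N_weight_zero_neg {G : ℕ} {N nb : ℕ → H2 → ℚ}
    (hb : IsBPS G 2 N nb) (hv : Vanishing G 2 nb) {g : ℕ} (hg : g ≤ G)
    {a : ℤ} (ha : a < -2) : N g (levelTwoWeight 0 + a • fib) = 0 := by
  have hl : pair (levelTwoWeight 0 + a • fib) fib = 2 := by rw [levelTwoWeight_add, pair_cls_fib]
  rw [bps_level_two hb hg hl, sum_nb_eq_zero hv hg (by omega) (by omega), zero_add]
  · split_ifs with h
    · obtain ⟨b, rfl⟩ : ∃ b, a = 2 * b := by
        rw [levelTwoWeight_eq, fib_eq] at h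
        have h1 := h 9
        simp at h1
        omega
      rw [half_weight_zero]
      have hl' : pair (e 9 + (1 + b) • fib) fib = 1 := by rw [e_nine_add, pair_cls_fib]
      have := sum_nb_eq_zero hv hg hl'.ge (by omega)
        (by rw [e_nine_add, twiceGenus_cls, qE_zero]; omega)
      rw [← mul_zero ((2 : ℚ) ^ (2 * (g : ℤ) - 3)), ← this, Finset.mul_sum]
      exact Finset.sum_congr rfl fun i _ => by ring
    · rfl
  · rw [twiceGenus_levelTwoWeight]; simp; omega

/-- The class is 2e₉. Its own genus is negative, so the double cover of e₉ is the only contribution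
and produces the factor 2^{2g-3}. -/
theorem N_weight_zero_first {G : ℕ} {N nb : ℕ → H2 → ℚ}
    (hb : IsBPS G 2 N nb) (hv : Vanishing G 2 nb) {g : ℕ} (hg : g ≤ G) :
    N g (levelTwoWeight 0 + (-2 : ℤ) • fib) =
    2 ^ (2 * (g : ℤ) - 3) * gvC 0 g * N 0 (e 9) := by
  have hl : pair (levelTwoWeight 0 + (-2 : ℤ) • fib) fib = 2 := by
    rw [levelTwoWeight_add, pair_cls_fib]
  have hd : ∀ i, 2 ∣ (levelTwoWeight 0 + (-2 : ℤ) • fib) i := by decide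
  have hhalf := half_weight_zero (-1)
  rw [show (2 * -1 : ℤ) = -2 by norm_num, add_neg_cancel, zero_smul, add_zero] at hhalf
  have hgen : twiceGenus (e 9) < 2 := by decide
  rw [bps_level_two hb hg hl, if_pos hd, hhalf, sum_nb_eq_zero hv hg (by omega) (by omega)
    (by decide), zero_add, bps_level_one hb (Nat.zero_le G) pair_e_nine_fib,
    sum_nb_eq_single hv (Nat.zero_le G) (by rw [pair_e_nine_fib])
      (by rw [pair_e_nine_fib]; norm_num)
      hgen, gvC_zero_right]
  have := sum_nb_eq_single hv hg (by rw [pair_e_nine_fib]) (by rw [pair_e_nine_fib]; norm_num) hgen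
  rw [one_mul, mul_assoc, ← this, Finset.mul_sum]
  exact Finset.sum_congr rfl fun i _ => by ring

/-! ### Expansions in `q^{1/2}` -/

/-- `q^{1/2} = e^{πiτ}`. -/
def nome (τ : ℍ) : ℂ := Complex.exp (Real.pi * Complex.I * τ)

/-- `f` is the sum of the power series `p` in `q^{1/2}`. -/
def HasExp (p : PowerSeries ℂ) (f : ℍ → ℂ) : Prop :=
  ∀ τ, HasSum (fun n => PowerSeries.coeff n p * nome τ ^ n) (f τ)

theorem nome_ne_zero (τ : ℍ) : nome τ ≠ 0 := Complex.exp_ne_zero _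

theorem nome_eq_qParam (τ : ℍ) : nome τ = Function.Periodic.qParam 2 τ := by
  rw [nome, Function.Periodic.qParam]
  congr 1
  push_cast
  ring

theorem norm_nome_lt_one (τ : ℍ) : ‖nome τ‖ < 1 := by
  rw [nome_eq_qParam]
  exact Function.Periodic.norm_qParam_lt_one two_pos τ.im_pos

theorem exists_nome_eq {z : ℂ} (hz : z ≠ 0) (h1 : ‖z‖ < 1) : ∃ τ, nome τ = z := by
  refine ⟨⟨Function.Periodic.invQParam 2 z,
    Function.Periodic.im_invQParam_pos_of_norm_lt_one two_pos h1 hz⟩, ?_⟩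
  rw [nome_eq_qParam]
  exact Function.Periodic.qParam_right_inv two_ne_zero hz

theorem tendsto_nome : Filter.Tendsto nome atImInfty (nhds 0) := by
  have := qParam_tendsto_atImInfty (h := 2) two_pos
  exact this.congr fun τ => (nome_eq_qParam τ).symm

theorem nome_add_one (τ : ℍ) : nome ((1 : ℝ) +ᵥ τ) = -nome τ := by
  rw [nome, nome, coe_vadd, mul_add, Complex.exp_add]
  simp [Complex.exp_pi_mul_I]

namespace HasExp

variable {p s : PowerSeries ℂ} {f g : ℍ → ℂ}

/-- Every nonzero point of the unit disc is a value of q^{1/2}. The series therefore converges on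
the whole disc, and f is the pullback of an analytic function. -/
theorem hasFPowerSeries (h : HasExp p f) :
    ∃ F : ℂ → ℂ, HasFPowerSeriesOnBall F (.ofScalars ℂ fun n => PowerSeries.coeff n p) 0 1 ∧
      ∀ τ, f τ = F (nome τ) := by
  refine ⟨fun z => ∑' n, PowerSeries.coeff n p * z ^ n, ?_, fun τ => (h τ).tsum_eq.symm⟩
  have hsum : ∀ z : ℂ, ‖z‖ < 1 → Summable fun n => PowerSeries.coeff n p * z ^ n := by
    intro z hz
    rcases eq_or_ne z 0 with rfl | hz0
    · exact summable_of_ne_finset_zero (s := {0}) fun n hn => by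
        rw [zero_pow (by simpa using hn), mul_zero]
    · obtain ⟨τ, rfl⟩ := exists_nome_eq hz0 hz
      exact (h τ).summable
  constructor
  · refine le_of_forall_lt_imp_le_of_dense fun r hr => ?_
    lift r to NNReal using hr.ne_top
    apply FormalMultilinearSeries.le_radius_of_summable
    have := (hsum (r : ℝ) (by simpa using hr)).norm
    refine this.congr fun n => ?_
    rw [norm_mul, norm_pow, Complex.norm_real, NNReal.norm_eq,
      FormalMultilinearSeries.ofScalars_norm]
  · simp
  · intro y hy
    rw [← ENNReal.coe_one, Metric.eball_coe, NNReal.coe_one, mem_ball_zero_iff] at hy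
    simpa [mul_comm] using (hsum y hy).hasSum

theorem tendsto (h : HasExp p f) :
    Filter.Tendsto f atImInfty (nhds (PowerSeries.constantCoeff p)) := by
  obtain ⟨F, hF, hf⟩ := h.hasFPowerSeries
  have h0 : F 0 = PowerSeries.constantCoeff p := by
    have := hF.hasSum (Metric.mem_eball_self one_pos)
    rw [add_zero] at this
    refine (this.unique (hasSum_single 0 fun n hn => ?_)).trans ?_
    · simp [hn]
    · simp
  rw [← h0]
  exact (hF.continuousOn.continuousAt (Metric.eball_mem_nhds _ one_pos)).tendsto.comp tendsto_nome
    |>.congr fun τ => (hf τ).symm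

theorem bounded (h : HasExp p f) : IsBoundedAtImInfty f := h.tendsto.isBigO_one ℝ

/-- The two analytic functions agree on the punctured disc, hence by continuity also at 0, and so
have the same Taylor series. -/
theorem unique (h : HasExp p f) (h' : HasExp s f) : p = s := by
  obtain ⟨F, hF, hf⟩ := h.hasFPowerSeries
  obtain ⟨F', hF', hf'⟩ := h'.hasFPowerSeries
  have heq : F =ᶠ[nhds 0] F' := by
    have hne : F =ᶠ[nhdsWithin 0 {0}ᶜ] F' := by
      filter_upwards [self_mem_nhdsWithin,
        nhdsWithin_le_nhds (Metric.ball_mem_nhds (0 : ℂ) one_pos)] with z hz hz1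
      obtain ⟨τ, rfl⟩ := exists_nome_eq hz (by simpa using hz1)
      rw [← hf, hf']
    have c1 := hF.continuousOn.continuousAt (Metric.eball_mem_nhds _ one_pos)
    have c2 := hF'.continuousOn.continuousAt (Metric.eball_mem_nhds _ one_pos)
    exact (c1.eventuallyEq_nhds_iff_eventuallyEq_nhdsNE c2).mp hne
  have := (hF.hasFPowerSeriesAt.congr heq).eq_formalMultilinearSeries hF'.hasFPowerSeriesAt
  ext n
  have := congrArg (fun P : FormalMultilinearSeries ℂ ℂ ℂ => P.coeff n) this
  simpa [FormalMultilinearSeries.coeff_ofScalars] using this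

theorem ext_fun (h : HasExp p f) (h' : HasExp p g) : f = g :=
  funext fun τ => (h τ).unique (h' τ)

theorem differentiable (h : HasExp p f) :
    DifferentiableOn ℂ (f ∘ ofComplex) {z | 0 < z.im} := by
  obtain ⟨F, hF, hf⟩ := h.hasFPowerSeries
  have h1 : DifferentiableOn ℂ (fun z : ℂ => F (Complex.exp (Real.pi * Complex.I * z)))
      {z | 0 < z.im} := by
    refine hF.differentiableOn.comp (by fun_prop) fun z hz => ?_
    have := norm_nome_lt_one ⟨z, hz⟩
    rw [← ENNReal.coe_one, Metric.eball_coe, NNReal.coe_one, mem_ball_zero_iff]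
    exact this
  refine h1.congr fun z hz => ?_
  rw [Function.comp_apply, hf, ofComplex_apply_of_im_pos hz]
  rfl

theorem mdiff (h : HasExp p f) :
    MDifferentiable (modelWithCornersSelf ℂ ℂ) (modelWithCornersSelf ℂ ℂ) f :=
  mdifferentiable_iff.mpr h.differentiable

/-- A function of period 2, holomorphic and bounded at i∞, has a q-expansion of width 2, that is, a
power series in q^{1/2}. -/
theorem of_mdiff (hf : MDifferentiable (modelWithCornersSelf ℂ ℂ) (modelWithCornersSelf ℂ ℂ) f)
    (hb : IsBoundedAtImInfty f) (hper : ∀ τ, f ((2 : ℝ) +ᵥ τ) = f τ) : ∃ p, HasExp p f := by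
  refine ⟨qExpansion 2 f, fun τ => ?_⟩
  have hp : Function.Periodic (f ∘ ofComplex) ((2 : ℝ) : ℂ) := by
    intro w
    by_cases! hw : 0 < w.im
    · have : 0 < (w + (2 : ℝ)).im := by simpa using hw
      simp only [Function.comp_apply, ofComplex_apply_of_im_pos this,
        ofComplex_apply_of_im_pos hw]
      rw [← hper ⟨w, hw⟩]
      congr 1
      ext
      exact add_comm _ _
    · have : (w + (2 : ℝ)).im ≤ 0 := by simpa using hw
      simp only [Function.comp_apply, ofComplex_apply_of_im_nonpos this,
        ofComplex_apply_of_im_nonpos hw]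
  have := hasSum_qExpansion two_pos hp hf hb τ
  simpa [nome_eq_qParam] using this

theorem add_two (h : HasExp p f) (τ : ℍ) : f ((2 : ℝ) +ᵥ τ) = f τ := by
  obtain ⟨F, -, hf⟩ := h.hasFPowerSeries
  rw [hf, hf, show (2 : ℝ) +ᵥ τ = (1 : ℝ) +ᵥ (1 : ℝ) +ᵥ τ by rw [vadd_vadd]; norm_num,
    nome_add_one, nome_add_one, neg_neg]

theorem add (h : HasExp p f) (h' : HasExp s g) : HasExp (p + s) (f + g) := fun τ => by
  simpa [add_mul] using (h τ).add (h' τ)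

theorem const_mul (c : ℂ) (h : HasExp p f) : HasExp (c • p) (c • f) := fun τ => by
  simpa [mul_assoc] using (h τ).mul_left c

theorem neg (h : HasExp p f) : HasExp (-p) (-f) := fun τ => by
  simpa using (h τ).neg

theorem sub (h : HasExp p f) (h' : HasExp s g) : HasExp (p - s) (f - g) := by
  rw [sub_eq_add_neg, sub_eq_add_neg]; exact h.add h'.neg

theorem mul (h : HasExp p f) (h' : HasExp s g) : HasExp (p * s) (f * g) := fun τ => by
  have h1 := norm_summable (h τ)
  have h2 := norm_summable (h' τ)
  have h3 := summable_norm_sum_mul_antidiagonal_of_summable_norm h1 h2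
  have h4 := tsum_mul_tsum_eq_tsum_sum_antidiagonal_of_summable_norm h1 h2
  rw [(h τ).tsum_eq, (h' τ).tsum_eq] at h4
  rw [Pi.mul_apply, h4]
  refine h3.of_norm.hasSum.congr_fun fun n => ?_
  rw [PowerSeries.coeff_mul, Finset.sum_mul]
  refine Finset.sum_congr rfl fun ij hij => ?_
  rw [← Finset.HasAntidiagonal.mem_antidiagonal.mp hij, pow_add]
  ring

theorem const (c : ℂ) : HasExp (PowerSeries.C c) (fun _ => c) := fun τ => by
  have := hasSum_single (f := fun n => PowerSeries.coeff n (PowerSeries.C c) * nome τ ^ n) 0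
    fun n hn => by rw [PowerSeries.coeff_C, if_neg hn, zero_mul]
  simpa using this

theorem one : HasExp 1 1 := by simpa using! const 1

theorem zero : HasExp 0 0 := by simpa using! const 0

theorem pow (h : HasExp p f) : ∀ n : ℕ, HasExp (p ^ n) (f ^ n)
  | 0 => by simpa using one
  | n + 1 => by rw [pow_succ, pow_succ]; exact (pow h n).mul h

theorem sum {ι : Type*} {S : Finset ι} {p : ι → PowerSeries ℂ} {f : ι → ℍ → ℂ}
    (h : ∀ i ∈ S, HasExp (p i) (f i)) : HasExp (∑ i ∈ S, p i) (∑ i ∈ S, f i) := by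
  classical
  induction S using Finset.induction_on with
  | empty => simpa using zero
  | insert i S hi ih =>
    rw [Finset.sum_insert hi, Finset.sum_insert hi]
    exact (h i (Finset.mem_insert_self i S)).add
      (ih fun j hj => h j (Finset.mem_insert_of_mem hj))

theorem nome : HasExp PowerSeries.X nome := fun τ => by
  have := hasSum_single (f := fun n => PowerSeries.coeff n (PowerSeries.X : PowerSeries ℂ)
    * HalfK3.nome τ ^ n) 1 fun n hn => by rw [PowerSeries.coeff_X, if_neg hn, zero_mul]
  simpa using this

/-- Division by a nowhere vanishing function with non-zero constant term. -/
theorem div (h : HasExp p f) (h' : HasExp s g) (hg : ∀ τ, g τ ≠ 0)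
    (hs : PowerSeries.constantCoeff s ≠ 0) : ∃ t, HasExp t (f / g) ∧ t * s = p := by
  have hm : MDifferentiable (modelWithCornersSelf ℂ ℂ) (modelWithCornersSelf ℂ ℂ) (f / g) := by
    rw [mdifferentiable_iff]
    exact h.differentiable.div h'.differentiable fun z _ => hg _
  have hb : IsBoundedAtImInfty (f / g) := (h.tendsto.div h'.tendsto hs).isBigO_one ℝ
  obtain ⟨t, ht⟩ := of_mdiff hm hb fun τ => by
    rw [Pi.div_apply, Pi.div_apply, h.add_two, h'.add_two]
  refine ⟨t, ht, ?_⟩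
  have h1 := ht.mul h'
  rw [show f / g * g = f from funext fun τ => div_mul_cancel₀ _ (hg τ)] at h1
  exact h1.unique h

theorem div_nome_pow {k : ℕ} (h : HasExp (PowerSeries.X ^ k * p) f) :
    HasExp p (f / HalfK3.nome ^ k) := fun τ => by
  have h0 := pow_ne_zero k (nome_ne_zero τ)
  have h1 := (h τ).mul_right (HalfK3.nome τ ^ k)⁻¹
  rw [← hasSum_nat_add_iff' k] at h1
  have hz : ∑ i ∈ Finset.range k, PowerSeries.coeff i (PowerSeries.X ^ k * p) *
      HalfK3.nome τ ^ i * (HalfK3.nome τ ^ k)⁻¹ = 0 := Finset.sum_eq_zero fun i hi => by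
    rw [PowerSeries.coeff_X_pow_mul', if_neg (by simpa using hi), zero_mul, zero_mul]
  rw [hz, sub_zero] at h1
  rw [Pi.div_apply, Pi.pow_apply, div_eq_mul_inv]
  refine h1.congr_fun fun n => ?_
  rw [PowerSeries.coeff_X_pow_mul', if_pos (by omega), Nat.add_sub_cancel, pow_add]
  field_simp

/-- The coefficients of the translate by `1`. -/
theorem vadd_one (h : HasExp p f) :
    HasExp (PowerSeries.mk fun n => (-1) ^ n * PowerSeries.coeff n p)
      (fun τ => f ((1 : ℝ) +ᵥ τ)) := fun τ => by
  refine (h ((1 : ℝ) +ᵥ τ)).congr_fun fun n => ?_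
  rw [PowerSeries.coeff_mk, nome_add_one, neg_pow]
  ring

theorem coeff_eq_zero_of_even (h : HasExp p f) (hT : ∀ τ, f ((1 : ℝ) +ᵥ τ) = f τ) {n : ℕ}
    (hn : Odd n) : PowerSeries.coeff n p = 0 := by
  have h1 : HasExp _ f := (funext hT : (fun τ => f ((1 : ℝ) +ᵥ τ)) = f) ▸ h.vadd_one
  have := congrArg (PowerSeries.coeff n) (h1.unique h)
  rw [PowerSeries.coeff_mk, hn.neg_one_pow] at this
  linear_combination (-1 / 2 : ℂ) * this

theorem coeff_eq_zero_of_odd (h : HasExp p f) (hT : ∀ τ, f ((1 : ℝ) +ᵥ τ) = -f τ) {n : ℕ}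
    (hn : Even n) : PowerSeries.coeff n p = 0 := by
  have h1 : HasExp _ (-f) := (funext hT : (fun τ => f ((1 : ℝ) +ᵥ τ)) = -f) ▸ h.vadd_one
  have := congrArg (PowerSeries.coeff n) (h1.unique h.neg)
  rw [PowerSeries.coeff_mk, hn.neg_one_pow] at this
  rw [map_neg] at this
  linear_combination (1 / 2 : ℂ) * this

/-- Formal power series over a field form a domain. Functions with expansions can thus be cancelled
even when they have zeros in ℍ. -/
theorem eq_zero_or_eq_zero (h : HasExp p f) (h' : HasExp s g) (h0 : f * g = 0) :
    f = 0 ∨ g = 0 := by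
  have h1 := h.mul h'
  rw [h0] at h1
  rcases mul_eq_zero.mp (h1.unique zero) with rfl | rfl
  · exact Or.inl (h.ext_fun zero)
  · exact Or.inr (h'.ext_fun zero)

theorem of_hasSum {ι : Type*} {c : ι → ℂ} {m : ι → ℕ}
    (h : ∀ τ, HasSum (fun i => c i * HalfK3.nome τ ^ m i) (f τ)) :
    HasExp (PowerSeries.mk fun n => ∑' i : m ⁻¹' {n}, c i) f := fun τ => by
  refine ((h τ).tsum_fiberwise m).congr_fun fun n => ?_
  rw [PowerSeries.coeff_mk, ← tsum_mul_right]
  refine tsum_congr fun i => ?_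
  have : m i = n := i.2
  rw [this]

end HasExp

/-- `f` has an expansion in `q^{1/2}` with rational coefficients. -/
def HasRatExp (p : PowerSeries ℚ) (f : ℍ → ℂ) : Prop :=
  HasExp (p.map (algebraMap ℚ ℂ)) f

/-! ### Modular forms of level one -/

theorem denom_T (τ : ℍ) : denom ModularGroup.T (τ : ℂ) = 1 := by
  rw [ModularGroup.denom_apply]; simp [ModularGroup.T]

-- The translation and the inversion generate SL₂(ℤ). By invariance, boundedness at i∞ gives
-- boundedness at every cusp.
open ModularForm MatrixGroups in
theorem exists_modularForm {k : ℤ} {p : PowerSeries ℂ} {f : ℍ → ℂ} (h : HasExp p f)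
    (hT : ∀ τ, f ((1 : ℝ) +ᵥ τ) = f τ)
    (hS : ∀ τ : ℍ, f (ModularGroup.S • τ) = (τ : ℂ) ^ k * f τ) :
    ∃ F : ModularForm 𝒮ℒ k, ⇑F = f := by
  have h1 : f ∣[k] ModularGroup.S = f := by
    funext τ
    rw [SL_slash_apply, ModularGroup.denom_S, hS, mul_right_comm, ← zpow_add₀ (ne_zero τ),
      add_neg_cancel,
      zpow_zero, one_mul]
  have h2 : f ∣[k] ModularGroup.T = f := by
    funext τ
    rw [SL_slash_apply, modular_T_smul, hT, denom_T, one_zpow, mul_one]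
  have h3 := SlashInvariantForm.slash_action_generators_SL2Z h1 h2
  exact ⟨{ toFun := f
           slash_action_eq' := fun _ ⟨γ, hγ⟩ => hγ ▸ h3 γ
           holo' := h.mdiff
           bdd_at_cusps' := fun {c} hc => by
             rw [Subgroup.IsArithmetic.isCusp_iff_isCusp_SL2Z] at hc
             rw [OnePoint.isBoundedAt_iff_forall_SL2Z hc]
             intro γ _
             rw [h3 γ]
             exact h.bounded }, rfl⟩

/-- The infinite product `∏ (1 - qⁿ)`. -/
def etaProd (τ : ℍ) : ℂ := ∏' n, (1 - ModularForm.eta_q n τ)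

theorem etaProd_ne_zero (τ : ℍ) : etaProd τ ≠ 0 := ModularForm.eta_tprod_ne_zero τ.im_pos

theorem eta_pow_twelve (τ : ℍ) : ModularForm.eta τ ^ 12 = nome τ * etaProd τ ^ 12 := by
  rw [ModularForm.eta, mul_pow, Function.Periodic.qParam, ← Complex.exp_nat_mul]
  congr 2
  push_cast
  ring

theorem qPow_eq_nome (r : ℚ) (n : ℕ) (h : 2 * r = n) (τ : ℍ) : qPow r τ = nome τ ^ n := by
  rw [qPow, nome, ← Complex.exp_nat_mul]
  congr 1
  have : (2 * r : ℂ) = n := by exact_mod_cast congrArg (fun x : ℚ => (x : ℂ)) h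
  rw [← this]
  ring

theorem exists_hasExp_etaProd : ∃ p, HasExp p etaProd ∧ PowerSeries.constantCoeff p = 1 := by
  have hd := ModularForm.differentiableOn_tprod_one_sub_pow
  have heq : ∀ τ, etaProd τ = ∏' n : ℕ, (1 - Function.Periodic.qParam 1 τ ^ (n + 1)) :=
    fun τ => rfl
  have hlim : Filter.Tendsto etaProd atImInfty (nhds 1) := by
    have h0 : ∏' n : ℕ, (1 - (0 : ℂ) ^ (n + 1)) = 1 := by simp
    have h1 : ContinuousAt (fun q : ℂ => ∏' n : ℕ, (1 - q ^ (n + 1))) 0 :=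
      hd.continuousOn.continuousAt (Metric.ball_mem_nhds _ one_pos)
    have h2 := h1.tendsto.comp (qParam_tendsto_atImInfty (h := 1) one_pos)
    rw [h0] at h2
    exact h2
  have hm : MDifferentiable (modelWithCornersSelf ℂ ℂ) (modelWithCornersSelf ℂ ℂ) etaProd := by
    rw [mdifferentiable_iff]
    have h1 : DifferentiableOn ℂ (fun z : ℂ => ∏' n : ℕ,
        (1 - (Function.Periodic.qParam 1 z) ^ (n + 1))) {z | 0 < z.im} := by
      refine hd.comp (Function.Periodic.differentiable_qParam).differentiableOn fun z hz => ?_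
      rw [mem_ball_zero_iff]
      exact Function.Periodic.norm_qParam_lt_one one_pos hz
    refine h1.congr fun z hz => ?_
    rw [Function.comp_apply, heq, ofComplex_apply_of_im_pos hz]
  obtain ⟨p, hp⟩ := HasExp.of_mdiff hm (hlim.isBigO_one ℝ) fun τ => by
    rw [heq, heq]
    have : Function.Periodic.qParam 1 ((2 : ℝ) +ᵥ τ : ℍ) = Function.Periodic.qParam 1 τ := by
      rw [coe_vadd, Function.Periodic.qParam, Function.Periodic.qParam, mul_add, add_div,
        Complex.exp_add]
      have := Complex.exp_int_mul_two_pi_mul_I 2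
      push_cast at this ⊢
      rw [show 2 * Real.pi * Complex.I * 2 / 1 = 2 * (2 * Real.pi * Complex.I) by ring, this,
        one_mul]
    rw [this]
  exact ⟨p, hp, tendsto_nhds_unique hp.tendsto hlim⟩

theorem discriminant_eq (τ : ℍ) :
    ModularForm.discriminant τ = (nome τ * etaProd τ ^ 12) ^ 2 := by
  rw [ModularForm.discriminant, ← eta_pow_twelve, ← pow_mul]

theorem exists_hasExp_discriminant : ∃ p, HasExp (PowerSeries.X ^ 2 * p) ModularForm.discriminant ∧
    HasExp p (etaProd ^ 24) ∧ PowerSeries.constantCoeff p = 1 := by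
  obtain ⟨p, hp, h1⟩ := exists_hasExp_etaProd
  refine ⟨p ^ 24, ?_, hp.pow 24, by rw [map_pow, h1, one_pow]⟩
  have := (HasExp.nome.pow 2).mul (hp.pow 24)
  rwa [show nome ^ 2 * etaProd ^ 24 = ModularForm.discriminant from funext fun τ => by
    rw [discriminant_eq]; simp only [Pi.mul_apply, Pi.pow_apply]; ring] at this

open ModularForm in
theorem discriminant_vadd_one (τ : ℍ) :
    ModularForm.discriminant ((1 : ℝ) +ᵥ τ) = ModularForm.discriminant τ := by
  have := congrFun discriminant_T_invariant τ
  rwa [SL_slash_apply, modular_T_smul, denom_T, one_zpow, mul_one] at this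

open ModularForm in
theorem discriminant_S_smul (τ : ℍ) :
    ModularForm.discriminant (ModularGroup.S • τ) = (τ : ℂ) ^ 12 * ModularForm.discriminant τ := by
  have := congrFun discriminant_S_invariant τ
  rw [SL_slash_apply, ModularGroup.denom_S] at this
  rw [← this, mul_left_comm, ← zpow_natCast, ← zpow_add₀ (ne_zero τ)]
  norm_num

/-- A level one form divided by a power of the discriminant. -/
theorem hasExp_div_discriminant {p : PowerSeries ℂ} {f : ℍ → ℂ} {m : ℕ}
    (h : HasExp (PowerSeries.X ^ (2 * m) * p) f) :
    ∃ t, HasExp t (f / ModularForm.discriminant ^ m) ∧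
      PowerSeries.constantCoeff t = PowerSeries.constantCoeff p := by
  obtain ⟨u, -, hu, h1⟩ := exists_hasExp_discriminant
  obtain ⟨t, ht, hts⟩ := h.div_nome_pow.div (hu.pow m)
    (fun τ => pow_ne_zero _ (pow_ne_zero _ (etaProd_ne_zero τ)))
    (by rw [map_pow, h1, one_pow]; exact one_ne_zero)
  refine ⟨t, ?_, ?_⟩
  · rwa [show f / nome ^ (2 * m) / (etaProd ^ 24) ^ m = f / ModularForm.discriminant ^ m from
      funext fun τ => by
        simp only [Pi.div_apply, Pi.pow_apply]
        rw [div_div, discriminant_eq, pow_mul, ← mul_pow]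
        congr 2
        ring] at ht
  · rw [← hts, map_mul, map_pow, h1, one_pow, mul_one]

theorem S_smul_div_discriminant {k : ℤ} {f : ℍ → ℂ} (m : ℕ)
    (hS : ∀ τ : ℍ, f (ModularGroup.S • τ) = (τ : ℂ) ^ k * f τ) (τ : ℍ) :
    (f / ModularForm.discriminant ^ m) (ModularGroup.S • τ) =
      (τ : ℂ) ^ (k - 12 * m) * (f / ModularForm.discriminant ^ m) τ := by
  have h0 : (τ : ℂ) ≠ 0 := ne_zero τ
  have h1 := pow_ne_zero m (ModularForm.discriminant_ne_zero τ)
  simp only [Pi.div_apply, Pi.pow_apply]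
  rw [hS, discriminant_S_smul, mul_pow, ← pow_mul, zpow_sub₀ h0,
    show (12 * m : ℤ) = ((12 * m : ℕ) : ℤ) by push_cast; rfl, zpow_natCast, mul_div_mul_comm]

/-- Dividing by the m-th power of the discriminant, which has no zeros in ℍ, cancels the zero of
order m in q and leaves a modular form of negative weight. -/
theorem level_one_eq_zero {k : ℤ} {p : PowerSeries ℂ} {f : ℍ → ℂ} {m : ℕ}
    (h : HasExp (PowerSeries.X ^ (2 * m) * p) f)
    (hT : ∀ τ, f ((1 : ℝ) +ᵥ τ) = f τ)
    (hS : ∀ τ : ℍ, f (ModularGroup.S • τ) = (τ : ℂ) ^ k * f τ) (hk : k < 12 * m) : f = 0 := by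
  obtain ⟨t, ht, -⟩ := hasExp_div_discriminant h
  obtain ⟨F, hF⟩ := exists_modularForm ht
    (fun τ => by simp only [Pi.div_apply, Pi.pow_apply]; rw [hT, discriminant_vadd_one])
    (S_smul_div_discriminant m hS)
  have h0 := ModularFormClass.levelOne_neg_weight_eq_zero (by omega) F
  rw [hF] at h0
  funext τ
  have := congrFun h0 τ
  simp only [Pi.div_apply, Pi.pow_apply, Pi.zero_apply, div_eq_zero_iff] at this
  exact this.resolve_right (pow_ne_zero m (ModularForm.discriminant_ne_zero τ))

/-- The quotient by the discriminant has weight 0, hence is constant, and its value at the cusp is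
read off from the expansion. -/
theorem level_one_weight_twelve {p : PowerSeries ℂ} {f : ℍ → ℂ}
    (h : HasExp (PowerSeries.X ^ 2 * p) f)
    (hT : ∀ τ, f ((1 : ℝ) +ᵥ τ) = f τ)
    (hS : ∀ τ : ℍ, f (ModularGroup.S • τ) = (τ : ℂ) ^ (12 : ℤ) * f τ) (τ : ℍ) :
    f τ = PowerSeries.constantCoeff p * ModularForm.discriminant τ := by
  obtain ⟨t, ht, hc⟩ := hasExp_div_discriminant (m := 1) h
  obtain ⟨F, hF⟩ := exists_modularForm (k := 0) ht
    (fun τ => by simp only [Pi.div_apply, Pi.pow_apply]; rw [hT, discriminant_vadd_one])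
    (S_smul_div_discriminant 1 hS)
  obtain ⟨c, hc'⟩ := ModularFormClass.levelOne_weight_zero_const F
  rw [hF] at hc'
  have h1 : c = PowerSeries.constantCoeff p := by
    have h2 := ht.tendsto
    rw [hc', hc] at h2
    exact tendsto_nhds_unique tendsto_const_nhds h2
  have := congrFun hc' τ
  simp only [Pi.div_apply, pow_one, Function.const_apply] at this
  rw [div_eq_iff (ModularForm.discriminant_ne_zero τ)] at this
  rw [this, h1]

/-- A function of period 1 has only even powers of q^{1/2}, so a zero at the cusp has order at least
2 in q^{1/2}. -/
theorem X_sq_dvd {p : PowerSeries ℂ} {f : ℍ → ℂ} (h : HasExp p f)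
    (hT : ∀ τ, f ((1 : ℝ) +ᵥ τ) = f τ) (h0 : PowerSeries.constantCoeff p = 0) :
    PowerSeries.X ^ 2 ∣ p := by
  rw [PowerSeries.X_pow_dvd_iff]
  intro m hm
  interval_cases m
  · rwa [PowerSeries.coeff_zero_eq_constantCoeff_apply]
  · exact h.coeff_eq_zero_of_even hT odd_one

/-! ### Triples of modular forms of level two -/

/-- A modular form `a` of weight `k` for the congruence subgroup `Γ₀(2)`, together with its images
`b` under `τ ↦ -1/τ` and `c` under `τ ↦ -1/(τ + 1)`. -/
structure Triple (k : ℤ) (a b c : ℍ → ℂ) : Prop where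
  T_fst : ∀ τ, a ((1 : ℝ) +ᵥ τ) = a τ
  T_snd : ∀ τ, b ((1 : ℝ) +ᵥ τ) = c τ
  T_trd : ∀ τ, c ((1 : ℝ) +ᵥ τ) = b τ
  S_fst : ∀ τ : ℍ, a (ModularGroup.S • τ) = (τ : ℂ) ^ k * b τ
  S_snd : ∀ τ : ℍ, b (ModularGroup.S • τ) = (τ : ℂ) ^ k * a τ
  S_trd : ∀ τ : ℍ, c (ModularGroup.S • τ) = (τ : ℂ) ^ k * c τ
  exp_fst : ∃ p, HasExp p a
  exp_snd : ∃ p, HasExp p b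

namespace Triple

variable {k l : ℤ} {a b c a' b' c' : ℍ → ℂ}

theorem exp_trd (h : Triple k a b c) : ∃ p, HasExp p c := by
  obtain ⟨p, hp⟩ := h.exp_snd
  have := hp.vadd_one
  rw [funext h.T_snd] at this
  exact ⟨_, this⟩

theorem add (h : Triple k a b c) (h' : Triple k a' b' c') :
    Triple k (a + a') (b + b') (c + c') where
  T_fst τ := by simp only [Pi.add_apply, h.T_fst, h'.T_fst]
  T_snd τ := by simp only [Pi.add_apply, h.T_snd, h'.T_snd]
  T_trd τ := by simp only [Pi.add_apply, h.T_trd, h'.T_trd]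
  S_fst τ := by simp only [Pi.add_apply, h.S_fst, h'.S_fst, mul_add]
  S_snd τ := by simp only [Pi.add_apply, h.S_snd, h'.S_snd, mul_add]
  S_trd τ := by simp only [Pi.add_apply, h.S_trd, h'.S_trd, mul_add]
  exp_fst := ⟨_, h.exp_fst.choose_spec.add h'.exp_fst.choose_spec⟩
  exp_snd := ⟨_, h.exp_snd.choose_spec.add h'.exp_snd.choose_spec⟩

theorem smul (h : Triple k a b c) (x : ℂ) : Triple k (x • a) (x • b) (x • c) where
  T_fst τ := by simp only [Pi.smul_apply, h.T_fst]
  T_snd τ := by simp only [Pi.smul_apply, h.T_snd]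
  T_trd τ := by simp only [Pi.smul_apply, h.T_trd]
  S_fst τ := by simp only [Pi.smul_apply, h.S_fst, smul_eq_mul]; ring
  S_snd τ := by simp only [Pi.smul_apply, h.S_snd, smul_eq_mul]; ring
  S_trd τ := by simp only [Pi.smul_apply, h.S_trd, smul_eq_mul]; ring
  exp_fst := ⟨_, h.exp_fst.choose_spec.const_mul x⟩
  exp_snd := ⟨_, h.exp_snd.choose_spec.const_mul x⟩

theorem sub (h : Triple k a b c) (h' : Triple k a' b' c') :
    Triple k (a - a') (b - b') (c - c') := by
  have := h.add (h'.smul (-1))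
  simpa [sub_eq_add_neg] using this

theorem mul (h : Triple k a b c) (h' : Triple l a' b' c') :
    Triple (k + l) (a * a') (b * b') (c * c') where
  T_fst τ := by simp only [Pi.mul_apply, h.T_fst, h'.T_fst]
  T_snd τ := by simp only [Pi.mul_apply, h.T_snd, h'.T_snd]
  T_trd τ := by simp only [Pi.mul_apply, h.T_trd, h'.T_trd]
  S_fst τ := by simp only [Pi.mul_apply, h.S_fst, h'.S_fst, zpow_add₀ (ne_zero τ)]; ring
  S_snd τ := by simp only [Pi.mul_apply, h.S_snd, h'.S_snd, zpow_add₀ (ne_zero τ)]; ring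
  S_trd τ := by simp only [Pi.mul_apply, h.S_trd, h'.S_trd, zpow_add₀ (ne_zero τ)]; ring
  exp_fst := ⟨_, h.exp_fst.choose_spec.mul h'.exp_fst.choose_spec⟩
  exp_snd := ⟨_, h.exp_snd.choose_spec.mul h'.exp_snd.choose_spec⟩

theorem one : Triple 0 1 1 1 where
  T_fst τ := rfl
  T_snd τ := rfl
  T_trd τ := rfl
  S_fst τ := by simp
  S_snd τ := by simp
  S_trd τ := by simp
  exp_fst := ⟨_, HasExp.one⟩
  exp_snd := ⟨_, HasExp.one⟩

theorem zero (k : ℤ) : Triple k 0 0 0 where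
  T_fst τ := rfl
  T_snd τ := rfl
  T_trd τ := rfl
  S_fst τ := by simp
  S_snd τ := by simp
  S_trd τ := by simp
  exp_fst := ⟨_, HasExp.zero⟩
  exp_snd := ⟨_, HasExp.zero⟩

theorem pow (h : Triple k a b c) : ∀ n : ℕ, Triple (n * k) (a ^ n) (b ^ n) (c ^ n)
  | 0 => by simpa using one
  | n + 1 => by
    have := (pow h n).mul h
    rw [← pow_succ, ← pow_succ, ← pow_succ] at this
    convert this using 1
    push_cast
    ring

theorem sum {ι : Type*} {S : Finset ι} {a b c : ι → ℍ → ℂ}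
    (h : ∀ i ∈ S, Triple k (a i) (b i) (c i)) :
    Triple k (∑ i ∈ S, a i) (∑ i ∈ S, b i) (∑ i ∈ S, c i) := by
  classical
  induction S using Finset.induction_on with
  | empty => simpa using zero k
  | insert i S hi ih =>
    rw [Finset.sum_insert hi, Finset.sum_insert hi, Finset.sum_insert hi]
    exact (h i (Finset.mem_insert_self i S)).add
      (ih fun j hj => h j (Finset.mem_insert_of_mem hj))

theorem eq_zero_of_fst (h : Triple k a b c) (h0 : a = 0) : b = 0 ∧ c = 0 := by
  have hb : b = 0 := funext fun τ => by
    have := h.S_fst τ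
    rw [h0, Pi.zero_apply, eq_comm, mul_eq_zero] at this
    exact this.resolve_left (zpow_ne_zero _ (ne_zero τ))
  refine ⟨hb, funext fun τ => ?_⟩
  rw [← h.T_snd, hb]
  rfl

/-- The valence bound for the product of the three members of a triple. -/
theorem eq_zero_of_order (h : Triple k a b c) {i j m : ℕ} {p s t : PowerSeries ℂ}
    (hp : HasExp (PowerSeries.X ^ i * p) a) (hs : HasExp (PowerSeries.X ^ j * s) b)
    (ht : HasExp (PowerSeries.X ^ j * t) c) (hm : 2 * m ≤ i + j + j) (hk : 3 * k < 12 * m) :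
    a = 0 := by
  obtain ⟨d, hd⟩ := Nat.exists_eq_add_of_le hm
  have h1 := (hp.mul hs).mul ht
  rw [show PowerSeries.X ^ i * p * (PowerSeries.X ^ j * s) * (PowerSeries.X ^ j * t) =
    PowerSeries.X ^ (i + j + j) * (p * s * t) by ring, hd, pow_add, mul_assoc] at h1
  -- The generators permute the three members, so their product transforms with weight 3k under all
  -- of SL₂(ℤ).
  have h0 := level_one_eq_zero (k := k + k + k) h1
    (fun τ => by simp only [Pi.mul_apply]; rw [h.T_fst, h.T_snd, h.T_trd]; ring)
    (fun τ => by
      simp only [Pi.mul_apply]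
      rw [h.S_fst, h.S_snd, h.S_trd, zpow_add₀ (ne_zero τ), zpow_add₀ (ne_zero τ)]; ring)
    (by omega)
  have hbz : b = 0 → a = 0 := fun hb => funext fun τ => by
    have := h.S_snd τ
    rw [hb, Pi.zero_apply, eq_comm, mul_eq_zero] at this
    exact this.resolve_left (zpow_ne_zero _ (ne_zero τ))
  rcases (hp.mul hs).eq_zero_or_eq_zero ht h0 with h2 | h2
  · rcases hp.eq_zero_or_eq_zero hs h2 with h3 | h3
    · exact h3
    · exact hbz h3
  · exact hbz (funext fun τ => by rw [← h.T_trd, h2]; rfl)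

theorem eq_zero_of_neg (h : Triple k a b c) (hk : k < 0) : a = 0 := by
  obtain ⟨p, hp⟩ := h.exp_fst
  obtain ⟨s, hs⟩ := h.exp_snd
  obtain ⟨t, ht⟩ := h.exp_trd
  exact h.eq_zero_of_order (i := 0) (j := 0) (m := 0) (p := p) (s := s) (t := t)
    (by simpa using hp) (by simpa using hs) (by simpa using ht) (by omega) (by push_cast; omega)

end Triple

/-! ### Rational expansions -/

namespace HasRatExp

variable {p s : PowerSeries ℚ} {f g : ℍ → ℂ}

theorem add (h : HasRatExp p f) (h' : HasRatExp s g) : HasRatExp (p + s) (f + g) := by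
  rw [HasRatExp, map_add]; exact HasExp.add h h'

theorem sub (h : HasRatExp p f) (h' : HasRatExp s g) : HasRatExp (p - s) (f - g) := by
  rw [HasRatExp, map_sub]; exact HasExp.sub h h'

theorem mul (h : HasRatExp p f) (h' : HasRatExp s g) : HasRatExp (p * s) (f * g) := by
  rw [HasRatExp, map_mul]; exact HasExp.mul h h'

theorem pow (h : HasRatExp p f) (n : ℕ) : HasRatExp (p ^ n) (f ^ n) := by
  rw [HasRatExp, map_pow]; exact HasExp.pow h n

theorem const (c : ℚ) : HasRatExp (PowerSeries.C c) (fun _ => (c : ℂ)) := by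
  rw [HasRatExp, PowerSeries.map_C]; exact HasExp.const _

theorem nome : HasRatExp PowerSeries.X nome := by
  rw [HasRatExp, PowerSeries.map_X]; exact HasExp.nome

theorem of_hasSum {ι : Type*} {c : ι → ℚ} {m : ι → ℕ} (hm : ∀ n, (m ⁻¹' {n}).Finite)
    (h : ∀ τ, HasSum (fun i => (c i : ℂ) * HalfK3.nome τ ^ m i) (f τ)) :
    HasRatExp (PowerSeries.mk fun n => ∑ i ∈ (hm n).toFinset, c i) f := by
  have h1 := HasExp.of_hasSum (c := fun i => (c i : ℂ)) h
  rw [HasRatExp]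
  convert h1 using 1
  ext n
  rw [PowerSeries.coeff_map, PowerSeries.coeff_mk, PowerSeries.coeff_mk]
  have := (hm n).fintype
  rw [tsum_fintype, map_sum]
  rw [← Finset.sum_coe_sort]
  refine Fintype.sum_equiv (Equiv.subtypeEquivRight fun i => by simp) _ _ fun i => rfl

theorem map_injective : Function.Injective (PowerSeries.map (algebraMap ℚ ℂ)) :=
  PowerSeries.map_injective _ (algebraMap ℚ ℂ).injective

theorem inv (h : HasRatExp p f) (hf : ∀ τ, f τ ≠ 0) (h0 : PowerSeries.constantCoeff p ≠ 0) :
    HasRatExp p⁻¹ f⁻¹ := by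
  obtain ⟨t, ht, htp⟩ := HasExp.one.div h hf (by
    rwa [← PowerSeries.coeff_zero_eq_constantCoeff_apply, PowerSeries.coeff_map,
      PowerSeries.coeff_zero_eq_constantCoeff_apply, map_ne_zero])
  have h1 : t * PowerSeries.map (algebraMap ℚ ℂ) p =
      PowerSeries.map (algebraMap ℚ ℂ) p⁻¹ * PowerSeries.map (algebraMap ℚ ℂ) p := by
    rw [htp, ← map_mul, PowerSeries.inv_mul_cancel _ h0, map_one]
  have hne : PowerSeries.map (algebraMap ℚ ℂ) p ≠ 0 := by
    rw [Ne, map_eq_zero_iff _ map_injective]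
    rintro rfl
    exact h0 (map_zero _)
  rw [HasRatExp, ← mul_right_cancel₀ hne h1]
  rwa [one_div] at ht

theorem div_nome_pow {k : ℕ} (h : HasRatExp (PowerSeries.X ^ k * p) f) :
    HasRatExp p (f / HalfK3.nome ^ k) := by
  rw [HasRatExp, map_mul, map_pow, PowerSeries.map_X] at h
  exact HasExp.div_nome_pow h

end HasRatExp

theorem exists_hasRatExp_E2 : ∃ p, HasRatExp p EisensteinSeries.E2 ∧
    PowerSeries.constantCoeff p = 1 := by
  have hfin : ∀ n, ((fun m : ℕ => 2 * m) ⁻¹' {n}).Finite := fun n =>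
    Set.Finite.subset (Set.finite_Iic n) fun m hm => by
      simp only [Set.mem_preimage, Set.mem_singleton_iff] at hm
      simp only [Set.mem_Iic]; omega
  refine ⟨_, HasRatExp.of_hasSum (c := fun m : ℕ =>
    if m = 0 then 1 else -24 * (ArithmeticFunction.sigma 1 m : ℚ)) hfin fun τ => ?_, ?_⟩
  · refine (EisensteinSeries.hasSum_qExpansion_E2 (z := τ)).congr_fun fun m => ?_
    rw [pow_mul, smul_eq_mul]
    congr 1
    · split_ifs <;> push_cast <;> rfl
    · congr 1
      rw [nome, ← Complex.exp_nat_mul]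
      congr 1
      push_cast
      ring
  · rw [← PowerSeries.coeff_zero_eq_constantCoeff_apply, PowerSeries.coeff_mk,
      Finset.sum_eq_single 0]
    · simp
    · intro b hb h0
      simp at hb
      exact absurd hb h0
    · simp

/-! ### Theta constants -/

theorem theta3_eq (τ : ℍ) : theta3 τ = thetaChar 0 0 0 τ := by
  rw [← (hasSum_thetaTerm 0 0 0 τ.im_pos).tsum_eq, theta3]
  refine tsum_congr fun n => ?_
  rw [thetaTerm]; congr 1; ring

theorem theta4_eq (τ : ℍ) : theta4 τ = thetaChar 0 1 0 τ := by
  rw [← (hasSum_thetaTerm 0 1 0 τ.im_pos).tsum_eq, theta4]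
  refine tsum_congr fun n => ?_
  rw [thetaTerm, ← Complex.exp_pi_mul_I, ← Complex.exp_int_mul, ← Complex.exp_add]
  congr 1; ring

theorem theta2_eq (τ : ℍ) : theta2 τ = thetaChar 1 0 0 τ := by
  rw [← (hasSum_thetaTerm 1 0 0 τ.im_pos).tsum_eq, theta2]
  refine tsum_congr fun n => ?_
  rw [thetaTerm]; congr 1; ring

theorem neg_I_mul_sqrt_pow_four (τ : ℂ) :
    ((-Complex.I * τ) ^ (1 / 2 : ℂ)) ^ 4 = -τ ^ 2 := by
  rw [← Complex.cpow_nat_mul, show ((4 : ℕ) : ℂ) * (1 / 2) = ((2 : ℕ) : ℂ) by norm_num,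
    Complex.cpow_natCast, mul_pow, neg_sq, Complex.I_sq]
  ring

theorem coe_S_smul (τ : ℍ) : ((ModularGroup.S • τ : ℍ) : ℂ) = -1 / τ := by
  rw [modular_S_smul, coe_mk, neg_div, one_div, inv_neg]

/-- The fourth power turns (-iτ)^{1/2} into -τ² and so removes the branch. -/
theorem thetaChar_S_pow_four {ε δ : ℂ} (h : ε * δ = 0) (τ : ℍ) :
    thetaChar (-δ) ε 0 (ModularGroup.S • τ : ℍ) ^ 4 = -(τ : ℂ) ^ 2 * thetaChar ε δ 0 τ ^ 4 := by
  have h0 : (τ : ℂ) ≠ 0 := ne_zero τ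
  have h1 := thetaChar_functional_equation ε δ 0 h0
  rw [h, zero_div, ← coe_S_smul] at h1
  rw [h1, mul_pow, mul_pow, mul_pow, div_pow, neg_I_mul_sqrt_pow_four]
  simp [h0]

theorem theta3_S (τ : ℍ) : theta3 (ModularGroup.S • τ) ^ 4 = -(τ : ℂ) ^ 2 * theta3 τ ^ 4 := by
  rw [theta3_eq, theta3_eq, ← thetaChar_S_pow_four (by ring), neg_zero]

theorem theta2_S (τ : ℍ) : theta2 (ModularGroup.S • τ) ^ 4 = -(τ : ℂ) ^ 2 * theta4 τ ^ 4 := by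
  rw [theta2_eq, theta4_eq, ← thetaChar_S_pow_four (by ring), thetaChar_neg_one]
  simp

theorem theta4_S (τ : ℍ) : theta4 (ModularGroup.S • τ) ^ 4 = -(τ : ℂ) ^ 2 * theta2 τ ^ 4 := by
  rw [theta2_eq, theta4_eq, ← thetaChar_S_pow_four (by ring), neg_zero]

theorem exp_pi_sq (n : ℤ) : Complex.exp (Real.pi * Complex.I * (n : ℂ) ^ 2) = (-1) ^ n := by
  obtain ⟨k, hk⟩ := Int.even_mul_pred_self n
  rw [← Complex.exp_pi_mul_I, ← Complex.exp_int_mul]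
  have : (n : ℂ) ^ 2 = n + k * 2 := by
    have : (n : ℂ) * (n - 1) = k + k := by exact_mod_cast congrArg (fun x : ℤ => (x : ℂ)) hk
    linear_combination this
  rw [this, show Real.pi * Complex.I * (n + k * 2) =
    n * (Real.pi * Complex.I) + k * (2 * Real.pi * Complex.I) by ring, Complex.exp_add,
    Complex.exp_int_mul_two_pi_mul_I, mul_one]

theorem theta3_vadd_one (τ : ℍ) : theta3 ((1 : ℝ) +ᵥ τ) = theta4 τ := by
  refine tsum_congr fun n => ?_
  rw [coe_vadd, mul_add, Complex.exp_add, Complex.ofReal_one, mul_one, exp_pi_sq]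

theorem theta4_vadd_one (τ : ℍ) : theta4 ((1 : ℝ) +ᵥ τ) = theta3 τ := by
  refine tsum_congr fun n => ?_
  rw [coe_vadd, mul_add, Complex.exp_add, Complex.ofReal_one, mul_one, exp_pi_sq, ← mul_assoc,
    ← mul_zpow, neg_one_mul, neg_neg, one_zpow, one_mul]

/-- The even part of `θ₂`. -/
def theta2Red (τ : ℍ) : ℂ := ∑' n : ℤ, nome τ ^ (n * (n + 1)).toNat

theorem toNat_mul_succ (n : ℤ) : ((n * (n + 1)).toNat : ℤ) = n * (n + 1) := by
  apply Int.toNat_of_nonneg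
  rcases le_or_gt 0 n with h | h
  · positivity
  · exact mul_nonneg_of_nonpos_of_nonpos h.le (by omega)

theorem theta2_term (τ : ℍ) (n : ℤ) :
    Complex.exp (Real.pi * Complex.I * ((n : ℂ) + 1 / 2) ^ 2 * τ) =
      Complex.exp (Real.pi * Complex.I * τ / 4) * nome τ ^ (n * (n + 1)).toNat := by
  rw [nome, ← Complex.exp_nat_mul, ← Complex.exp_add]
  congr 1
  have : (((n * (n + 1)).toNat : ℕ) : ℂ) = n * (n + 1) := by
    exact_mod_cast congrArg (fun x : ℤ => (x : ℂ)) (toNat_mul_succ n)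
  rw [this]
  ring

theorem hasSum_theta2Red (τ : ℍ) :
    HasSum (fun n : ℤ => nome τ ^ (n * (n + 1)).toNat) (theta2Red τ) := by
  have h := hasSum_thetaTerm 1 0 0 τ.im_pos
  have h1 : Summable fun n : ℤ => Complex.exp (Real.pi * Complex.I * τ / 4) *
      nome τ ^ (n * (n + 1)).toNat := h.summable.congr fun n => by
    rw [← theta2_term, thetaTerm]; congr 1; ring
  exact ((summable_mul_left_iff (Complex.exp_ne_zero _)).mp h1).hasSum

theorem gFourSqrt_eq (τ : ℍ) : gFourSqrt τ = nome τ * theta2Red τ ^ 4 := by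
  have : theta2 τ = Complex.exp (Real.pi * Complex.I * τ / 4) * theta2Red τ := by
    rw [theta2, theta2Red, ← tsum_mul_left]
    exact tsum_congr (theta2_term τ)
  rw [gFourSqrt, this, mul_pow, nome, ← Complex.exp_nat_mul]
  congr 2
  push_cast
  ring

theorem finite_natAbs_sq (n : ℕ) : ((fun m : ℤ => m.natAbs ^ 2) ⁻¹' {n}).Finite :=
  Set.Finite.subset (Set.finite_Icc (-n : ℤ) n) fun m hm => by
    simp only [Set.mem_preimage, Set.mem_singleton_iff] at hm
    have : m.natAbs ≤ n := hm ▸ Nat.le_self_pow two_ne_zero _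
    simp only [Set.mem_Icc]; omega

theorem finite_toNat_mul_succ (n : ℕ) : ((fun m : ℤ => (m * (m + 1)).toNat) ⁻¹' {n}).Finite :=
  Set.Finite.subset (Set.finite_Icc (-(n + 1) : ℤ) (n + 1)) fun m hm => by
    simp only [Set.mem_preimage, Set.mem_singleton_iff] at hm
    have h := toNat_mul_succ m
    rw [hm] at h
    simp only [Set.mem_Icc]
    constructor <;> nlinarith

theorem theta3_term (τ : ℍ) (n : ℤ) :
    Complex.exp (Real.pi * Complex.I * (n : ℂ) ^ 2 * τ) = nome τ ^ (n.natAbs ^ 2) := by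
  rw [nome, ← Complex.exp_nat_mul]
  congr 1
  have : ((n.natAbs ^ 2 : ℕ) : ℂ) = (n : ℂ) ^ 2 := by
    have := congrArg (fun x : ℤ => (x : ℂ)) (Int.natAbs_sq n)
    rw [Nat.cast_pow, ← Int.cast_natCast]
    push_cast at this ⊢
    exact this
  rw [this]
  ring

theorem exists_hasRatExp_theta3 : ∃ p, HasRatExp p theta3 ∧ PowerSeries.constantCoeff p = 1 := by
  refine ⟨_, HasRatExp.of_hasSum (c := fun _ : ℤ => 1) finite_natAbs_sq fun τ => ?_, ?_⟩
  · have h := hasSum_thetaTerm 0 0 0 τ.im_pos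
    rw [← theta3_eq] at h
    refine h.congr_fun fun n => ?_
    rw [← theta3_term, thetaTerm, Rat.cast_one, one_mul]
    congr 1; ring
  · rw [← PowerSeries.coeff_zero_eq_constantCoeff_apply, PowerSeries.coeff_mk,
      Finset.sum_eq_single 0]
    · intro b hb h0
      simp at hb
      exact absurd hb h0
    · simp

theorem exists_hasRatExp_theta4 : ∃ p, HasRatExp p theta4 ∧ PowerSeries.constantCoeff p = 1 := by
  refine ⟨_, HasRatExp.of_hasSum (c := fun n : ℤ => (-1) ^ n) finite_natAbs_sq fun τ => ?_, ?_⟩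
  · have h := hasSum_thetaTerm 0 1 0 τ.im_pos
    rw [← theta4_eq] at h
    refine h.congr_fun fun n => ?_
    rw [← theta3_term, thetaTerm]
    push_cast
    rw [← Complex.exp_pi_mul_I, ← Complex.exp_int_mul, ← Complex.exp_add]
    congr 1; ring
  · rw [← PowerSeries.coeff_zero_eq_constantCoeff_apply, PowerSeries.coeff_mk,
      Finset.sum_eq_single 0]
    · simp
    · intro b hb h0
      simp at hb
      exact absurd hb h0
    · simp

theorem exists_hasRatExp_theta2Red :
    ∃ p, HasRatExp p theta2Red ∧ PowerSeries.constantCoeff p = 2 := by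
  refine ⟨_, HasRatExp.of_hasSum (c := fun _ : ℤ => 1) finite_toNat_mul_succ fun τ => ?_, ?_⟩
  · refine (hasSum_theta2Red τ).congr_fun fun n => ?_
    rw [Rat.cast_one, one_mul]
  · rw [← PowerSeries.coeff_zero_eq_constantCoeff_apply, PowerSeries.coeff_mk,
      show (finite_toNat_mul_succ 0).toFinset = {0, -1} from ?_]
    · rw [Finset.sum_pair (by norm_num)]; norm_num
    · ext b
      have h := toNat_mul_succ b
      simp only [Set.Finite.mem_toFinset, Set.mem_preimage, Set.mem_singleton_iff,
        Finset.mem_insert, Finset.mem_singleton]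
      constructor
      · intro h0
        rw [h0, Nat.cast_zero, eq_comm, mul_eq_zero] at h
        omega
      · rintro (rfl | rfl) <;> rfl

theorem exists_hasRatExp_gFourSqrt : ∃ p, HasRatExp (PowerSeries.X * p) gFourSqrt ∧
    PowerSeries.constantCoeff p = 16 := by
  obtain ⟨p, hp, h0⟩ := exists_hasRatExp_theta2Red
  refine ⟨p ^ 4, ?_, by rw [map_pow, h0]; norm_num⟩
  have := HasRatExp.nome.mul (hp.pow 4)
  rwa [show nome * theta2Red ^ 4 = gFourSqrt from funext fun τ => (gFourSqrt_eq τ).symm] at this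

/-- The exponents n(n + 1) are even, so the sign under translation comes from the prefactor q^{1/2}
alone. -/
theorem gFourSqrt_vadd_one (τ : ℍ) : gFourSqrt ((1 : ℝ) +ᵥ τ) = -gFourSqrt τ := by
  obtain ⟨p, hp, -⟩ := exists_hasRatExp_theta2Red
  have h1 : theta2Red ((1 : ℝ) +ᵥ τ) = theta2Red τ := by
    refine tsum_congr fun n => ?_
    have : Even (n * (n + 1)).toNat := by
      have := Int.even_mul_succ_self n
      rw [← toNat_mul_succ] at this
      exact_mod_cast this
    rw [nome_add_one, this.neg_pow]
  rw [gFourSqrt_eq, gFourSqrt_eq, nome_add_one, h1, neg_mul]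

theorem gFour_eq (τ : ℍ) : gFour τ = gFourSqrt τ ^ 2 := by
  rw [gFour, gFourSqrt, ← pow_mul]

theorem gFourSqrt_S (τ : ℍ) :
    gFourSqrt (ModularGroup.S • τ) = -(τ : ℂ) ^ 2 * theta4 τ ^ 4 := theta2_S τ

/-- The identity of Jacobi. -/
theorem theta_jacobi (τ : ℍ) : theta3 τ ^ 4 = gFourSqrt τ + theta4 τ ^ 4 := by
  obtain ⟨p2, h2, c2⟩ := exists_hasRatExp_gFourSqrt
  obtain ⟨p3, h3, c3⟩ := exists_hasRatExp_theta3
  obtain ⟨p4, h4, c4⟩ := exists_hasRatExp_theta4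
  -- The difference of the two sides changes sign under translation and under inversion (up to τ²).
  -- Its square is therefore of level one and weight 4, vanishes at the cusp, and so is zero.
  have hD := (((h3.pow 4).sub h2).sub (h4.pow 4)).pow 2
  have hT : ∀ τ : ℍ, ((theta3 ^ 4 - gFourSqrt - theta4 ^ 4) ^ 2) ((1 : ℝ) +ᵥ τ) =
      ((theta3 ^ 4 - gFourSqrt - theta4 ^ 4) ^ 2) τ := fun τ => by
    simp only [Pi.pow_apply, Pi.sub_apply]
    rw [theta3_vadd_one, theta4_vadd_one, gFourSqrt_vadd_one]; ring
  obtain ⟨s, hs⟩ := X_sq_dvd hD hT (by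
    rw [← PowerSeries.coeff_zero_eq_constantCoeff_apply, PowerSeries.coeff_map,
      PowerSeries.coeff_zero_eq_constantCoeff_apply]
    simp [c3, c4])
  have h0 := level_one_eq_zero (m := 1) (k := 4) (p := s) (by rw [← hs]; exact hD) hT
    (fun τ => by
      simp only [Pi.pow_apply, Pi.sub_apply]
      rw [theta3_S, theta4_S, gFourSqrt_S, gFourSqrt, zpow_ofNat]; ring) (by norm_num)
  have := congrFun h0 τ
  simp only [Pi.pow_apply, Pi.sub_apply, Pi.zero_apply, sq_eq_zero_iff] at this
  linear_combination this

theorem theta3_pow_four (τ : ℍ) : theta3 τ ^ 4 = (gTwo τ + gFourSqrt τ) / 2 := by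
  rw [gTwo]; linear_combination (1 / 2 : ℂ) * theta_jacobi τ

theorem theta4_pow_four (τ : ℍ) : theta4 τ ^ 4 = (gTwo τ - gFourSqrt τ) / 2 := by
  rw [gTwo]; linear_combination (-1 / 2 : ℂ) * theta_jacobi τ

theorem gTwo_vadd_one (τ : ℍ) : gTwo ((1 : ℝ) +ᵥ τ) = gTwo τ := by
  rw [gTwo, gTwo, theta3_vadd_one, theta4_vadd_one, add_comm]

theorem gTwo_S (τ : ℍ) : gTwo (ModularGroup.S • τ) =
    (τ : ℂ) ^ 2 * (-(gTwo τ + 3 * gFourSqrt τ) / 2) := by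
  rw [gTwo, theta3_S, theta4_S, ← gFourSqrt, theta3_pow_four]; ring

theorem gFourSqrt_S_smul (τ : ℍ) : gFourSqrt (ModularGroup.S • τ) =
    (τ : ℂ) ^ 2 * (-(gTwo τ - gFourSqrt τ) / 2) := by
  rw [gFourSqrt_S, theta4_pow_four]; ring

theorem exists_hasRatExp_gTwo : ∃ p, HasRatExp p gTwo ∧ PowerSeries.constantCoeff p = 2 := by
  obtain ⟨p3, h3, c3⟩ := exists_hasRatExp_theta3
  obtain ⟨p4, h4, c4⟩ := exists_hasRatExp_theta4
  exact ⟨_, (h3.pow 4).add (h4.pow 4), by simp [c3, c4]; norm_num⟩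

/-- The eighth power of θ₂θ₃θ₄ is of level one and weight 12, with leading coefficient 16² = 256.
Consequently θ₂ and θ₄ have no zeros in ℍ, which permits division by G₄ and its conjugates. -/
theorem theta_product (τ : ℍ) : (gFourSqrt τ * theta3 τ ^ 4 * theta4 τ ^ 4) ^ 2 =
    256 * ModularForm.discriminant τ := by
  obtain ⟨p2, h2, c2⟩ := exists_hasRatExp_gFourSqrt
  obtain ⟨p3, h3, c3⟩ := exists_hasRatExp_theta3
  obtain ⟨p4, h4, c4⟩ := exists_hasRatExp_theta4
  have h := ((h2.mul (h3.pow 4)).mul (h4.pow 4)).pow 2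
  rw [show (PowerSeries.X * p2 * p3 ^ 4 * p4 ^ 4) ^ 2 =
    PowerSeries.X ^ 2 * (p2 * p3 ^ 4 * p4 ^ 4) ^ 2 by ring, HasRatExp, map_mul, map_pow,
    PowerSeries.map_X] at h
  have h1 := level_one_weight_twelve h (fun τ => by
      simp only [Pi.pow_apply, Pi.mul_apply]
      rw [theta3_vadd_one, theta4_vadd_one, gFourSqrt_vadd_one]; ring)
    (fun τ => by
      simp only [Pi.pow_apply, Pi.mul_apply]
      rw [theta3_S, theta4_S, gFourSqrt_S, gFourSqrt, zpow_ofNat]; ring) τ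
  rw [← PowerSeries.coeff_zero_eq_constantCoeff_apply, PowerSeries.coeff_map,
      PowerSeries.coeff_zero_eq_constantCoeff_apply] at h1
  refine h1.trans ?_
  simp [c2, c3, c4]
  norm_num

theorem gFourSqrt_ne_zero (τ : ℍ) : gFourSqrt τ ≠ 0 := by
  intro h
  have := theta_product τ
  rw [h] at this
  exact ModularForm.discriminant_ne_zero τ (by linear_combination (-1 / 256 : ℂ) * this)

theorem gFour_ne_zero (τ : ℍ) : gFour τ ≠ 0 := by
  rw [gFour_eq]; exact pow_ne_zero 2 (gFourSqrt_ne_zero τ)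

theorem theta4_ne_zero (τ : ℍ) : theta4 τ ≠ 0 := by
  intro h
  have := theta_product τ
  rw [h] at this
  exact ModularForm.discriminant_ne_zero τ (by linear_combination (-1 / 256 : ℂ) * this)

theorem triple_gTwo : Triple 2 gTwo (fun τ => -(gTwo τ + 3 * gFourSqrt τ) / 2)
    (fun τ => -(gTwo τ - 3 * gFourSqrt τ) / 2) where
  T_fst := gTwo_vadd_one
  T_snd τ := by simp only [gTwo_vadd_one, gFourSqrt_vadd_one]; ring
  T_trd τ := by simp only [gTwo_vadd_one, gFourSqrt_vadd_one]; ring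
  S_fst τ := by rw [gTwo_S, zpow_ofNat]
  S_snd τ := by rw [gTwo_S, gFourSqrt_S_smul, zpow_ofNat]; ring
  S_trd τ := by rw [gTwo_S, gFourSqrt_S_smul, zpow_ofNat]; ring
  exp_fst := ⟨_, exists_hasRatExp_gTwo.choose_spec.1⟩
  exp_snd := by
    obtain ⟨p, hp, -⟩ := exists_hasRatExp_gTwo
    obtain ⟨s, hs, -⟩ := exists_hasRatExp_gFourSqrt
    have := (HasExp.add hp (HasExp.const_mul 3 hs)).const_mul (-1 / 2)
    have h : ((-1 / 2 : ℂ) • (gTwo + (3 : ℂ) • gFourSqrt)) =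
        fun τ => -(gTwo τ + 3 * gFourSqrt τ) / 2 := funext fun τ => by
      simp only [Pi.smul_apply, Pi.add_apply, smul_eq_mul]
      ring
    exact ⟨_, h ▸ this⟩

theorem triple_gFour : Triple 4 gFour (fun τ => ((gTwo τ - gFourSqrt τ) / 2) ^ 2)
    (fun τ => ((gTwo τ + gFourSqrt τ) / 2) ^ 2) where
  T_fst τ := by rw [gFour_eq, gFour_eq, gFourSqrt_vadd_one, neg_sq]
  T_snd τ := by simp only [gTwo_vadd_one, gFourSqrt_vadd_one]; ring
  T_trd τ := by simp only [gTwo_vadd_one, gFourSqrt_vadd_one]; ring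
  S_fst τ := by rw [gFour_eq, gFourSqrt_S_smul, zpow_ofNat]; ring
  S_snd τ := by rw [gTwo_S, gFourSqrt_S_smul, zpow_ofNat, gFour_eq]; ring
  S_trd τ := by rw [gTwo_S, gFourSqrt_S_smul, zpow_ofNat]; ring
  exp_fst := by
    obtain ⟨s, hs, -⟩ := exists_hasRatExp_gFourSqrt
    have h : gFourSqrt ^ 2 = gFour := funext fun τ => (gFour_eq τ).symm
    exact ⟨_, h ▸ HasExp.pow hs 2⟩
  exp_snd := by
    obtain ⟨p, hp, -⟩ := exists_hasRatExp_gTwo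
    obtain ⟨s, hs, -⟩ := exists_hasRatExp_gFourSqrt
    have := ((HasExp.sub hp hs).const_mul (1 / 2)).pow 2
    have h : ((1 / 2 : ℂ) • (gTwo - gFourSqrt)) ^ 2 =
        fun τ => ((gTwo τ - gFourSqrt τ) / 2) ^ 2 := funext fun τ => by
      simp only [Pi.smul_apply, Pi.sub_apply, Pi.pow_apply, smul_eq_mul]
      ring
    exact ⟨_, h ▸ this⟩

theorem exists_hasRatExp_gFour : ∃ p, HasRatExp (PowerSeries.X ^ 2 * p) gFour ∧
    PowerSeries.constantCoeff p = 256 := by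
  obtain ⟨s, hs, c⟩ := exists_hasRatExp_gFourSqrt
  refine ⟨s ^ 2, ?_, by rw [map_pow, c]; norm_num⟩
  have := hs.pow 2
  rwa [mul_pow, show gFourSqrt ^ 2 = gFour from funext fun τ => (gFour_eq τ).symm] at this

/-! ### The structure of triples -/

/-- The image of `G₂` under `τ ↦ -1/τ`. -/
def gTwoS (τ : ℍ) : ℂ := -(gTwo τ + 3 * gFourSqrt τ) / 2

/-- The image of `G₂` under `τ ↦ -1/(τ + 1)`. -/
def gTwoT (τ : ℍ) : ℂ := -(gTwo τ - 3 * gFourSqrt τ) / 2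

/-- The image of `G₄` under `τ ↦ -1/τ`. -/
def gFourS (τ : ℍ) : ℂ := ((gTwo τ - gFourSqrt τ) / 2) ^ 2

/-- The image of `G₄` under `τ ↦ -1/(τ + 1)`. -/
def gFourT (τ : ℍ) : ℂ := ((gTwo τ + gFourSqrt τ) / 2) ^ 2

theorem triple_monomial {n j : ℕ} (hj : 2 * j ≤ n) :
    Triple (2 * n) (gTwo ^ (n - 2 * j) * gFour ^ j) (gTwoS ^ (n - 2 * j) * gFourS ^ j)
      (gTwoT ^ (n - 2 * j) * gFourT ^ j) := by
  have := (triple_gTwo.pow (n - 2 * j)).mul (triple_gFour.pow j)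
  rwa [show (((n - 2 * j : ℕ) : ℤ) * 2 + j * 4) = 2 * n by omega] at this

theorem constantCoeff_map {p : PowerSeries ℚ} :
    PowerSeries.constantCoeff (p.map (algebraMap ℚ ℂ)) = (PowerSeries.constantCoeff p : ℚ) := by
  rw [← PowerSeries.coeff_zero_eq_constantCoeff_apply, PowerSeries.coeff_map,
    PowerSeries.coeff_zero_eq_constantCoeff_apply]
  rfl

theorem exists_hasExp_gFourS : ∃ p, HasExp p gFourS ∧ PowerSeries.constantCoeff p = 1 := by
  obtain ⟨p, hp, h1⟩ := exists_hasRatExp_gTwo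
  obtain ⟨s, hs, -⟩ := exists_hasRatExp_gFourSqrt
  have := ((HasExp.sub hp hs).const_mul (1 / 2)).pow 2
  have h : ((1 / 2 : ℂ) • (gTwo - gFourSqrt)) ^ 2 = gFourS := funext fun τ => by
    simp only [gFourS, Pi.smul_apply, Pi.sub_apply, Pi.pow_apply, smul_eq_mul]
    ring
  refine ⟨_, h ▸ this, ?_⟩
  rw [map_pow, PowerSeries.smul_eq_C_mul, map_mul, map_sub, constantCoeff_map, h1]
  simp

theorem gFourS_ne_zero (τ : ℍ) : gFourS τ ≠ 0 := by
  rw [gFourS, ← theta4_pow_four]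
  exact pow_ne_zero _ (pow_ne_zero _ (theta4_ne_zero τ))

/-- G₄ has no zeros in ℍ and vanishes to order exactly 2 in q^{1/2} at i∞, while its conjugate has
constant term 1. Dividing a form that vanishes at i∞ therefore stays holomorphic at both cusps. -/
theorem Triple.div_gFour {k : ℤ} {a b c : ℍ → ℂ} {p : PowerSeries ℂ} (h : Triple k a b c)
    (hp : HasExp p a) (h0 : PowerSeries.constantCoeff p = 0) :
    Triple (k - 4) (a / gFour) (b / gFourS) (c / gFourT) where
  T_fst τ := by simp only [Pi.div_apply, h.T_fst, triple_gFour.T_fst]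
  T_snd τ := congrArg₂ (· / ·) (h.T_snd τ) (triple_gFour.T_snd τ)
  T_trd τ := congrArg₂ (· / ·) (h.T_trd τ) (triple_gFour.T_trd τ)
  S_fst τ := by
    have h1 := triple_gFour.S_fst τ
    rw [Pi.div_apply, h.S_fst, h1, zpow_sub₀ (ne_zero τ), mul_div_mul_comm]
    rfl
  S_snd τ := by
    have h1 : gFourS (ModularGroup.S • τ) = _ := triple_gFour.S_snd τ
    rw [Pi.div_apply, h.S_snd, h1, zpow_sub₀ (ne_zero τ), mul_div_mul_comm]
    rfl
  S_trd τ := by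
    have h1 : gFourT (ModularGroup.S • τ) = _ := triple_gFour.S_trd τ
    rw [Pi.div_apply, h.S_trd, h1, zpow_sub₀ (ne_zero τ), mul_div_mul_comm]
    rfl
  exp_fst := by
    obtain ⟨s, rfl⟩ := X_sq_dvd hp h.T_fst h0
    obtain ⟨q, hq, hc⟩ := exists_hasRatExp_gFour
    have hq' := hq.div_nome_pow
    obtain ⟨t, ht, -⟩ := hp.div_nome_pow.div hq'
      (fun τ => div_ne_zero (gFour_ne_zero τ) (pow_ne_zero _ (nome_ne_zero τ)))
      (by rw [constantCoeff_map, hc]; norm_num)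
    refine ⟨t, ?_⟩
    rwa [show a / nome ^ 2 / (gFour / nome ^ 2) = a / gFour from funext fun τ =>
      div_div_div_cancel_right₀ (pow_ne_zero 2 (nome_ne_zero τ)) _ _] at ht
  exp_snd := by
    obtain ⟨s, hs⟩ := h.exp_snd
    obtain ⟨q, hq, hc⟩ := exists_hasExp_gFourS
    obtain ⟨t, ht, -⟩ := hs.div hq gFourS_ne_zero (by rw [hc]; exact one_ne_zero)
    exact ⟨t, ht⟩

/-- Induction on the weight: remove the constant term with a power of G₂, then divide by G₄ to lower
the weight by 4. -/
theorem Triple.exists_sum_monomial (n : ℕ) : ∀ {a b c : ℍ → ℂ}, Triple (2 * n) a b c →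
    ∃ x : ℕ → ℂ, a = ∑ j ∈ Finset.range (n / 2 + 1), x j • (gTwo ^ (n - 2 * j) * gFour ^ j) := by
  induction n using Nat.strong_induction_on with
  | _ n ih =>
  intro a b c h
  obtain ⟨p, hp⟩ := h.exp_fst
  obtain ⟨q, hq, hc⟩ := exists_hasRatExp_gTwo
  -- The constant term of G₂ is 2, hence the division by 2ⁿ.
  set y := PowerSeries.constantCoeff p / 2 ^ n
  have h1 := h.sub ((triple_monomial (n := n) (j := 0) (Nat.zero_le n)).smul y)
  have hp1 := hp.sub ((HasExp.pow hq n).const_mul y)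
  rw [show gTwo ^ n = gTwo ^ (n - 2 * 0) * gFour ^ 0 by simp] at hp1
  have h2 := h1.div_gFour hp1 (by
    rw [map_sub, PowerSeries.smul_eq_C_mul, map_mul, map_pow, constantCoeff_map, hc]
    simp [y])
  set a1 := a - y • (gTwo ^ (n - 2 * 0) * gFour ^ 0) with ha1
  have ha : a = y • (gTwo ^ (n - 2 * 0) * gFour ^ 0) + gFour * (a1 / gFour) := by
    rw [show gFour * (a1 / gFour) = a1 from funext fun τ => mul_div_cancel₀ _ (gFour_ne_zero τ),
      ha1, add_sub_cancel]
  rcases lt_or_ge n 2 with hn | hn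
  -- For n < 2 the quotient by G₄ has negative weight and vanishes, so the power of G₂ is
  -- everything.
  · have h3 := h2.eq_zero_of_neg (by omega)
    refine ⟨fun _ => y, ?_⟩
    have h4 : gFour * (0 : ℍ → ℂ) = 0 := mul_zero _
    rw [Nat.div_eq_of_lt hn, Finset.sum_range_one, ha, h3, h4]
    exact add_zero _
  · rw [show (2 * n - 4 : ℤ) = 2 * ((n - 2 : ℕ) : ℤ) by omega] at h2
    obtain ⟨x, hx⟩ := ih (n - 2) (by omega) h2
    refine ⟨fun j => Nat.casesOn j y x, ?_⟩
    rw [ha, hx, show n / 2 + 1 = ((n - 2) / 2 + 1) + 1 by omega,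
      Finset.sum_range_succ' _ ((n - 2) / 2 + 1), add_comm, Finset.mul_sum]
    congr 1
    refine Finset.sum_congr rfl fun j hj => ?_
    rw [Finset.mem_range] at hj
    rw [show n - 2 * (j + 1) = n - 2 - 2 * j by omega, mul_smul_comm, pow_succ]
    congr 1
    ring

/-- Applied to the coefficients of a linear relation between rational expansions, such a projection
yields a relation with rational coefficients. No independence of the monomials is needed. -/
theorem exists_rational_projection : ∃ φ : ℂ →ₗ[ℚ] ℚ, ∀ r : ℚ, φ (r : ℂ) = r := by
  obtain ⟨φ, hφ⟩ := LinearMap.exists_leftInverse_of_injective (Algebra.linearMap ℚ ℂ)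
    (LinearMap.ker_eq_bot.mpr (algebraMap ℚ ℂ).injective)
  exact ⟨φ, fun r => LinearMap.congr_fun hφ r⟩

theorem Triple.exists_rat_sum_monomial {n : ℕ} {a b c : ℍ → ℂ} {p : PowerSeries ℚ}
    (h : Triple (2 * n) a b c) (hp : HasRatExp p a) :
    ∃ x : ℕ → ℚ,
      a = ∑ j ∈ Finset.range (n / 2 + 1), (x j : ℂ) • (gTwo ^ (n - 2 * j) * gFour ^ j) ∧
      b = ∑ j ∈ Finset.range (n / 2 + 1), (x j : ℂ) • (gTwoS ^ (n - 2 * j) * gFourS ^ j) ∧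
      c = ∑ j ∈ Finset.range (n / 2 + 1), (x j : ℂ) • (gTwoT ^ (n - 2 * j) * gFourT ^ j) := by
  obtain ⟨x, hx⟩ := h.exists_sum_monomial n
  obtain ⟨φ, hφ⟩ := exists_rational_projection
  obtain ⟨q, hq, -⟩ := exists_hasRatExp_gTwo
  obtain ⟨s, hs, -⟩ := exists_hasRatExp_gFour
  have hm : ∀ j, HasRatExp (q ^ (n - 2 * j) * (PowerSeries.X ^ 2 * s) ^ j)
      (gTwo ^ (n - 2 * j) * gFour ^ j) := fun j => (hq.pow _).mul (hs.pow j)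
  have h1 := HasExp.sum (S := Finset.range (n / 2 + 1)) fun j _ => (hm j).const_mul (x j)
  rw [← hx] at h1
  have h2 := hp.unique h1
  -- The expansions of a and of the monomials are rational, so φ can be applied coefficient by
  -- coefficient and acts only on the scalars x j.
  have h3 : PowerSeries.map (algebraMap ℚ ℂ) p = ∑ j ∈ Finset.range (n / 2 + 1), (φ (x j) : ℂ) •
      PowerSeries.map (algebraMap ℚ ℂ) (q ^ (n - 2 * j) * (PowerSeries.X ^ 2 * s) ^ j) := by
    ext m
    have h4 := congrArg (fun f => φ (PowerSeries.coeff m f)) h2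
    simp only [PowerSeries.coeff_map, map_sum, PowerSeries.coeff_smul] at h4 ⊢
    have h5 : φ (algebraMap ℚ ℂ (PowerSeries.coeff m p)) = PowerSeries.coeff m p := hφ _
    rw [h5] at h4
    rw [h4]
    rw [map_sum]
    refine Finset.sum_congr rfl fun j _ => ?_
    have h6 : ∀ r : ℚ, x j • algebraMap ℚ ℂ r = r • x j := fun r => by
      rw [Rat.smul_def, smul_eq_mul, mul_comm]; rfl
    rw [h6, map_smul, smul_eq_mul, smul_eq_mul, map_mul, mul_comm]
    rfl
  have h7 := HasExp.sum (S := Finset.range (n / 2 + 1)) fun j _ => (hm j).const_mul (φ (x j) : ℂ)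
  rw [← h3] at h7
  have ha := HasExp.ext_fun hp h7
  have ht := Triple.sum (S := Finset.range (n / 2 + 1)) fun j hj =>
    (triple_monomial (n := n) (j := j) (by rw [Finset.mem_range] at hj; omega)).smul
      (φ (x j) : ℂ)
  rw [← ha] at ht
  have hd := (h.sub ht).eq_zero_of_fst (sub_self a)
  exact ⟨fun j => φ (x j), ha, sub_eq_zero.mp hd.1, sub_eq_zero.mp hd.2⟩

/-! ### Even and odd parts of polynomials in `G₂` and `G₄^{1/2}` -/

/-- `f` is a polynomial `κ xⁿ + t² E(x, t²) + t O(x, t²)` with rational coefficients. -/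
def Decomposes (n : ℕ) (f : ℂ → ℂ → ℂ) : Prop :=
  ∃ (κ : ℚ) (E O : MvPolynomial (Fin 3) ℚ), MvPolynomial.pderiv 0 E = 0 ∧
    MvPolynomial.pderiv 0 O = 0 ∧ ∀ y x t, f x t = κ * x ^ n +
      t ^ 2 * MvPolynomial.aeval ![y, x, t ^ 2] E + t * MvPolynomial.aeval ![y, x, t ^ 2] O

theorem Decomposes.mul {n m : ℕ} {f g : ℂ → ℂ → ℂ} (hf : Decomposes n f) (hg : Decomposes m g) :
    Decomposes (n + m) (fun x t => f x t * g x t) := by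
  obtain ⟨κ, E, O, hE, hO, h⟩ := hf
  obtain ⟨κ', E', O', hE', hO', h'⟩ := hg
  refine ⟨κ * κ', MvPolynomial.C κ * g2 ^ n * E' + MvPolynomial.C κ' * g2 ^ m * E + g4 * E * E'
      + O * O',
    MvPolynomial.C κ * g2 ^ n * O' + MvPolynomial.C κ' * g2 ^ m * O + g4 * (E * O' + O * E'),
    ?_, ?_, fun y x t => ?_⟩
  · simp [hE, hO, hE', hO']
  · simp [hE, hO, hE', hO']
  · simp only [h y, h' y]
    simp [pow_add]
    ring

theorem Decomposes.pow {n : ℕ} {f : ℂ → ℂ → ℂ} (hf : Decomposes n f) :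
    ∀ m, Decomposes (m * n) (fun x t => f x t ^ m)
  | 0 => ⟨1, 0, 0, by simp, by simp, by simp⟩
  | m + 1 => by
    have := (hf.pow m).mul hf
    rw [Nat.succ_mul]
    simpa only [pow_succ] using this

theorem Decomposes.sum {ι : Type*} {S : Finset ι} {n : ℕ} {f : ι → ℂ → ℂ → ℂ} (x : ι → ℚ)
    (h : ∀ i ∈ S, Decomposes n (f i)) : Decomposes n (fun u v => ∑ i ∈ S, x i * f i u v) := by
  classical
  induction S using Finset.induction_on with
  | empty => exact ⟨0, 0, 0, by simp, by simp, by simp⟩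
  | insert i S hi ih =>
    obtain ⟨κ, E, O, hE, hO, h1⟩ := h i (Finset.mem_insert_self i S)
    obtain ⟨κ', E', O', hE', hO', h2⟩ := ih fun j hj => h j (Finset.mem_insert_of_mem hj)
    refine ⟨x i * κ + κ', MvPolynomial.C (x i) * E + E', MvPolynomial.C (x i) * O + O',
      by simp [hE, hE'], by simp [hO, hO'], fun y u v => ?_⟩
    simp only [Finset.sum_insert hi]
    have h3 := h2 y u v
    simp only at h3
    rw [h1 y, h3]
    simp
    ring

theorem decomposes_monomial {n j : ℕ} (hj : 2 * j ≤ n) :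
    Decomposes n (fun x t => (-(x + 3 * t) / 2) ^ (n - 2 * j) * (((x - t) / 2) ^ 2) ^ j) := by
  have h1 : Decomposes 1 (fun x t => -(x + 3 * t) / 2) :=
    ⟨-1 / 2, 0, MvPolynomial.C (-3 / 2), by simp, by simp, fun y x t => by simp; ring⟩
  have h2 : Decomposes 1 (fun x t => (x - t) / 2) :=
    ⟨1 / 2, 0, MvPolynomial.C (-1 / 2), by simp, by simp, fun y x t => by simp; ring⟩
  have := (h1.pow (n - 2 * j)).mul ((h2.pow 2).pow j)
  rwa [show (n - 2 * j) * 1 + j * (2 * 1) = n by omega] at this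

/-- The conjugates b and c are the values of one polynomial at (G₂, G₄^{1/2}) and (G₂, -G₄^{1/2}).
Splitting it into even and odd parts in the second variable gives the common and the opposite terms.
The even term free of G₄ is kept apart as κ G₂ⁿ. -/
theorem Triple.exists_polynomials {n : ℕ} {a b c : ℍ → ℂ} {p : PowerSeries ℚ}
    (h : Triple (2 * n) a b c) (hp : HasRatExp p a) :
    ∃ (κ : ℚ) (A E O : MvPolynomial (Fin 3) ℚ), MvPolynomial.pderiv 0 A = 0 ∧
      MvPolynomial.pderiv 0 E = 0 ∧ MvPolynomial.pderiv 0 O = 0 ∧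
      (∀ τ, a τ = evalAt A τ) ∧
      (∀ τ, b τ = κ * gTwo τ ^ n + gFour τ * evalAt E τ + gFourSqrt τ * evalAt O τ) ∧
      (∀ τ, c τ = κ * gTwo τ ^ n + gFour τ * evalAt E τ - gFourSqrt τ * evalAt O τ) := by
  obtain ⟨x, ha, hb, hc⟩ := h.exists_rat_sum_monomial hp
  obtain ⟨κ, E, O, hE, hO, hf⟩ := Decomposes.sum x (S := Finset.range (n / 2 + 1)) (n := n)
    (f := fun j x t => (-(x + 3 * t) / 2) ^ (n - 2 * j) * (((x - t) / 2) ^ 2) ^ j)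
    fun j hj => decomposes_monomial (by rw [Finset.mem_range] at hj; omega)
  refine ⟨κ, ∑ j ∈ Finset.range (n / 2 + 1), MvPolynomial.C (x j) * (g2 ^ (n - 2 * j) * g4 ^ j),
    E, O, ?_, hE, hO, fun τ => ?_, fun τ => ?_, fun τ => ?_⟩
  · simp
  · rw [ha, evalAt]
    simp
  · have := hf (EisensteinSeries.E2 τ) (gTwo τ) (gFourSqrt τ)
    rw [hb, evalAt, evalAt, gFour_eq, ← this]
    simp [gTwoS, gFourS]
  -- The translation τ ↦ τ + 1 exchanges b and c and changes the sign of G₄^{1/2}.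
  · have := hf (EisensteinSeries.E2 τ) (gTwo τ) (-gFourSqrt τ)
    rw [neg_sq] at this
    rw [hc, evalAt, evalAt, gFour_eq, sub_eq_add_neg, ← neg_mul, ← this]
    simp [gTwoT, gFourT, sub_eq_add_neg]

/-! ### The level two theta functions of `E₈` -/

/-- The cases s = 1, 2, 4 cover Θ at τ/2, τ and 2τ. The constant term is 1 because only the zero
vector has norm 0. -/
theorem exists_hasExp_thetaE8 {s : ℕ} (hs : s ≠ 0) :
    ∃ p, HasExp p (fun τ => thetaE8 (s * τ / 2) 0) ∧ PowerSeries.constantCoeff p = 1 := by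
  have him : ∀ τ : ℍ, 0 < (s * (τ : ℂ) / 2).im := fun τ => by
    rw [mul_div_assoc, ← nsmul_eq_mul, Complex.smul_im]
    exact nsmul_pos (half_im_pos τ) hs
  refine ⟨_, HasExp.of_hasSum (c := fun _ : E8 => 1) (m := fun x => s * (qE x).toNat)
    fun τ => ?_, ?_⟩
  · refine (hasSum_thetaE8Term (him τ) 0).congr_fun fun x => ?_
    rw [thetaE8Term, ell_zero_right, one_mul, nome, ← Complex.exp_nat_mul]
    congr 1
    have : (((qE x).toNat : ℕ) : ℂ) = qE x := by
      exact_mod_cast congrArg (fun x : ℤ => (x : ℂ)) (Int.toNat_of_nonneg (qE_nonneg x))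
    push_cast
    rw [this]
    ring
  · rw [← PowerSeries.coeff_zero_eq_constantCoeff_apply, PowerSeries.coeff_mk,
      tsum_eq_single ⟨0, by simp [qE_zero]⟩]
    rintro ⟨x, hx⟩ hne
    simp only [Set.mem_preimage, Set.mem_singleton_iff, mul_eq_zero, hs, false_or,
      Int.toNat_eq_zero] at hx
    exact absurd (Subtype.ext (eq_zero_of_qE (le_antisymm hx (qE_nonneg x)))) hne

/-- Both functions have level one, weight 4 and constant term 1, so their difference vanishes at the
cusp and is zero. -/
theorem thetaE8_eq_E₄ (τ : ℍ) : thetaE8 τ 0 = ModularForm.E₄ τ := by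
  obtain ⟨p, hp, h1⟩ := exists_hasExp_thetaE8 two_ne_zero
  simp only [Nat.cast_ofNat, mul_div_cancel_left₀ _ (two_ne_zero' ℂ)] at hp
  have hT4 : ∀ τ : ℍ, ModularForm.E₄ ((1 : ℝ) +ᵥ τ) = ModularForm.E₄ τ := fun τ =>
    SlashInvariantForm.vAdd_apply_of_mem_strictPeriods ModularForm.E₄ τ one_mem_strictPeriods_SL
  have hS4 : ∀ τ : ℍ, ModularForm.E₄ (ModularGroup.S • τ) =
      (τ : ℂ) ^ (4 : ℤ) * ModularForm.E₄ τ := fun τ => by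
    have h := congrFun (SlashInvariantForm.slash_action_eqn ModularForm.E₄
      (ModularGroup.S : Matrix.GeneralLinearGroup (Fin 2) ℝ) ⟨ModularGroup.S, rfl⟩) τ
    rw [← ModularForm.SL_slash, ModularForm.SL_slash_apply, ModularGroup.denom_S] at h
    rw [← h, mul_left_comm, ← zpow_add₀ (ne_zero τ), add_neg_cancel, zpow_zero, mul_one]
  obtain ⟨s, hs⟩ := HasExp.of_mdiff (f := ModularForm.E₄) ModularForm.E₄.holo'
    (ModularFormClass.bdd_at_infty ModularForm.E₄) fun τ => by
      rw [show (2 : ℝ) +ᵥ τ = (1 : ℝ) +ᵥ (1 : ℝ) +ᵥ τ by rw [vadd_vadd]; norm_num, hT4, hT4]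
  have h2 : PowerSeries.constantCoeff s = 1 := by
    have h3 := EisensteinSeries.E_qExpansion_coeff_zero (k := 4) (by norm_num) ⟨2, rfl⟩
    rw [qExpansion_coeff_zero one_pos (ModularFormClass.analyticAt_cuspFunction_zero _ one_pos
      one_mem_strictPeriods_SL) (SlashInvariantFormClass.periodic_comp_ofComplex _
      one_mem_strictPeriods_SL)] at h3
    rw [← h3]
    exact hs.tendsto.limUnder_eq.symm
  have hT : ∀ τ : ℍ, ((fun τ : ℍ => thetaE8 τ 0) - ⇑ModularForm.E₄) ((1 : ℝ) +ᵥ τ) =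
      ((fun τ : ℍ => thetaE8 τ 0) - ⇑ModularForm.E₄) τ := fun τ => by
    simp only [Pi.sub_apply]
    rw [hT4, coe_vadd, Complex.ofReal_one, add_comm, thetaE8_add_one]
  obtain ⟨t, ht⟩ := X_sq_dvd (hp.sub hs) hT (by rw [map_sub, h1, h2, sub_self])
  have h0 := level_one_eq_zero (m := 1) (k := 4) (p := t) (by rw [← ht]; exact hp.sub hs) hT
    (fun τ => by
      simp only [Pi.sub_apply]
      have h4 := thetaE8_inversion τ.im_pos 0
      rw [smul_zero] at h4
      rw [hS4, coe_S_smul, mul_sub]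
      congr 1
      refine h4.trans ?_
      simp [pair_eq]) (by norm_num)
  exact sub_eq_zero.mp (congrFun h0 τ)

/-- The automorphy factor of index `2`. -/
def autFactor (τ : ℍ) (u : E8C) : ℂ :=
  Complex.exp (-(Real.pi * Complex.I * (2 : ℕ) * pair u.1 u.1 / τ))

theorem autFactor_ne_zero (τ : ℍ) (u : E8C) : autFactor τ u ≠ 0 := Complex.exp_ne_zero _

theorem autFactor_zero (τ : ℍ) : autFactor τ 0 = 1 := by
  simp [autFactor, pair_eq]

/-- Inversion of Θ at the point (2τ, 2u). The factor 16 is 2⁴. -/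
theorem thetaE8_half_S (τ : ℍ) (u : E8C) :
    thetaE8 ((ModularGroup.S • τ : ℍ) / 2) ((τ : ℂ)⁻¹ • u) =
      16 * (τ : ℂ) ^ 4 * autFactor τ u * thetaType 0 τ u := by
  have h0 : (τ : ℂ) ≠ 0 := ne_zero τ
  have him : 0 < (2 * (τ : ℂ)).im := by simpa using τ.im_pos
  have h := thetaE8_inversion him ((2 : ℂ) • u)
  rw [thetaE8_double, smul_smul, show (2 * (τ : ℂ))⁻¹ * 2 = (τ : ℂ)⁻¹ by field_simp] at h
  rw [coe_S_smul, show -1 / (τ : ℂ) / 2 = -1 / (2 * τ) by field_simp, h, autFactor,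
    show (((2 : ℂ) • u : E8C) : Fin 10 → ℂ) = (2 : ℂ) • u.1 from rfl, pair_smul_left,
    pair_smul_right]
  have h2 : Real.pi * Complex.I * (2 * (2 * pair u.1 u.1)) / (2 * τ) =
    Real.pi * Complex.I * (2 : ℕ) * pair u.1 u.1 / τ := by
    push_cast; field_simp
  rw [h2]
  ring

theorem thetaType_zero_S (τ : ℍ) (u : E8C) :
    16 * thetaType 0 (ModularGroup.S • τ) ((τ : ℂ)⁻¹ • u) =
      (τ : ℂ) ^ 4 * autFactor τ u * thetaE8 (τ / 2) u := by
  have h0 : (τ : ℂ) ≠ 0 := ne_zero τ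
  have h := thetaE8_inversion (half_im_pos τ) u
  rw [← thetaE8_double, coe_S_smul, smul_smul, show 2 * (-1 / (τ : ℂ)) = -1 / (τ / 2) by field_simp,
    show 2 * (τ : ℂ)⁻¹ = (τ / 2 : ℂ)⁻¹ by field_simp, h, autFactor]
  have h2 : Real.pi * Complex.I * pair u.1 u.1 / (τ / 2) =
    Real.pi * Complex.I * (2 : ℕ) * pair u.1 u.1 / τ := by
    push_cast; field_simp
  rw [h2]
  ring

theorem thetaE8_neg (τ : ℂ) (u : E8C) : thetaE8 τ (-u) = thetaE8 τ u := by
  rw [thetaE8, thetaE8, ← (Equiv.neg E8).tsum_eq]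
  refine tsum_congr fun x => ?_
  rw [thetaE8Term, thetaE8Term, Equiv.neg_apply, qE_neg]
  have h1 := ell_zsmul_left (-1) x (-u)
  have h2 := ell_smul_right x (-1) u
  rw [neg_one_smul] at h1
  rw [show (-1 : ℂ) • u = -u from neg_one_smul ℂ u] at h2
  rw [h1, h2]
  push_cast
  ring_nf

/-- The point (τ + 1)/2 goes to (-1/τ + 1)/2 in four steps: translate by -1, invert, translate by
-2, invert. The two inversions produce the automorphy factor and a sign of u, which is absorbed by
starting from -u. -/
theorem thetaE8_half_add_S (τ : ℍ) (u : E8C) :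
    thetaE8 (((ModularGroup.S • τ : ℍ) + 1) / 2) ((τ : ℂ)⁻¹ • u) =
      (τ : ℂ) ^ 4 * autFactor τ u * thetaE8 ((τ + 1) / 2) u := by
  have h0 : (τ : ℂ) ≠ 0 := ne_zero τ
  have hi : 0 < (τ : ℂ).im := τ.im_pos
  have h1 : (τ : ℂ) - 1 ≠ 0 := fun h => by
    have := congrArg Complex.im h
    simp at this
    exact τ.im_pos.ne' this
  have hr : 0 < (((τ : ℂ) - 1) / 2).im := by
    rw [Complex.div_ofNat_im, Complex.sub_im, Complex.one_im, sub_zero]; exact half_pos hi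
  have hs : 0 < (-1 / (((τ : ℂ) - 1) / 2)).im := by
    rw [neg_div, Complex.neg_im, one_div, Complex.inv_im, neg_div, neg_neg]
    exact div_pos hr (Complex.normSq_pos.mpr (div_ne_zero h1 two_ne_zero))
  have hs' : 0 < (-1 / (((τ : ℂ) - 1) / 2) - 2).im := by
    rw [Complex.sub_im]; simpa using hs
  have e1 := thetaE8_inversion hr (-u)
  have e2 := thetaE8_inversion hs' ((((τ : ℂ) - 1) / 2)⁻¹ • (-u))
  have e3 : thetaE8 (-1 / (((τ : ℂ) - 1) / 2)) ((((τ : ℂ) - 1) / 2)⁻¹ • (-u)) =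
      thetaE8 (-1 / (((τ : ℂ) - 1) / 2) - 2) ((((τ : ℂ) - 1) / 2)⁻¹ • (-u)) := by
    rw [← thetaE8_add_one (_ - 2), ← thetaE8_add_one (_ - 2 + 1)]
    congr 1
    ring
  have e4 : thetaE8 (((τ : ℂ) - 1) / 2) (-u) = thetaE8 ((τ + 1) / 2) u := by
    rw [thetaE8_neg, ← thetaE8_add_one]
    congr 1
    ring
  have hsv : -1 / (((τ : ℂ) - 1) / 2) - 2 = -2 * τ / (τ - 1) := by field_simp; ring
  rw [e1, e4] at e3
  rw [← e3, smul_smul] at e2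
  rw [hsv] at e2
  have a1 : -1 / (-2 * (τ : ℂ) / (τ - 1)) = (-1 / τ + 1) / 2 := by field_simp; ring
  have a2 : (-2 * (τ : ℂ) / (τ - 1))⁻¹ * (((τ : ℂ) - 1) / 2)⁻¹ = -(τ : ℂ)⁻¹ := by
    field_simp
  rw [a1, a2, _root_.neg_smul, smul_neg, neg_neg] at e2
  rw [coe_S_smul, e2, autFactor]
  have a3 : ((((((τ : ℂ) - 1) / 2)⁻¹ • (-u) : E8C)) : Fin 10 → ℂ) =
      (-(((τ : ℂ) - 1) / 2)⁻¹) • u.1 := by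
    rw [smul_neg, ← _root_.neg_smul]; rfl
  have a4 : ((-u : E8C) : Fin 10 → ℂ) = (-1 : ℂ) • u.1 := by
    rw [neg_one_smul]; rfl
  rw [a3, a4]
  simp only [pair_smul_left, pair_smul_right]
  generalize pair u.1 u.1 = P
  have h5 : Complex.exp (-(Real.pi * Complex.I *
      (-(((τ : ℂ) - 1) / 2)⁻¹ * (-(((τ : ℂ) - 1) / 2)⁻¹ * P)) / (-2 * τ / (τ - 1)))) *
      Complex.exp (-(Real.pi * Complex.I * (-1 * (-1 * P)) / (((τ : ℂ) - 1) / 2))) =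
      Complex.exp (-(Real.pi * Complex.I * (2 : ℕ) * P / τ)) := by
    rw [← Complex.exp_add]
    congr 1
    push_cast
    field_simp
    ring
  have h6 : (-2 * (τ : ℂ) / (τ - 1)) ^ 4 * (((τ : ℂ) - 1) / 2) ^ 4 = (τ : ℂ) ^ 4 := by
    field_simp
  rw [← h5, ← h6]
  ring

/-! ### Constants of the level two theta functions -/

theorem thetaE8_half_vadd (τ : ℍ) (u : E8C) :
    thetaE8 (((1 : ℝ) +ᵥ τ : ℍ) / 2) u = thetaE8 ((τ + 1) / 2) u := by
  rw [coe_vadd, Complex.ofReal_one, add_comm]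

theorem thetaE8_half_add_vadd (τ : ℍ) (u : E8C) :
    thetaE8 ((((1 : ℝ) +ᵥ τ : ℍ) + 1) / 2) u = thetaE8 (τ / 2) u := by
  rw [coe_vadd, Complex.ofReal_one, ← thetaE8_add_one ((τ : ℂ) / 2)]
  congr 1
  ring

theorem thetaType_zero_vadd (τ : ℍ) (u : E8C) :
    thetaType 0 ((1 : ℝ) +ᵥ τ) u = thetaType 0 τ u := by
  rw [← thetaE8_double, ← thetaE8_double, coe_vadd, Complex.ofReal_one,
    ← thetaE8_add_one (2 * τ), ← thetaE8_add_one (2 * τ + 1)]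
  congr 1
  ring

theorem triple_thetaE8 : Triple 4 (fun τ => thetaType 0 τ 0)
    ((1 / 16 : ℂ) • fun τ : ℍ => thetaE8 (τ / 2) 0)
    ((1 / 16 : ℂ) • fun τ : ℍ => thetaE8 ((τ + 1) / 2) 0) where
  T_fst τ := thetaType_zero_vadd τ 0
  T_snd τ := by simp only [Pi.smul_apply, thetaE8_half_vadd]
  T_trd τ := by simp only [Pi.smul_apply, thetaE8_half_add_vadd]
  S_fst τ := by
    have := thetaType_zero_S τ 0
    rw [smul_zero, autFactor_zero] at this
    simp only [Pi.smul_apply, smul_eq_mul]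
    rw [zpow_ofNat]
    linear_combination (1 / 16 : ℂ) * this
  S_snd τ := by
    have := thetaE8_half_S τ 0
    rw [smul_zero, autFactor_zero] at this
    simp only [Pi.smul_apply, smul_eq_mul]
    rw [zpow_ofNat]
    linear_combination (1 / 16 : ℂ) * this
  S_trd τ := by
    have := thetaE8_half_add_S τ 0
    rw [smul_zero, autFactor_zero] at this
    simp only [Pi.smul_apply, smul_eq_mul]
    rw [zpow_ofNat]
    linear_combination (1 / 16 : ℂ) * this
  exp_fst := by
    obtain ⟨p, hp, -⟩ := exists_hasExp_thetaE8 four_ne_zero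
    refine ⟨p, ?_⟩
    rwa [show (fun τ : ℍ => thetaE8 ((4 : ℕ) * τ / 2) 0) = fun τ => thetaType 0 τ 0 from
      funext fun τ => by
        rw [← thetaE8_double, smul_zero]
        congr 1
        push_cast
        ring] at hp
  exp_snd := by
    obtain ⟨p, hp, -⟩ := exists_hasExp_thetaE8 one_ne_zero
    simp only [Nat.cast_one, one_mul] at hp
    exact ⟨_, hp.const_mul _⟩

theorem triple_quartic : Triple 4
    ((1 / 4 : ℂ) • gTwo ^ 2 - (3 / 16 : ℂ) • gFour)
    ((1 / 4 : ℂ) • gTwoS ^ 2 - (3 / 16 : ℂ) • gFourS)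
    ((1 / 4 : ℂ) • gTwoT ^ 2 - (3 / 16 : ℂ) • gFourT) :=
  ((triple_gTwo.pow 2).smul _).sub (triple_gFour.smul _)

theorem exists_hasExp_gTwoS : ∃ p, HasExp p gTwoS ∧ PowerSeries.constantCoeff p = -1 := by
  obtain ⟨p, hp, h1⟩ := exists_hasRatExp_gTwo
  obtain ⟨s, hs, -⟩ := exists_hasRatExp_gFourSqrt
  have := (HasExp.add hp (HasExp.const_mul 3 hs)).const_mul (-1 / 2)
  have h : ((-1 / 2 : ℂ) • (gTwo + (3 : ℂ) • gFourSqrt)) = gTwoS := funext fun τ => by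
    simp only [gTwoS, Pi.smul_apply, Pi.add_apply, smul_eq_mul]
    ring
  refine ⟨_, h ▸ this, ?_⟩
  rw [PowerSeries.smul_eq_C_mul, PowerSeries.smul_eq_C_mul, map_mul, map_add, map_mul,
    constantCoeff_map, constantCoeff_map, h1]
  simp

theorem HasExp.X_dvd {p : PowerSeries ℂ} {f : ℍ → ℂ} (_h : HasExp p f)
    (h0 : PowerSeries.constantCoeff p = 0) : ∃ s, p = PowerSeries.X ^ 1 * s := by
  rw [pow_one]; exact PowerSeries.X_dvd_iff.mpr h0

/-- Two triples of weight 4 whose constant terms agree at both cusps are compared by the valence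
bound. -/
theorem thetaType_zero_zero :
    (fun τ => thetaType 0 τ 0) = (1 / 4 : ℂ) • gTwo ^ 2 - (3 / 16 : ℂ) • gFour := by
  have h := triple_thetaE8.sub triple_quartic
  obtain ⟨p, hp, hp1⟩ := exists_hasExp_thetaE8 four_ne_zero
  rw [show (fun τ : ℍ => thetaE8 ((4 : ℕ) * τ / 2) 0) = fun τ => thetaType 0 τ 0 from
      funext fun τ => by
        rw [← thetaE8_double, smul_zero]
        congr 1
        push_cast
        ring] at hp
  obtain ⟨s, hs, hs1⟩ := exists_hasExp_thetaE8 one_ne_zero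
  simp only [Nat.cast_one, one_mul] at hs
  obtain ⟨g, hg, hg1⟩ := exists_hasRatExp_gTwo
  obtain ⟨f, hf, hf1⟩ := exists_hasRatExp_gFour
  obtain ⟨g', hg', hg1'⟩ := exists_hasExp_gTwoS
  obtain ⟨f', hf', hf1'⟩ := exists_hasExp_gFourS
  have e1 := hp.sub (((HasExp.pow hg 2).const_mul (1 / 4)).sub (HasExp.const_mul (3 / 16) hf))
  have e2 := (hs.const_mul (1 / 16)).sub
    ((hg'.pow 2).const_mul (1 / 4) |>.sub (hf'.const_mul (3 / 16)))
  obtain ⟨a, ha⟩ := X_sq_dvd e1 h.T_fst (by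
    simp only [PowerSeries.smul_eq_C_mul, map_mul, map_sub, map_pow, constantCoeff_map, hp1, hg1]
    simp
    norm_num)
  obtain ⟨b, hb⟩ := e2.X_dvd (by
    simp only [PowerSeries.smul_eq_C_mul, map_mul, map_sub, map_pow, hs1, hg1', hf1']
    simp
    norm_num)
  have e3 := e2.vadd_one
  rw [funext h.T_snd] at e3
  obtain ⟨c, hc⟩ := e3.X_dvd (by
    rw [← PowerSeries.coeff_zero_eq_constantCoeff_apply, PowerSeries.coeff_mk, hb]; simp)
  -- The orders in q^{1/2} are at least 2, 1 and 1, so the product of weight 12 vanishes to order 2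
  -- in q.
  have h0 := h.eq_zero_of_order (i := 2) (j := 1) (m := 2) (p := a) (s := b) (t := c)
    (ha ▸ e1) (hb ▸ e2) (hc ▸ e3) (by norm_num) (by norm_num)
  exact sub_eq_zero.mp h0

/-- The identity for θ₀ and its two conjugates are three linear equations for the three theta
constants. -/
theorem thetaType_constants (τ : ℍ) :
    thetaType 0 τ 0 = (4 * gTwo τ ^ 2 - 3 * gFour τ) / 16 ∧
    thetaType 1 τ 0 = 135 * gFour τ / 16 ∧
    thetaType 2 τ 0 = 120 * (gTwo τ * gFourSqrt τ / 16) := by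
  have h0 := thetaType_zero_zero
  have h := triple_thetaE8.sub triple_quartic
  obtain ⟨hb, hc⟩ := h.eq_zero_of_fst (sub_eq_zero.mpr h0)
  have a1 := congrFun h0 τ
  have b1 := congrFun (sub_eq_zero.mp hb) τ
  have c1 := congrFun (sub_eq_zero.mp hc) τ
  simp only [Pi.sub_apply, Pi.smul_apply, Pi.pow_apply, smul_eq_mul, gTwoS, gTwoT, gFourS,
    gFourT] at a1 b1 c1
  rw [thetaE8_half] at b1
  rw [thetaE8_half_add] at c1
  rw [gFour_eq] at a1 ⊢
  refine ⟨by linear_combination a1, ?_, ?_⟩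
  · linear_combination 8 * b1 + 8 * c1 - a1
  · linear_combination 8 * b1 - 8 * c1

/-! ### Polynomials in `E₂` with coefficients that are functions -/

/-- A function of `τ`, viewed as a function of `τ` and `u`. -/
def lift (f : ℍ → ℂ) : Fun := fun τ _ => f τ

/-- Evaluation of a polynomial at `(E₂, G₂, G₄)`, with `E₂` kept as a variable. -/
def toFun : MvPolynomial (Fin 3) ℚ →ₐ[ℚ] Polynomial Fun :=
  MvPolynomial.aeval ![Polynomial.X, Polynomial.C (lift gTwo), Polynomial.C (lift gFour)]

theorem toFun_C (r : ℚ) : toFun (MvPolynomial.C r) = Polynomial.C (lift fun _ => (r : ℂ)) := by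
  rw [toFun, MvPolynomial.algHom_C]
  rfl

theorem toFun_X (i : Fin 3) : toFun (MvPolynomial.X i) =
    ![Polynomial.X, Polynomial.C (lift gTwo), Polynomial.C (lift gFour)] i :=
  MvPolynomial.aeval_X _ _

theorem derivative_toFun_X (i : Fin 3) : Polynomial.derivative (toFun (MvPolynomial.X i)) =
    toFun (MvPolynomial.pderiv 0 (MvPolynomial.X i)) := by
  rw [toFun_X, MvPolynomial.pderiv_X]
  match i with
  | 0 => rw [Pi.single_eq_same, map_one]; exact Polynomial.derivative_X
  | 1 => rw [Pi.single_eq_of_ne (by decide), map_zero]; exact Polynomial.derivative_C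
  | 2 => rw [Pi.single_eq_of_ne (by decide), map_zero]; exact Polynomial.derivative_C

theorem derivative_toFun (Q : MvPolynomial (Fin 3) ℚ) :
    Polynomial.derivative (toFun Q) = toFun (MvPolynomial.pderiv 0 Q) := by
  induction Q using MvPolynomial.induction_on with
  | C a => rw [toFun_C, Polynomial.derivative_C, MvPolynomial.pderiv_C, map_zero]
  | add p q hp hq => rw [map_add, map_add, map_add, map_add, hp, hq]
  | mul_X p i hp =>
    rw [map_mul, Polynomial.derivative_mul, hp, MvPolynomial.pderiv_mul, map_add, map_mul, map_mul,
      derivative_toFun_X]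

theorem eval_toFun (Q : MvPolynomial (Fin 3) ℚ) (y : ℍ → ℂ) (τ : ℍ) (u : E8C) :
    (toFun Q).eval (lift y) τ u = MvPolynomial.aeval ![y τ, gTwo τ, gFour τ] Q := by
  induction Q using MvPolynomial.induction_on with
  | C a => rw [toFun_C, Polynomial.eval_C, MvPolynomial.algHom_C]; rfl
  | add p q hp hq => rw [map_add, map_add, Polynomial.eval_add, Pi.add_apply, Pi.add_apply, hp, hq]
  | mul_X p i hp =>
    rw [map_mul, map_mul, Polynomial.eval_mul, Pi.mul_apply, Pi.mul_apply, hp]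
    congr 1
    fin_cases i <;> simp [toFun, lift]

theorem smul_eq_lift_mul (c : ℂ) (P : Polynomial Fun) :
    c • P = Polynomial.C (lift fun _ => c) * P := by
  ext n τ u
  simp [lift]

theorem eq_add_C_of_derivative_eq {P P' : Polynomial Fun}
    (h : Polynomial.derivative P = Polynomial.derivative P') :
    P = P' + Polynomial.C (P.coeff 0 - P'.coeff 0) := by
  have h1 : Polynomial.derivative (P - P') = 0 := by rw [Polynomial.derivative_sub, h, sub_self]
  have h2 := Polynomial.derivative_eq_zero.mp h1
  have h3 := Polynomial.eq_C_of_natDegree_eq_zero h2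
  rw [Polynomial.coeff_sub] at h3
  rw [← h3]
  ring

/-- Integration in E₂ monomial by monomial. The antiderivative has no terms free of E₂, so its
E₂-free part satisfies any homogeneous transformation law. -/
theorem exists_antiderivative (R : MvPolynomial (Fin 3) ℚ) : ∃ S : MvPolynomial (Fin 3) ℚ,
    MvPolynomial.pderiv 0 S = R ∧ ∀ x y : ℂ, MvPolynomial.aeval ![0, x, y] S = 0 := by
  induction R using MvPolynomial.induction_on' with
  | monomial d c =>
    refine ⟨MvPolynomial.monomial (d + Finsupp.single 0 1) (c / (d 0 + 1)), ?_, fun x y => ?_⟩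
    · rw [MvPolynomial.pderiv_monomial, add_tsub_cancel_right]
      congr 1
      simp only [Finsupp.add_apply, Finsupp.single_eq_same]
      push_cast
      field_simp
    · rw [MvPolynomial.aeval_monomial, Finsupp.prod_fintype _ _ (by simp)]
      simp [Fin.prod_univ_three]
  | add p q hp hq =>
    obtain ⟨S, h1, h2⟩ := hp
    obtain ⟨T, h3, h4⟩ := hq
    exact ⟨S + T, by rw [map_add, h1, h3], fun x y => by rw [map_add, h2, h4, add_zero]⟩

/-- The terms without `E₂`. -/
def constPart (Q : MvPolynomial (Fin 3) ℚ) (τ : ℍ) : ℂ :=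
  MvPolynomial.aeval ![0, gTwo τ, gFour τ] Q

theorem coeff_zero_toFun (Q : MvPolynomial (Fin 3) ℚ) (τ : ℍ) (u : E8C) :
    (toFun Q).coeff 0 τ u = constPart Q τ := by
  rw [Polynomial.coeff_zero_eq_eval_zero]
  exact eval_toFun Q (fun _ => 0) τ u

/-- Polynomials in functions with rational expansions. -/
theorem exists_hasRatExp_aeval {f : Fin 3 → ℍ → ℂ} {p : Fin 3 → PowerSeries ℚ}
    (h : ∀ i, HasRatExp (p i) (f i)) (Q : MvPolynomial (Fin 3) ℚ) :
    ∃ s, HasRatExp s (fun τ => MvPolynomial.aeval (fun i => f i τ) Q) ∧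
      PowerSeries.constantCoeff s =
        MvPolynomial.aeval (fun i => PowerSeries.constantCoeff (p i)) Q := by
  induction Q using MvPolynomial.induction_on with
  | C a =>
    refine ⟨PowerSeries.C a, ?_, by simp⟩
    simp only [MvPolynomial.algHom_C]
    exact HasRatExp.const a
  | add P Q hP hQ =>
    obtain ⟨s, hs, h1⟩ := hP
    obtain ⟨t, ht, h2⟩ := hQ
    refine ⟨s + t, ?_, by simp [h1, h2]⟩
    simp only [map_add]
    exact hs.add ht
  | mul_X P i hP =>
    obtain ⟨s, hs, h1⟩ := hP
    refine ⟨s * p i, ?_, by simp [h1]⟩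
    simp only [map_mul, MvPolynomial.aeval_X]
    exact hs.mul (h i)

theorem exists_hasRatExp_evalAt (Q : MvPolynomial (Fin 3) ℚ) :
    ∃ s, HasRatExp s (evalAt Q) ∧
      PowerSeries.constantCoeff s = MvPolynomial.aeval ![(1 : ℚ), 2, 0] Q := by
  obtain ⟨p0, h0, c0⟩ := exists_hasRatExp_E2
  obtain ⟨p1, h1, c1⟩ := exists_hasRatExp_gTwo
  obtain ⟨p2, h2, c2⟩ := exists_hasRatExp_gFour
  obtain ⟨s, hs, hc⟩ := exists_hasRatExp_aeval
    (f := ![EisensteinSeries.E2, gTwo, gFour]) (p := ![p0, p1, PowerSeries.X ^ 2 * p2])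
    (fun i => by fin_cases i <;> assumption) Q
  refine ⟨s, ?_, ?_⟩
  · convert hs using 2 with τ
    rw [evalAt]
    congr 2
    funext i
    fin_cases i <;> rfl
  · rw [hc]
    congr 2
    funext i
    fin_cases i <;> simp [c0, c1]

/-- Reindexes a series that starts at a = b as a power series in q^{1/2} with leading exponent s and
steps of 2, and records the leading coefficient. -/
theorem exists_hasRatExp_of_hasSum_int {c : ℤ → ℚ} {t : ℤ → ℍ → ℂ} {f : ℍ → ℂ} (b : ℤ) (s : ℕ)
    (hc : ∀ a < b, c a = 0) (ht : ∀ (n : ℕ) τ, t (b + n) τ = nome τ ^ (s + 2 * n))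
    (h : ∀ τ, HasSum (fun a => (c a : ℂ) * t a τ) (f τ)) :
    ∃ p, HasRatExp (PowerSeries.X ^ s * p) f ∧ PowerSeries.constantCoeff p = c b := by
  have hfin : ∀ n, ((fun m : ℕ => 2 * m) ⁻¹' {n}).Finite := fun n =>
    Set.Finite.subset (Set.finite_Iic n) fun m hm => by
      simp only [Set.mem_preimage, Set.mem_singleton_iff] at hm
      simp only [Set.mem_Iic]; omega
  have hinj : Function.Injective fun n : ℕ => b + (n : ℤ) := fun m n hmn => by
    simpa using hmn
  have h1 := HasRatExp.of_hasSum (c := fun n : ℕ => c (b + n)) (f := f / nome ^ s) hfin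
    fun τ => by
      have h2 := (hinj.hasSum_iff (f := fun a => (c a : ℂ) * t a τ) fun a ha => by
        rw [hc a, Rat.cast_zero, zero_mul]
        by_contra hab
        exact ha ⟨(a - b).toNat, by simp only; omega⟩).mpr (h τ)
      have h3 := h2.mul_right (nome τ ^ s)⁻¹
      rw [Pi.div_apply, Pi.pow_apply, div_eq_mul_inv]
      refine h3.congr_fun fun n => ?_
      rw [Function.comp_apply, ht, pow_add]
      field_simp [nome_ne_zero τ]
  have h4 := (HasRatExp.nome.pow s).mul h1
  rw [show nome ^ s * (f / nome ^ s) = f from funext fun τ =>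
    mul_div_cancel₀ _ (pow_ne_zero _ (nome_ne_zero τ))] at h4
  refine ⟨_, h4, ?_⟩
  · rw [← PowerSeries.coeff_zero_eq_constantCoeff_apply, PowerSeries.coeff_mk,
      Finset.sum_eq_single 0]
    · simp
    · intro b hb h0
      simp at hb
      exact absurd hb h0
    · simp

/-! ### Level one -/

/-- The holomorphic anomaly equation for the generating series `Φ`. -/
def SolvesAnomaly (G : ℕ) (N : ℕ → H2 → ℚ) (Φ : ℕ → ℕ → Polynomial Fun) : Prop :=
  ∀ g ≤ G, ∀ n : ℕ, 1 ≤ n → n ≤ 2 →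
    (∀ k : ℕ, ModularLaw (2 * g + 6 * n - 2 - 2 * k) n ((Φ g n).coeff k)) ∧
    (∀ τ u, HasSum (genTerm N g n τ u)
      (qPow (n / 2) τ / ModularForm.eta τ ^ (12 * n)
        * (Φ g n).eval (fun τ' _ => EisensteinSeries.E2 τ') τ u)) ∧
    Polynomial.derivative (Φ g n) =
      ∑ p ∈ Finset.HasAntidiagonal.antidiagonal g, ∑ s ∈ Finset.Ico 1 n,
        (((s * (n - s) : ℕ) : ℂ) / 24) • (Φ p.1 s * Φ p.2 (n - s))
      + if g = 0 then 0 else (((n * (n + 1) : ℕ) : ℂ) / 24) • Φ (g - 1) n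

theorem qPow_div_eta {n : ℕ} (τ : ℍ) :
    qPow (n / 2) τ / ModularForm.eta τ ^ (12 * n) = (etaProd τ ^ (12 * n))⁻¹ := by
  rw [qPow_eq_nome _ n (by ring), pow_mul, eta_pow_twelve, mul_pow, pow_mul]
  have h1 := nome_ne_zero τ
  have h2 := etaProd_ne_zero τ
  field_simp

theorem evalAt_eq_eval (Q : MvPolynomial (Fin 3) ℚ) (τ : ℍ) (u : E8C) :
    (toFun Q).eval (lift EisensteinSeries.E2) τ u = evalAt Q τ :=
  eval_toFun Q EisensteinSeries.E2 τ u

theorem toFun_of_pderiv_eq_zero {Q : MvPolynomial (Fin 3) ℚ} (h : MvPolynomial.pderiv 0 Q = 0) :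
    toFun Q = Polynomial.C (lift (evalAt Q)) := by
  have h1 : Polynomial.derivative (toFun Q) = 0 := by rw [derivative_toFun, h, map_zero]
  have h2 := Polynomial.eq_C_of_natDegree_eq_zero (Polynomial.derivative_eq_zero.mp h1)
  have h3 : (toFun Q).coeff 0 = lift (evalAt Q) := by
    funext τ u
    rw [lift, ← evalAt_eq_eval Q τ u]
    nth_rw 2 [h2]
    rw [Polynomial.eval_C]
  rw [← h3]
  exact h2

theorem constPart_of_pderiv_eq_zero {Q : MvPolynomial (Fin 3) ℚ}
    (h : MvPolynomial.pderiv 0 Q = 0) : constPart Q = evalAt Q := by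
  funext τ
  rw [← coeff_zero_toFun Q τ 0, toFun_of_pderiv_eq_zero h, Polynomial.coeff_C_zero]
  rfl

theorem gFour_vadd_one (τ : ℍ) : gFour ((1 : ℝ) +ᵥ τ) = gFour τ := triple_gFour.T_fst τ

theorem constPart_vadd_one (Q : MvPolynomial (Fin 3) ℚ) (τ : ℍ) :
    constPart Q ((1 : ℝ) +ᵥ τ) = constPart Q τ := by
  rw [constPart, constPart, gTwo_vadd_one, gFour_vadd_one]

/-- The function u ↦ Θ(τ, 2u) is θ₀ at τ/2, which is not identically zero by independence. -/
theorem exists_thetaE8_ne_zero (τ : ℍ) : ∃ u, thetaE8 τ u ≠ 0 := by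
  by_contra! h
  let σ : ℍ := ⟨τ / 2, half_im_pos τ⟩
  have hσ : (2 * (σ : ℂ)) = τ := mul_div_cancel₀ _ two_ne_zero
  have := thetaType_independent (w := Pi.single 0 1) (τ := σ) (fun u => by
    rw [Finset.sum_eq_single 0 (fun i _ hi => by rw [Pi.single_eq_of_ne hi, zero_mul]) (by simp),
      ← thetaE8_double, hσ, h, mul_zero]) 0
  simp at this

/-- The theta function of `E₈` as a function on `ℍ × E₈ ⊗ ℂ`. -/
def thetaFun : Fun := fun τ u => thetaE8 τ u

theorem thetaE8_vadd_one (τ : ℍ) (u : E8C) : thetaE8 ((1 : ℝ) +ᵥ τ : ℍ) u = thetaE8 τ u := by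
  rw [coe_vadd, Complex.ofReal_one, add_comm, thetaE8_add_one]

theorem thetaE8_S_smul (τ : ℍ) (u : E8C) :
    thetaE8 (ModularGroup.S • τ : ℍ) ((τ : ℂ)⁻¹ • u) = (τ : ℂ) ^ 4 *
      Complex.exp (-(Real.pi * Complex.I * (1 : ℕ) * pair u.1 u.1 / τ)) * thetaE8 τ u := by
  rw [coe_S_smul, thetaE8_inversion τ.im_pos, Nat.cast_one, mul_one]

/-- The generating series of level one is determined up to a modular form. -/
theorem level_one_step {w : ℤ} {Ψ : Polynomial Fun} {Z : ℍ → ℂ} {P : MvPolynomial (Fin 3) ℚ}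
    (hmod : ModularLaw (w + 4) 1 (Ψ.coeff 0))
    (hval : ∀ τ u, Z τ * thetaE8 τ u =
      (etaProd τ ^ 12)⁻¹ * Ψ.eval (lift EisensteinSeries.E2) τ u)
    (hder : Polynomial.derivative Ψ = toFun (MvPolynomial.pderiv 0 P) * Polynomial.C thetaFun)
    (hP : ∀ τ : ℍ, constPart P (ModularGroup.S • τ) = (τ : ℂ) ^ w * constPart P τ)
    {f : ℍ → ℂ} (hf : f = etaProd ^ 12 * Z - evalAt P) :
    (∀ τ : ℍ, f (ModularGroup.S • τ) = (τ : ℂ) ^ w * f τ) ∧ (∀ τ, f ((1 : ℝ) +ᵥ τ) = f τ) ∧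
      Ψ = (toFun P + Polynomial.C (lift f)) * Polynomial.C thetaFun := by
  -- Equal derivatives in E₂ mean that Ψ and the particular solution differ by a term ψ without E₂.
  obtain ⟨ψ, hψ⟩ : ∃ ψ, Ψ = toFun P * Polynomial.C thetaFun + Polynomial.C ψ :=
    ⟨_, eq_add_C_of_derivative_eq (by
      rw [hder, Polynomial.derivative_mul, Polynomial.derivative_C, mul_zero, add_zero,
        derivative_toFun])⟩
  have h1 : ψ = lift f * thetaFun := by
    funext τ u
    have h2 := hval τ u
    rw [hψ, Polynomial.eval_add, Polynomial.eval_mul, Polynomial.eval_C, Polynomial.eval_C,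
      Pi.add_apply, Pi.add_apply, Pi.mul_apply, Pi.mul_apply, evalAt_eq_eval] at h2
    have h3 : etaProd τ ^ 12 ≠ 0 := pow_ne_zero _ (etaProd_ne_zero τ)
    rw [eq_inv_mul_iff_mul_eq₀ h3] at h2
    rw [hf]
    simp only [lift, thetaFun, Pi.mul_apply, Pi.sub_apply, Pi.pow_apply] at h2 ⊢
    linear_combination -h2
  have hΨ : Ψ = (toFun P + Polynomial.C (lift f)) * Polynomial.C thetaFun := by
    rw [hψ, h1, add_mul, Polynomial.C_mul]
  have hc : ∀ τ u, Ψ.coeff 0 τ u = (constPart P τ + f τ) * thetaE8 τ u := fun τ u => by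
    rw [hΨ, Polynomial.coeff_mul_C, Polynomial.coeff_add, Polynomial.coeff_C_zero]
    simp only [Pi.mul_apply, Pi.add_apply, coeff_zero_toFun]
    rfl
  refine ⟨fun τ => ?_, fun τ => ?_, hΨ⟩
  -- At u = 0 the theta function is E₄(τ), which has zeros, so u is chosen depending on τ before Θ
  -- is cancelled.
  · obtain ⟨u, hu⟩ := exists_thetaE8_ne_zero τ
    have h2 := hmod.2 τ u
    rw [hc, hc, hP, thetaE8_S_smul, zpow_add₀ (ne_zero τ), zpow_ofNat] at h2
    have h3 := Complex.exp_ne_zero (-(Real.pi * Complex.I * (1 : ℕ) * pair u.1 u.1 / τ))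
    have h4 : (τ : ℂ) ^ 4 ≠ 0 := pow_ne_zero _ (ne_zero τ)
    have h5 := mul_ne_zero (mul_ne_zero h4 h3) hu
    refine mul_right_cancel₀ h5 ?_
    linear_combination h2
  · obtain ⟨u, hu⟩ := exists_thetaE8_ne_zero τ
    have h2 := hmod.1 τ u
    rw [hc, hc, constPart_vadd_one, thetaE8_vadd_one] at h2
    have := mul_right_cancel₀ hu h2
    linear_combination this

/-- The polynomials that compute the numbers of level one in genus at most three. -/
def levelOnePoly : ℕ → MvPolynomial (Fin 3) ℚ
  | 0 => 1
  | 1 => MvPolynomial.C (1 / 12) * x2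
  | 2 => MvPolynomial.C (1 / 1440) * (5 * x2 ^ 2 + MvPolynomial.C (1 / 4) * (g2 ^ 2 + 3 * g4))
  | 3 => MvPolynomial.C (1 / 362880) * (35 * x2 ^ 3
      + MvPolynomial.C (21 / 4) * (g2 ^ 2 + 3 * g4) * x2
      + MvPolynomial.C (1 / 2) * (g2 ^ 3 - 9 * g2 * g4))
  | _ => 0

theorem pderiv_ofNat (n : ℕ) [n.AtLeastTwo] (i : Fin 3) :
    MvPolynomial.pderiv i (ofNat(n) : MvPolynomial (Fin 3) ℚ) = 0 :=
  Derivation.map_natCast _ n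

theorem pderiv_levelOnePoly {g : ℕ} (hg : g + 1 ≤ 3) :
    MvPolynomial.pderiv 0 (levelOnePoly (g + 1)) = MvPolynomial.C (1 / 12) * levelOnePoly g := by
  have h1 : MvPolynomial.pderiv 0 g2 = 0 := MvPolynomial.pderiv_X_of_ne (by decide)
  have h2 : MvPolynomial.pderiv 0 g4 = 0 := MvPolynomial.pderiv_X_of_ne (by decide)
  have h3 : MvPolynomial.pderiv 0 x2 = 1 := MvPolynomial.pderiv_X_self 0
  replace hg : g ≤ 2 := by omega
  interval_cases g <;>
  · refine MvPolynomial.funext fun x => ?_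
    simp only [levelOnePoly, map_add, map_sub, MvPolynomial.pderiv_mul, MvPolynomial.pderiv_C,
      Derivation.leibniz_pow, h1, h2, h3, map_mul, map_pow, map_ofNat, MvPolynomial.eval_C,
      MvPolynomial.eval_X, smul_eq_mul, nsmul_eq_mul, map_natCast, map_zero, map_one,
      pderiv_ofNat]
    push_cast
    ring

/-- With E₄ = (G₂² + 3G₄)/4 and E₆ = (G₂³ - 9G₂G₄)/8, the parts free of E₂ are 1, 0, E₄/1440 and
E₆/90720. -/
theorem constPart_levelOnePoly {g : ℕ} (hg : g ≤ 3) (τ : ℍ) :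
    constPart (levelOnePoly g) (ModularGroup.S • τ) =
      (τ : ℂ) ^ (2 * g : ℤ) * constPart (levelOnePoly g) τ := by
  have h0 : ((2 * g : ℕ) : ℤ) = 2 * (g : ℤ) := by push_cast; rfl
  rw [← h0, zpow_natCast]
  interval_cases g <;>
  · simp only [constPart, levelOnePoly, map_add, map_sub, map_mul, map_pow, map_ofNat,
      MvPolynomial.algHom_C, MvPolynomial.aeval_X, gTwo_S, gFour_eq, gFourSqrt_S_smul, map_one,
      Matrix.cons_val]
    ring

/-- The constant terms of E₂, G₂, G₄ are 1, 2, 0. The values agree with the contributions of the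
rational curve e₉ to genus g. -/
theorem aeval_levelOnePoly {g : ℕ} (hg : g ≤ 3) :
    MvPolynomial.aeval ![(1 : ℚ), 2, 0] (levelOnePoly g) = gvC 0 g := by
  obtain ⟨h0, h1, h2, h3⟩ := gvC_values
  interval_cases g <;>
  · simp only [levelOnePoly, map_add, map_sub, map_mul, map_pow, map_ofNat,
      MvPolynomial.algHom_C, MvPolynomial.aeval_X, map_one, Matrix.cons_val, h0, h1, h2, h3,
      Algebra.algebraMap_self_apply]
    try norm_num

theorem nome_sq (τ : ℍ) (n : ℕ) :
    Complex.exp (2 * Real.pi * Complex.I * (n * τ)) = nome τ ^ (2 * n) := by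
  rw [nome, ← Complex.exp_nat_mul]
  congr 1
  push_cast
  ring

section LevelOne

variable {G : ℕ} {N : ℕ → H2 → ℚ} {Φ : ℕ → ℕ → Polynomial Fun}

theorem summable_level_one (hN : IsSolution G 2 N) (hΦ : SolvesAnomaly G N Φ) {g : ℕ}
    (hg : g ≤ G) (τ : ℍ) : Summable (orbitTerm N g (e 9) τ) :=
  (level_one_decomposition (hN.weyl_inv g hg) ((hΦ g hg 1 le_rfl one_le_two).2.1 τ 0)).1

theorem exists_hasRatExp_orbitChar_one (hN : IsSolution G 2 N) (hΦ : SolvesAnomaly G N Φ) {g : ℕ}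
    (hg : g ≤ G) : ∃ p, HasRatExp p (orbitChar N g (e 9)) ∧
      PowerSeries.constantCoeff p = N g (e 9) := by
  obtain ⟨nb, hb, hv⟩ := hN.vanishing
  obtain ⟨p, hp, h0⟩ := exists_hasRatExp_of_hasSum_int (c := fun a => N g (e 9 + a • fib))
    (t := fun a τ => Complex.exp (2 * Real.pi * Complex.I * (a * τ)))
    (f := orbitChar N g (e 9)) 0 0 (fun a ha => N_e_nine_neg hb hv hg ha)
    (fun n τ => by
      rw [zero_add, zero_add, ← nome_sq]
      push_cast
      rfl)
    (fun τ => by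
      refine (summable_level_one hN hΦ hg τ).hasSum.congr_fun fun a => ?_
      exact (orbitTerm_e_nine N g τ a).symm)
  rw [pow_zero, one_mul] at hp
  exact ⟨p, hp, by rw [h0, zero_smul, add_zero]⟩

theorem exists_hasExp_E₄ : ∃ p, HasExp p (fun τ => ModularForm.E₄ τ) ∧
    PowerSeries.constantCoeff p = 1 := by
  obtain ⟨p, hp, h1⟩ := exists_hasExp_thetaE8 two_ne_zero
  simp only [Nat.cast_ofNat, mul_div_cancel_left₀ _ (two_ne_zero' ℂ), thetaE8_eq_E₄] at hp
  exact ⟨p, hp, h1⟩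

/-- The orbit character in genus zero and level one. -/
theorem orbitChar_zero_mul (hN : IsSolution G 2 N) (hΦ : SolvesAnomaly G N Φ) :
    orbitChar N 0 (e 9) * etaProd ^ 12 = 1 := by
  obtain ⟨p, hp, -⟩ := exists_hasRatExp_orbitChar_one hN hΦ (Nat.zero_le G)
  obtain ⟨r, hr, -⟩ := exists_hasExp_etaProd
  obtain ⟨s, hs, hs1⟩ := exists_hasExp_E₄
  -- The initial condition gives the identity only after multiplication by E₄, which has zeros. It
  -- is cancelled as a power series.
  have h0 : (orbitChar N 0 (e 9) * etaProd ^ 12 - 1) * (fun τ => ModularForm.E₄ τ) = 0 := by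
    funext τ
    have h := (level_one_decomposition (hN.weyl_inv 0 (Nat.zero_le G)) (hN.initial τ)).2
    have h1 := qPow_div_eta (n := 1) τ
    rw [Nat.cast_one, mul_one] at h1
    rw [mul_div_right_comm, h1, thetaE8_eq_E₄] at h
    have h2 : etaProd τ ^ 12 ≠ 0 := pow_ne_zero _ (etaProd_ne_zero τ)
    have h3 := congrArg (fun x => etaProd τ ^ 12 * x) h
    simp only [mul_inv_cancel_left₀ h2] at h3
    simp only [Pi.mul_apply, Pi.sub_apply, Pi.pow_apply, Pi.one_apply, Pi.zero_apply]
    linear_combination -h3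
  rcases ((HasExp.mul hp (hr.pow 12)).sub HasExp.one).eq_zero_or_eq_zero hs h0 with h | h
  · exact sub_eq_zero.mp h
  · rw [h] at hs
    rw [hs.unique HasExp.zero, map_zero] at hs1
    exact absurd hs1 zero_ne_one

theorem N_zero_e_nine (hN : IsSolution G 2 N) (hΦ : SolvesAnomaly G N Φ) : N 0 (e 9) = 1 := by
  obtain ⟨p, hp, hc⟩ := exists_hasRatExp_orbitChar_one hN hΦ (Nat.zero_le G)
  obtain ⟨r, hr, hr1⟩ := exists_hasExp_etaProd
  have h := HasExp.mul hp (hr.pow 12)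
  rw [orbitChar_zero_mul hN hΦ] at h
  have h1 := congrArg PowerSeries.constantCoeff (h.unique HasExp.one)
  rw [map_mul, map_pow, hr1, constantCoeff_map, hc] at h1
  rw [one_pow, mul_one, map_one] at h1
  exact_mod_cast h1

/-- By the initial condition the product is the inverse of the genus 0 orbit character, whose
coefficients are the rational numbers N₀. -/
theorem exists_hasRatExp_etaProd (hN : IsSolution G 2 N) (hΦ : SolvesAnomaly G N Φ) :
    ∃ p, HasRatExp p (etaProd ^ 12) ∧ PowerSeries.constantCoeff p = 1 := by
  obtain ⟨p, hp, hc⟩ := exists_hasRatExp_orbitChar_one hN hΦ (Nat.zero_le G)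
  have h := orbitChar_zero_mul hN hΦ
  rw [N_zero_e_nine hN hΦ] at hc
  have h1 := hp.inv (fun τ h0 => by
    have := congrFun h τ
    rw [Pi.mul_apply, h0, zero_mul] at this
    exact zero_ne_one this) (by rw [hc]; exact one_ne_zero)
  rw [inv_eq_of_mul_eq_one_right h] at h1
  exact ⟨_, h1, by simp [hc]⟩

/-! ### Integration of the anomaly equation in level one -/

theorem level_one_eval (hN : IsSolution G 2 N) (hΦ : SolvesAnomaly G N Φ) {g : ℕ} (hg : g ≤ G)
    (τ : ℍ) (u : E8C) : orbitChar N g (e 9) τ * thetaE8 τ u =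
      (etaProd τ ^ 12)⁻¹ * (Φ g 1).eval (lift EisensteinSeries.E2) τ u := by
  have h := (hΦ g hg 1 le_rfl one_le_two).2.1 τ u
  rw [← (level_one_decomposition (hN.weyl_inv g hg) h).2]
  have h1 := qPow_div_eta (n := 1) τ
  rw [h1]
  rfl

/-- The difference from a particular solution is a level-one form f of weight 2g times Θ. In general
f is a polynomial in G₂ and G₄. For g ≤ 3 it vanishes once its constant term does. -/
theorem level_one_of_particular (hN : IsSolution G 2 N) (hΦ : SolvesAnomaly G N Φ) {g : ℕ}
    (hg : g ≤ G) {P : MvPolynomial (Fin 3) ℚ}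
    (hder : Polynomial.derivative (Φ g 1) =
      toFun (MvPolynomial.pderiv 0 P) * Polynomial.C thetaFun)
    (hP : ∀ τ : ℍ, constPart P (ModularGroup.S • τ) = (τ : ℂ) ^ (2 * g : ℤ) * constPart P τ) :
    (∃ F, Φ g 1 = toFun F * Polynomial.C thetaFun) ∧
      (g ≤ 3 → MvPolynomial.aeval ![(1 : ℚ), 2, 0] P = gvC 0 g →
        Φ g 1 = toFun P * Polynomial.C thetaFun) := by
  obtain ⟨f, hf⟩ : ∃ f, f = etaProd ^ 12 * orbitChar N g (e 9) - evalAt P := ⟨_, rfl⟩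
  have hmod := (hΦ g hg 1 le_rfl one_le_two).1 0
  rw [show (2 * g + 6 * (1 : ℕ) - 2 - 2 * (0 : ℕ) : ℤ) = 2 * g + 4 by push_cast; ring] at hmod
  obtain ⟨hS, hT, hΨ⟩ := level_one_step hmod (level_one_eval hN hΦ hg) hder hP hf
  obtain ⟨r, hr, hr1⟩ := exists_hasRatExp_etaProd hN hΦ
  obtain ⟨p, hp, hpc⟩ := exists_hasRatExp_orbitChar_one hN hΦ hg
  obtain ⟨s, hs, hsc⟩ := exists_hasRatExp_evalAt P
  have hfe : HasRatExp (r * p - s) f := hf ▸ (hr.mul hp).sub hs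
  refine ⟨?_, fun h3 hc => ?_⟩
  -- A level-one form coincides with its conjugates, so the structure theorem for Γ₀(2) applies to
  -- it.
  · have ht : Triple (2 * g) f f f := ⟨hT, hT, hT, hS, hS, hS, ⟨_, hfe⟩, ⟨_, hfe⟩⟩
    obtain ⟨-, A, -, -, hA, -, -, hA', -⟩ := ht.exists_polynomials hfe
    refine ⟨P + A, ?_⟩
    rw [hΨ, map_add, toFun_of_pderiv_eq_zero hA, funext hA']
  · obtain ⟨nb, hb, hv⟩ := hN.vanishing
    have h0 : PowerSeries.constantCoeff ((r * p - s).map (algebraMap ℚ ℂ)) = 0 := by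
      rw [constantCoeff_map, map_sub, map_mul, hr1, hpc, hsc, hc, N_e_nine hb hv hg,
        N_zero_e_nine hN hΦ]
      simp
    obtain ⟨t, ht⟩ := X_sq_dvd hfe hT h0
    -- The weight is at most 6, below 12, and f vanishes at the cusp.
    have hf0 : f = 0 := level_one_eq_zero (m := 1) (p := t) (k := 2 * g) (by
      rw [mul_one, ← ht]; exact hfe) hT hS (by push_cast; omega)
    rw [hΨ, hf0, show lift 0 = 0 from rfl, Polynomial.C_0, add_zero]

theorem derivative_level_one (hΦ : SolvesAnomaly G N Φ) {g : ℕ} (hg : g ≤ G) :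
    Polynomial.derivative (Φ g 1) = if g = 0 then 0 else (1 / 12 : ℂ) • Φ (g - 1) 1 := by
  rw [(hΦ g hg 1 le_rfl one_le_two).2.2]
  simp only [Finset.Ico_self, Finset.sum_empty, Finset.sum_const_zero, zero_add]
  norm_num

theorem toFun_C_mul (r : ℚ) (Q : MvPolynomial (Fin 3) ℚ) (P : Polynomial Fun) :
    toFun (MvPolynomial.C r * Q) * P = (r : ℂ) • (toFun Q * P) := by
  rw [map_mul, toFun_C, smul_eq_lift_mul, mul_assoc]

/-- The generating series of level one. -/
theorem exists_level_one_poly (hN : IsSolution G 2 N) (hΦ : SolvesAnomaly G N Φ) :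
    ∀ g ≤ G, ∃ F : MvPolynomial (Fin 3) ℚ, Φ g 1 = toFun F * Polynomial.C thetaFun ∧
      (g ≤ 3 → F = levelOnePoly g) := by
  intro g
  induction g with
  | zero =>
    intro hg
    have hder := derivative_level_one hΦ hg
    rw [if_pos rfl] at hder
    exact ⟨levelOnePoly 0, (level_one_of_particular hN hΦ hg (P := levelOnePoly 0)
      (by rw [hder]; simp [levelOnePoly]) (constPart_levelOnePoly (by norm_num))).2 (by norm_num)
        (aeval_levelOnePoly (by norm_num)), fun _ => rfl⟩
  | succ g ih =>
    intro hg
    obtain ⟨F, hF, hF3⟩ := ih (by omega)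
    have hder := derivative_level_one hΦ hg
    rw [if_neg g.succ_ne_zero, Nat.add_sub_cancel, hF] at hder
    have hC := toFun_C_mul (1 / 12) F (Polynomial.C thetaFun)
    norm_num only [Rat.cast_div, Rat.cast_one, Rat.cast_ofNat] at hC hder
    rw [← hC] at hder
    by_cases h3 : g + 1 ≤ 3
    · have hpd := pderiv_levelOnePoly h3
      rw [← hF3 (by omega)] at hpd
      rw [← hpd] at hder
      exact ⟨levelOnePoly (g + 1), (level_one_of_particular hN hΦ hg hder
        (constPart_levelOnePoly h3)).2 h3 (aeval_levelOnePoly h3), fun _ => rfl⟩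
    -- This antiderivative has vanishing E₂-free part, so the transformation law required of a
    -- particular solution holds trivially.
    · obtain ⟨P, hP, hP0⟩ := exists_antiderivative (MvPolynomial.C (1 / 12) * F)
      rw [← hP] at hder
      obtain ⟨F', hF'⟩ := (level_one_of_particular hN hΦ hg hder fun τ => by
        rw [constPart, constPart, hP0, hP0, mul_zero]).1
      exact ⟨F', hF', fun h => absurd h h3⟩

theorem orbitChar_level_one (hN : IsSolution G 2 N) (hΦ : SolvesAnomaly G N Φ) {g : ℕ}
    (hg : g ≤ G) {F : MvPolynomial (Fin 3) ℚ} (hF : Φ g 1 = toFun F * Polynomial.C thetaFun)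
    (τ : ℍ) : orbitChar N g (e 9) τ = evalAt F τ / etaProd τ ^ 12 := by
  obtain ⟨u, hu⟩ := exists_thetaE8_ne_zero τ
  have h := level_one_eval hN hΦ hg τ u
  rw [hF, Polynomial.eval_mul, Polynomial.eval_C, Pi.mul_apply, Pi.mul_apply, evalAt_eq_eval,
    ← mul_assoc] at h
  rw [mul_right_cancel₀ hu h, div_eq_inv_mul]

end LevelOne

/-! ### Level two: the action of the modular group on the theta functions -/

/-- The transformation laws of a `Triple`. -/
structure TripleLaw (k : ℤ) (a b c : ℍ → ℂ) : Prop where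
  T_fst : ∀ τ, a ((1 : ℝ) +ᵥ τ) = a τ
  T_snd : ∀ τ, b ((1 : ℝ) +ᵥ τ) = c τ
  T_trd : ∀ τ, c ((1 : ℝ) +ᵥ τ) = b τ
  S_fst : ∀ τ : ℍ, a (ModularGroup.S • τ) = (τ : ℂ) ^ k * b τ
  S_snd : ∀ τ : ℍ, b (ModularGroup.S • τ) = (τ : ℂ) ^ k * a τ
  S_trd : ∀ τ : ℍ, c (ModularGroup.S • τ) = (τ : ℂ) ^ k * c τ

theorem TripleLaw.sub {k : ℤ} {a b c a' b' c' : ℍ → ℂ} (h : TripleLaw k a b c)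
    (h' : TripleLaw k a' b' c') : TripleLaw k (a - a') (b - b') (c - c') where
  T_fst τ := by simp only [Pi.sub_apply, h.T_fst, h'.T_fst]
  T_snd τ := by simp only [Pi.sub_apply, h.T_snd, h'.T_snd]
  T_trd τ := by simp only [Pi.sub_apply, h.T_trd, h'.T_trd]
  S_fst τ := by simp only [Pi.sub_apply, h.S_fst, h'.S_fst, mul_sub]
  S_snd τ := by simp only [Pi.sub_apply, h.S_snd, h'.S_snd, mul_sub]
  S_trd τ := by simp only [Pi.sub_apply, h.S_trd, h'.S_trd, mul_sub]

/-- The laws under which `∑ⱼ cⱼ θⱼ` is a Jacobi form. -/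
def ThetaLaw (k : ℤ) (c : Fin 3 → ℍ → ℂ) : Prop :=
  TripleLaw k (c 0 - c 1) ((8 : ℂ) • (c 1 + c 2)) ((8 : ℂ) • (c 1 - c 2))

theorem ThetaLaw.sub {k : ℤ} {c c' : Fin 3 → ℍ → ℂ} (h : ThetaLaw k c) (h' : ThetaLaw k c') :
    ThetaLaw k (c - c') := by
  have := TripleLaw.sub h h'
  rw [ThetaLaw]
  convert this using 1 <;> funext τ <;>
  · simp only [Pi.sub_apply, Pi.smul_apply, Pi.add_apply, smul_eq_mul]
    ring

/-- Change of basis from the theta functions of the types to the three functions that SL₂(ℤ)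
permutes. -/
theorem sum_thetaType (d : Fin 3 → ℂ) (τ : ℍ) (u : E8C) : ∑ j, d j * thetaType j τ u =
    (d 0 - d 1) * thetaType 0 τ u + (d 1 + d 2) / 2 * thetaE8 (τ / 2) u +
      (d 1 - d 2) / 2 * thetaE8 ((τ + 1) / 2) u := by
  rw [Fin.sum_univ_three, thetaE8_half, thetaE8_half_add]; ring

theorem theta_independent {x y z : ℂ} {τ : ℍ} (h : ∀ u, x * thetaType 0 τ u +
    y * thetaE8 (τ / 2) u + z * thetaE8 ((τ + 1) / 2) u = 0) : x = 0 ∧ y = 0 ∧ z = 0 := by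
  have h1 := thetaType_independent (w := ![x + y + z, y + z, y - z]) (τ := τ) fun u => by
    rw [Fin.sum_univ_three, ← h u, thetaE8_half, thetaE8_half_add]
    simp only [Matrix.cons_val]
    ring
  have h2 : x + y + z = 0 := h1 0
  have h3 : y + z = 0 := h1 1
  have h4 : y - z = 0 := h1 2
  refine ⟨?_, ?_, ?_⟩
  · linear_combination h2 - h3
  · linear_combination (h3 + h4) / 2
  · linear_combination (h3 - h4) / 2

/-- The coefficients of a Jacobi form with respect to the theta functions. -/
theorem thetaLaw_of_modularLaw {k : ℤ} {c : Fin 3 → ℍ → ℂ} {f : Fun}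
    (h : ModularLaw (k + 4) 2 f) (hf : ∀ τ u, f τ u = ∑ j, c j τ * thetaType j τ u) :
    ThetaLaw k c := by
  -- Inversion exchanges Θ(τ/2) with 16 θ₀ and fixes Θ((τ+1)/2). The factor 8 in `ThetaLaw` is this
  -- 16 times the 1/2 of the change of basis.
  have hS : ∀ τ : ℍ, _ := fun τ : ℍ => theta_independent (τ := τ)
    (x := 16 * (c 1 (ModularGroup.S • τ) + c 2 (ModularGroup.S • τ)) / 2
      - (τ : ℂ) ^ k * (c 0 τ - c 1 τ))
    (y := (c 0 (ModularGroup.S • τ) - c 1 (ModularGroup.S • τ)) / 16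
      - (τ : ℂ) ^ k * ((c 1 τ + c 2 τ) / 2))
    (z := (c 1 (ModularGroup.S • τ) - c 2 (ModularGroup.S • τ)) / 2
      - (τ : ℂ) ^ k * ((c 1 τ - c 2 τ) / 2)) fun u => by
    have h1 := h.2 τ u
    rw [hf, hf, sum_thetaType, sum_thetaType, thetaE8_half_S, thetaE8_half_add_S] at h1
    have h2 := thetaType_zero_S τ u
    rw [← autFactor, zpow_add₀ (ne_zero τ), zpow_ofNat] at h1
    have h3 := mul_ne_zero (pow_ne_zero 4 (ne_zero τ)) (autFactor_ne_zero τ u)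
    refine (mul_eq_zero.mp ?_).resolve_left h3
    linear_combination h1 - (c 0 (ModularGroup.S • τ) - c 1 (ModularGroup.S • τ)) / 16 * h2
  have hT : ∀ τ : ℍ, _ := fun τ : ℍ => theta_independent (τ := τ)
    (x := c 0 ((1 : ℝ) +ᵥ τ) - c 1 ((1 : ℝ) +ᵥ τ) - (c 0 τ - c 1 τ))
    (y := (c 1 ((1 : ℝ) +ᵥ τ) - c 2 ((1 : ℝ) +ᵥ τ)) / 2 - (c 1 τ + c 2 τ) / 2)
    (z := (c 1 ((1 : ℝ) +ᵥ τ) + c 2 ((1 : ℝ) +ᵥ τ)) / 2 - (c 1 τ - c 2 τ) / 2) fun u => by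
    have h1 := h.1 τ u
    rw [hf, hf, sum_thetaType, sum_thetaType, thetaE8_half_vadd, thetaE8_half_add_vadd,
      thetaType_zero_vadd] at h1
    linear_combination h1
  refine ⟨fun τ => ?_, fun τ => ?_, fun τ => ?_, fun τ => ?_, fun τ => ?_, fun τ => ?_⟩ <;>
    simp only [Pi.sub_apply, Pi.smul_apply, Pi.add_apply, smul_eq_mul]
  · linear_combination (hT τ).1
  · linear_combination 16 * (hT τ).2.2
  · linear_combination 16 * (hT τ).2.1
  · linear_combination 16 * (hS τ).2.1
  · linear_combination (hS τ).1
  · linear_combination 16 * (hS τ).2.2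

/-! ### The shape of the generating series of level two -/

/-- The factors `1`, `G₄`, `G₄^{1/2}`. -/
def weightForm : Fin 3 → ℍ → ℂ := ![1, gFour, gFourSqrt]

/-- The theta function of an orbit, as a function on `ℍ × E₈ ⊗ ℂ`. -/
def thetaTypeFun (j : Fin 3) : Fun := fun τ u => thetaType j τ u

/-- The generating series with orbit characters given by `Q`. -/
def levelTwoSeries (Q : Fin 3 → MvPolynomial (Fin 3) ℚ) : Polynomial Fun :=
  ∑ j, toFun (Q j) * Polynomial.C (lift (weightForm j) * thetaTypeFun j)

theorem derivative_levelTwoSeries (Q : Fin 3 → MvPolynomial (Fin 3) ℚ) :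
    Polynomial.derivative (levelTwoSeries Q) =
      levelTwoSeries fun j => MvPolynomial.pderiv 0 (Q j) := by
  rw [levelTwoSeries, levelTwoSeries, Polynomial.derivative_sum]
  refine Finset.sum_congr rfl fun j _ => ?_
  rw [Polynomial.derivative_mul, Polynomial.derivative_C, mul_zero, add_zero, derivative_toFun]

theorem eval_levelTwoSeries (Q : Fin 3 → MvPolynomial (Fin 3) ℚ) (τ : ℍ) (u : E8C) :
    (levelTwoSeries Q).eval (lift EisensteinSeries.E2) τ u =
      ∑ j, weightForm j τ * evalAt (Q j) τ * thetaType j τ u := by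
  rw [levelTwoSeries, Polynomial.eval_finsetSum, Finset.sum_apply, Finset.sum_apply]
  refine Finset.sum_congr rfl fun j _ => ?_
  rw [Polynomial.eval_mul, Polynomial.eval_C, Pi.mul_apply, Pi.mul_apply, evalAt_eq_eval,
    Pi.mul_apply, Pi.mul_apply, lift, thetaTypeFun]
  ring

theorem coeff_zero_levelTwoSeries (Q : Fin 3 → MvPolynomial (Fin 3) ℚ) (τ : ℍ) (u : E8C) :
    (levelTwoSeries Q).coeff 0 τ u =
      ∑ j, weightForm j τ * constPart (Q j) τ * thetaType j τ u := by
  rw [levelTwoSeries, Polynomial.finsetSum_coeff, Finset.sum_apply, Finset.sum_apply]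
  refine Finset.sum_congr rfl fun j _ => ?_
  rw [Polynomial.coeff_mul_C, Pi.mul_apply, Pi.mul_apply, coeff_zero_toFun, Pi.mul_apply,
    Pi.mul_apply, lift, thetaTypeFun]
  ring

theorem levelTwoSeries_add (P Q : Fin 3 → MvPolynomial (Fin 3) ℚ) :
    levelTwoSeries (P + Q) = levelTwoSeries P + levelTwoSeries Q := by
  simp only [levelTwoSeries, Pi.add_apply, map_add, add_mul, Finset.sum_add_distrib]

theorem levelTwoSeries_C_mul (r : ℚ) (Q : Fin 3 → MvPolynomial (Fin 3) ℚ) :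
    levelTwoSeries (fun j => MvPolynomial.C r * Q j) = (r : ℂ) • levelTwoSeries Q := by
  simp only [levelTwoSeries, toFun_C_mul, Finset.smul_sum]

theorem levelTwoSeries_mul (P : MvPolynomial (Fin 3) ℚ) (Q : Fin 3 → MvPolynomial (Fin 3) ℚ) :
    levelTwoSeries (fun j => P * Q j) = toFun P * levelTwoSeries Q := by
  simp only [levelTwoSeries, map_mul, Finset.mul_sum, mul_assoc]

theorem levelTwoSeries_of_pderiv_eq_zero {Q : Fin 3 → MvPolynomial (Fin 3) ℚ}
    (h : ∀ j, MvPolynomial.pderiv 0 (Q j) = 0) :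
    levelTwoSeries Q = Polynomial.C fun τ u =>
      ∑ j, weightForm j τ * evalAt (Q j) τ * thetaType j τ u := by
  have h1 : Polynomial.derivative (levelTwoSeries Q) = 0 := by
    rw [derivative_levelTwoSeries]
    simp [levelTwoSeries, h]
  rw [Polynomial.eq_C_of_natDegree_eq_zero (Polynomial.derivative_eq_zero.mp h1)]
  congr 1
  funext τ u
  rw [coeff_zero_levelTwoSeries]
  simp only [constPart_of_pderiv_eq_zero (h _)]

/-- The factors in the expansion of the square of the theta function of `E₈`. -/
def squarePoly : Fin 3 → MvPolynomial (Fin 3) ℚ :=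
  ![MvPolynomial.C (1 / 16) * (4 * g2 ^ 2 - 3 * g4), MvPolynomial.C (1 / 16),
    MvPolynomial.C (1 / 16) * g2]

theorem pderiv_squarePoly (j : Fin 3) : MvPolynomial.pderiv 0 (squarePoly j) = 0 := by
  have h1 : MvPolynomial.pderiv 0 g2 = 0 := MvPolynomial.pderiv_X_of_ne (by decide)
  have h2 : MvPolynomial.pderiv 0 g4 = 0 := MvPolynomial.pderiv_X_of_ne (by decide)
  fin_cases j <;>
    simp [squarePoly, Derivation.leibniz_pow, h1, h2, pderiv_ofNat]

theorem thetaCoset_weightVec (j : Fin 3) (τ : ℍ) :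
    thetaCoset (weightVec j) τ = weightForm j τ * evalAt (squarePoly j) τ := by
  obtain ⟨h0, h1, h2⟩ := thetaType_constants τ
  rw [thetaType_zero] at h0 h1 h2
  match j with
  | 0 =>
    simp [squarePoly, weightForm, evalAt, orbitCard] at h0 ⊢
    linear_combination h0
  | 1 =>
    simp [squarePoly, weightForm, evalAt, orbitCard] at h1 ⊢
    linear_combination h1 / 135
  | 2 =>
    simp [squarePoly, weightForm, evalAt, orbitCard] at h2 ⊢
    linear_combination h2

/-- Expresses the quadratic term of the anomaly equation in the basis of the θⱼ, so that the
equation can be compared coefficient by coefficient. -/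
theorem C_thetaFun_mul : Polynomial.C thetaFun * Polynomial.C thetaFun =
    levelTwoSeries squarePoly := by
  rw [levelTwoSeries_of_pderiv_eq_zero pderiv_squarePoly, ← Polynomial.C_mul]
  congr 1
  funext τ u
  rw [Pi.mul_apply, Pi.mul_apply, thetaFun, ← sq, thetaE8_sq]
  simp only [thetaCoset_weightVec]

/-! ### The explicit polynomials -/

/-- The right hand side of the anomaly equation for the orbit characters. -/
def anomalyPoly (F : ℕ → MvPolynomial (Fin 3) ℚ) (g : ℕ) (Q : Fin 3 → MvPolynomial (Fin 3) ℚ)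
    (j : Fin 3) : MvPolynomial (Fin 3) ℚ :=
  MvPolynomial.C (1 / 24) * ((∑ p ∈ Finset.HasAntidiagonal.antidiagonal g, F p.1 * F p.2)
    * squarePoly j) + MvPolynomial.C (1 / 4) * Q j

/-- The explicit polynomials of genus `g`. -/
def explicitFamily (g : Fin 4) (j : Fin 3) : MvPolynomial (Fin 3) ℚ := explicitPoly j g

theorem anomalyPoly_congr {F F' : ℕ → MvPolynomial (Fin 3) ℚ} {g : ℕ} (h : ∀ m ≤ g, F m = F' m)
    (Q : Fin 3 → MvPolynomial (Fin 3) ℚ) : anomalyPoly F g Q = anomalyPoly F' g Q := by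
  funext j
  rw [anomalyPoly, anomalyPoly]
  congr 3
  refine Finset.sum_congr rfl fun p hp => ?_
  have := Finset.HasAntidiagonal.mem_antidiagonal.mp hp
  rw [h p.1 (by omega), h p.2 (by omega)]

theorem antidiagonal_sums (f : ℕ → ℕ → MvPolynomial (Fin 3) ℚ) :
    (∑ p ∈ Finset.HasAntidiagonal.antidiagonal 0, f p.1 p.2 = f 0 0) ∧
    (∑ p ∈ Finset.HasAntidiagonal.antidiagonal 1, f p.1 p.2 = f 0 1 + f 1 0) ∧
    (∑ p ∈ Finset.HasAntidiagonal.antidiagonal 2, f p.1 p.2 = f 0 2 + f 1 1 + f 2 0) ∧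
    (∑ p ∈ Finset.HasAntidiagonal.antidiagonal 3, f p.1 p.2 =
      f 0 3 + f 1 2 + f 2 1 + f 3 0) := by
  refine ⟨?_, ?_, ?_, ?_⟩ <;>
  simp [Finset.Nat.antidiagonal_succ, add_assoc]

theorem pderiv_explicitFamily_zero (j : Fin 3) :
    MvPolynomial.pderiv 0 (explicitFamily 0 j) = anomalyPoly levelOnePoly 0 0 j := by
  have h1 : MvPolynomial.pderiv 0 g2 = 0 := MvPolynomial.pderiv_X_of_ne (by decide)
  have h2 : MvPolynomial.pderiv 0 g4 = 0 := MvPolynomial.pderiv_X_of_ne (by decide)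
  have h3 : MvPolynomial.pderiv 0 x2 = 1 := MvPolynomial.pderiv_X_self 0
  rw [anomalyPoly, (antidiagonal_sums fun a b => levelOnePoly a * levelOnePoly b).1]
  fin_cases j <;>
  · refine MvPolynomial.funext fun x => ?_
    simp only [explicitFamily, explicitPoly, explicitZero, explicitEven, explicitOdd, levelOnePoly,
      squarePoly, map_add, map_sub, MvPolynomial.pderiv_mul, MvPolynomial.pderiv_C,
      Derivation.leibniz_pow, h1, h2, h3, map_mul, map_pow, map_ofNat, MvPolynomial.eval_C,
      MvPolynomial.eval_X, smul_eq_mul, nsmul_eq_mul, map_natCast, map_zero, map_one,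
      pderiv_ofNat, Matrix.cons_val, Fin.zero_eta, Fin.mk_one, Fin.reduceFinMk, Pi.zero_apply]
    push_cast
    ring

theorem pderiv_explicitFamily_succ (g : Fin 3) (j : Fin 3) :
    MvPolynomial.pderiv 0 (explicitFamily g.succ j) =
      anomalyPoly levelOnePoly (g + 1) (explicitFamily g.castSucc) j := by
  have h1 : MvPolynomial.pderiv 0 g2 = 0 := MvPolynomial.pderiv_X_of_ne (by decide)
  have h2 : MvPolynomial.pderiv 0 g4 = 0 := MvPolynomial.pderiv_X_of_ne (by decide)
  have h3 : MvPolynomial.pderiv 0 x2 = 1 := MvPolynomial.pderiv_X_self 0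
  obtain ⟨-, s1, s2, s3⟩ := antidiagonal_sums fun a b => levelOnePoly a * levelOnePoly b
  rw [anomalyPoly]
  fin_cases g <;> fin_cases j <;>
  · refine MvPolynomial.funext fun x => ?_
    simp only [Fin.zero_eta, Fin.mk_one, Fin.reduceFinMk,
      zero_add, Nat.reduceAdd, s1, s2, s3]
    simp only [explicitFamily, explicitPoly, explicitZero, explicitEven, explicitOdd, levelOnePoly,
      squarePoly, map_add, map_sub, MvPolynomial.pderiv_mul, MvPolynomial.pderiv_C,
      Derivation.leibniz_pow, h1, h2, h3, map_mul, map_pow, map_ofNat, MvPolynomial.eval_C,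
      MvPolynomial.eval_X, smul_eq_mul, nsmul_eq_mul, map_natCast, map_zero, map_one,
      pderiv_ofNat, Matrix.cons_val, Fin.reduceSucc, Fin.reduceCastSucc, Fin.succ_zero_eq_one,
      Fin.succ_one_eq_two, Fin.castSucc_zero, Fin.castSucc_one]
    push_cast
    ring

/-- After substitution of the transforms of G₂ and G₄^{1/2}, each law is a polynomial identity in
these two functions and τ. -/
theorem thetaLaw_explicitFamily (g : Fin 4) :
    ThetaLaw (2 * g + 6) fun j τ => weightForm j τ * constPart (explicitFamily g j) τ := by
  have h0 : ((2 * g + 6 : ℕ) : ℤ) = 2 * ((g : ℕ) : ℤ) + 6 := by push_cast; rfl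
  rw [ThetaLaw, ← h0]
  fin_cases g <;> refine ⟨?_, ?_, ?_, ?_, ?_, ?_⟩ <;> intro τ <;>
  · simp only [Pi.sub_apply, Pi.smul_apply, Pi.add_apply, smul_eq_mul, zpow_natCast,
      constPart, explicitFamily, explicitPoly, explicitZero, explicitEven, explicitOdd, weightForm,
      map_add, map_sub, map_mul, map_pow, map_ofNat, MvPolynomial.algHom_C,
      MvPolynomial.aeval_X, gTwo_S, gFour_eq, gFourSqrt_S_smul, gTwo_vadd_one,
      gFourSqrt_vadd_one, Matrix.cons_val, Pi.one_apply, eq_ratCast, Rat.cast_div,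
      Rat.cast_one, Rat.cast_ofNat, Rat.cast_pow, Rat.cast_mul, Fin.zero_eta, Fin.mk_one,
      Fin.reduceFinMk]
    ring

/-- These are the leading coefficients dictated by the vanishing conditions: the double cover of e₉
for 2λ₀, the value -2 = N₀(λ₁) for λ₁, and zero for λ₇, whose normalised character starts at q^{3/2}
while G₄^{1/2} starts at q^{1/2}. The factor 256 is the leading coefficient of G₄. -/
theorem aeval_explicitFamily (g : Fin 4) :
    MvPolynomial.aeval ![(1 : ℚ), 2, 0] (explicitFamily g 0) =
      2 ^ (2 * ((g : ℕ) : ℤ) - 3) * gvC 0 g ∧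
    256 * MvPolynomial.aeval ![(1 : ℚ), 2, 0] (explicitFamily g 1) = -2 * gvC 0 g ∧
    MvPolynomial.aeval ![(1 : ℚ), 2, 0] (explicitFamily g 2) = 0 := by
  obtain ⟨h0, h1, h2, h3⟩ := gvC_values
  fin_cases g <;> refine ⟨?_, ?_, ?_⟩ <;>
  · simp only [explicitFamily, explicitPoly, explicitZero, explicitEven, explicitOdd, map_add,
      map_sub, map_mul, map_pow, map_ofNat, MvPolynomial.algHom_C, MvPolynomial.aeval_X,
      Matrix.cons_val, h0, h1, h2, h3, Algebra.algebraMap_self_apply, Fin.zero_eta, Fin.mk_one,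
      Fin.reduceFinMk]
    norm_num

/-! ### Level two -/

/-- The orbit characters of level two, normalised by the norm of the weight. -/
def shiftedChar (N : ℕ → H2 → ℚ) (g : ℕ) (j : Fin 3) (τ : ℍ) : ℂ :=
  orbitChar N g (levelTwoWeight j) τ * Complex.exp (-(Real.pi * Complex.I * weightNorm j * τ))

section LevelTwo

variable {G : ℕ} {N : ℕ → H2 → ℚ} {Φ : ℕ → ℕ → Polynomial Fun}

theorem level_two_eval (hN : IsSolution G 2 N) (hΦ : SolvesAnomaly G N Φ) {g : ℕ} (hg : g ≤ G)
    (τ : ℍ) (u : E8C) : ∑ j, shiftedChar N g j τ * thetaType j τ u =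
      (etaProd τ ^ 24)⁻¹ * (Φ g 2).eval (lift EisensteinSeries.E2) τ u := by
  have h := (hΦ g hg 2 one_le_two le_rfl).2.1 τ u
  have h1 := qPow_div_eta (n := 2) τ
  rw [h1] at h
  exact ((level_two_decomposition (hN.weyl_inv g hg) h).2).symm

theorem summable_level_two (hN : IsSolution G 2 N) (hΦ : SolvesAnomaly G N Φ) {g : ℕ}
    (hg : g ≤ G) (j : Fin 3) (τ : ℍ) : Summable (orbitTerm N g (levelTwoWeight j) τ) :=
  (level_two_decomposition (hN.weyl_inv g hg) ((hΦ g hg 2 one_le_two le_rfl).2.1 τ 0)).1 j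

/-- The only splitting of level 2 is 1 + 1, so the quadratic term is a polynomial times Θ², which is
expanded in the θⱼ. The linear coefficient is 2 · 3/24 = 1/4. -/
theorem derivative_level_two (hΦ : SolvesAnomaly G N Φ) {g : ℕ} (hg : g ≤ G)
    {F : ℕ → MvPolynomial (Fin 3) ℚ}
    (hF : ∀ m ≤ G, Φ m 1 = toFun (F m) * Polynomial.C thetaFun)
    {Q : Fin 3 → MvPolynomial (Fin 3) ℚ} (hQ0 : g = 0 → Q = 0)
    (hQ : g ≠ 0 → Φ (g - 1) 2 = levelTwoSeries Q) :
    Polynomial.derivative (Φ g 2) = levelTwoSeries (anomalyPoly F g Q) := by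
  rw [(hΦ g hg 2 one_le_two le_rfl).2.2]
  have hsplit : anomalyPoly F g Q = (fun j => MvPolynomial.C (1 / 24) *
      ((∑ p ∈ Finset.HasAntidiagonal.antidiagonal g, F p.1 * F p.2) * squarePoly j)) +
      fun j => MvPolynomial.C (1 / 4) * Q j := rfl
  rw [hsplit, levelTwoSeries_add, levelTwoSeries_C_mul, levelTwoSeries_C_mul, levelTwoSeries_mul,
    ← C_thetaFun_mul]
  congr 1
  · rw [map_sum, Finset.sum_mul, Finset.smul_sum]
    refine Finset.sum_congr rfl fun p hp => ?_
    have := Finset.HasAntidiagonal.mem_antidiagonal.mp hp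
    rw [show Finset.Ico 1 2 = {1} from rfl, Finset.sum_singleton, hF p.1 (by omega),
      show 2 - 1 = 1 from rfl, hF p.2 (by omega), map_mul]
    norm_num only [Nat.cast_one, Rat.cast_div, Rat.cast_one, Rat.cast_ofNat]
    congr 1
    ring
  · split_ifs with h0
    · rw [hQ0 h0]
      simp [levelTwoSeries]
    · rw [hQ h0]
      congr 1
      norm_num

/-- The difference between the orbit characters and a particular solution of the anomaly
equation. -/
def defect (N : ℕ → H2 → ℚ) (g : ℕ) (P : Fin 3 → MvPolynomial (Fin 3) ℚ) (j : Fin 3) : ℍ → ℂ :=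
  etaProd ^ 24 * shiftedChar N g j - weightForm j * evalAt (P j)

/-- The difference from the particular solution is free of E₂. Subtracting the modular E₂-free part
of the particular solution from that of Φ leaves a Jacobi form of weight 2g + 10, and the theta
functions account for 4 of this weight. -/
theorem level_two_step (hN : IsSolution G 2 N) (hΦ : SolvesAnomaly G N Φ) {g : ℕ} (hg : g ≤ G)
    {P : Fin 3 → MvPolynomial (Fin 3) ℚ}
    (hder : Polynomial.derivative (Φ g 2) =
      levelTwoSeries fun j => MvPolynomial.pderiv 0 (P j))
    (hP : ThetaLaw (2 * g + 6) fun j τ => weightForm j τ * constPart (P j) τ) :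
    (Φ g 2 = levelTwoSeries P +
      Polynomial.C fun τ u => ∑ j, defect N g P j τ * thetaType j τ u) ∧
    ThetaLaw (2 * g + 6) (defect N g P) := by
  obtain ⟨ψ, hψ⟩ : ∃ ψ, Φ g 2 = levelTwoSeries P + Polynomial.C ψ :=
    ⟨_, eq_add_C_of_derivative_eq (by rw [hder, derivative_levelTwoSeries])⟩
  have h1 : ψ = fun τ u => ∑ j, defect N g P j τ * thetaType j τ u := by
    funext τ u
    have h2 := level_two_eval hN hΦ hg τ u
    rw [hψ, Polynomial.eval_add, Polynomial.eval_C, Pi.add_apply, Pi.add_apply,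
      eval_levelTwoSeries,
      eq_inv_mul_iff_mul_eq₀ (pow_ne_zero _ (etaProd_ne_zero τ))] at h2
    simp only [defect, Pi.sub_apply, Pi.mul_apply, Pi.pow_apply, sub_mul, Finset.sum_sub_distrib,
      mul_assoc, ← Finset.mul_sum] at h2 ⊢
    linear_combination -h2
  refine ⟨h1 ▸ hψ, ?_⟩
  have hmod := (hΦ g hg 2 one_le_two le_rfl).1 0
  rw [show (2 * g + 6 * (2 : ℕ) - 2 - 2 * (0 : ℕ) : ℤ) = 2 * g + 6 + 4 by push_cast; ring] at hmod
  have h3 := (thetaLaw_of_modularLaw (c := fun j τ => weightForm j τ * constPart (P j) τ +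
    defect N g P j τ) hmod fun τ u => by
      rw [hψ, h1, Polynomial.coeff_add, Polynomial.coeff_C_zero, Pi.add_apply, Pi.add_apply,
        coeff_zero_levelTwoSeries, ← Finset.sum_add_distrib]
      exact Finset.sum_congr rfl fun j _ => (add_mul _ _ _).symm).sub hP
  convert h3 using 1
  funext j τ
  simp

/-! ### Expansions -/

/-- The class λⱼ + aF has q-exponent 2 + a, that is, 4 + 2a in powers of q^{1/2}. The normalisation
subtracts the half norm of the weight. -/
theorem exists_hasRatExp_shiftedChar (hN : IsSolution G 2 N) (hΦ : SolvesAnomaly G N Φ) {g : ℕ}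
    (hg : g ≤ G) (j : Fin 3) (b : ℤ) (s : ℕ) (hs : (s : ℤ) = 4 + 2 * b - weightNorm j)
    (hc : ∀ a < b, N g (levelTwoWeight j + a • fib) = 0) :
    ∃ p, HasRatExp (PowerSeries.X ^ s * p) (shiftedChar N g j) ∧
      PowerSeries.constantCoeff p = N g (levelTwoWeight j + b • fib) := by
  refine exists_hasRatExp_of_hasSum_int (c := fun a => N g (levelTwoWeight j + a • fib))
    (t := fun a τ => Complex.exp (2 * Real.pi * Complex.I * ((2 + a) * τ)) *
      Complex.exp (-(Real.pi * Complex.I * weightNorm j * τ))) b s hc (fun n τ => ?_) fun τ => ?_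
  · rw [← Complex.exp_add, nome, ← Complex.exp_nat_mul]
    congr 1
    have : (s : ℂ) = 4 + 2 * b - weightNorm j := by exact_mod_cast congrArg (Int.cast (R := ℂ)) hs
    push_cast
    rw [this]
    ring
  · refine ((summable_level_two hN hΦ hg j τ).hasSum.mul_right _).congr_fun fun a => ?_
    rw [orbitTerm_levelTwoWeight]
    exact (mul_assoc _ _ _).symm

/-- The characters start at a = -2 for 2λ₀, where the class is 2e₉, and at a = 0 for λ₁ and λ₇. In
powers of q^{1/2} the leading exponents are 0, 2 and 3, against 0, 2 and 1 for the forms 1, G₄ and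
G₄^{1/2}. -/
theorem exists_hasRatExp_defect (hN : IsSolution G 2 N) (hΦ : SolvesAnomaly G N Φ) {g : ℕ}
    (hg : g ≤ G) (P : Fin 3 → MvPolynomial (Fin 3) ℚ) :
    (∃ p, HasRatExp p (defect N g P 0) ∧ PowerSeries.constantCoeff p =
      2 ^ (2 * (g : ℤ) - 3) * gvC 0 g - MvPolynomial.aeval ![(1 : ℚ), 2, 0] (P 0)) ∧
    (∃ p, HasRatExp (PowerSeries.X ^ 2 * p) (defect N g P 1) ∧ PowerSeries.constantCoeff p =
      gvC 0 g * N 0 (levelTwoWeight 1) - 256 * MvPolynomial.aeval ![(1 : ℚ), 2, 0] (P 1)) ∧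
    (∃ p, HasRatExp (PowerSeries.X ^ 1 * p) (defect N g P 2) ∧ PowerSeries.constantCoeff p =
      -(16 * MvPolynomial.aeval ![(1 : ℚ), 2, 0] (P 2))) := by
  obtain ⟨nb, hb, hv⟩ := hN.vanishing
  obtain ⟨r, hr, hr1⟩ := exists_hasRatExp_etaProd hN hΦ
  have hr2 := hr.pow 2
  rw [← pow_mul] at hr2
  refine ⟨?_, ?_, ?_⟩
  · obtain ⟨p, hp, hpc⟩ := exists_hasRatExp_shiftedChar hN hΦ hg 0 (-2) 0 (by decide)
      fun a ha => N_weight_zero_neg hb hv hg ha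
    obtain ⟨s, hs, hsc⟩ := exists_hasRatExp_evalAt (P 0)
    have h : HasRatExp (r ^ 2 * (PowerSeries.X ^ 0 * p) - 1 * s) (defect N g P 0) :=
      (hr2.mul hp).sub (HasRatExp.mul (by
        have := HasRatExp.const 1
        rw [map_one, Rat.cast_one] at this
        exact this) hs)
    refine ⟨_, h, ?_⟩
    rw [N_weight_zero_first hb hv hg, N_zero_e_nine hN hΦ] at hpc
    simp [hr1, hpc, hsc]
  · obtain ⟨p, hp, hpc⟩ := exists_hasRatExp_shiftedChar hN hΦ hg 1 0 2 (by decide)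
      fun a ha => N_weight_neg hb hv hg (by decide) ha
    obtain ⟨s, hs, hsc⟩ := exists_hasRatExp_evalAt (P 1)
    obtain ⟨t, ht, htc⟩ := exists_hasRatExp_gFour
    have h : HasRatExp (r ^ 2 * (PowerSeries.X ^ 2 * p) - PowerSeries.X ^ 2 * t * s)
        (defect N g P 1) := (hr2.mul hp).sub (ht.mul hs)
    rw [show r ^ 2 * (PowerSeries.X ^ 2 * p) - PowerSeries.X ^ 2 * t * s =
      PowerSeries.X ^ 2 * (r ^ 2 * p - t * s) by ring] at h
    refine ⟨_, h, ?_⟩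
    rw [zero_smul, add_zero, N_weight_one hb hv hg] at hpc
    simp [hr1, hpc, hsc, htc]
  · obtain ⟨p, hp, hpc⟩ := exists_hasRatExp_shiftedChar hN hΦ hg 2 0 3 (by decide)
      fun a ha => N_weight_neg hb hv hg (by decide) ha
    obtain ⟨s, hs, hsc⟩ := exists_hasRatExp_evalAt (P 2)
    obtain ⟨t, ht, htc⟩ := exists_hasRatExp_gFourSqrt
    have h : HasRatExp (r ^ 2 * (PowerSeries.X ^ 3 * p) - PowerSeries.X * t * s)
        (defect N g P 2) := (hr2.mul hp).sub (ht.mul hs)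
    rw [show r ^ 2 * (PowerSeries.X ^ 3 * p) - PowerSeries.X * t * s =
      PowerSeries.X ^ 1 * (PowerSeries.X ^ 2 * r ^ 2 * p - t * s) by ring] at h
    refine ⟨_, h, ?_⟩
    simp [hsc, htc]

end LevelTwo

/-! ### Coefficients of Jacobi forms -/

theorem ThetaLaw.triple {k : ℤ} {c : Fin 3 → ℍ → ℂ} (h : ThetaLaw k c)
    {p : Fin 3 → PowerSeries ℂ} (hp : ∀ j, HasExp (p j) (c j)) :
    Triple k (c 0 - c 1) ((8 : ℂ) • (c 1 + c 2)) ((8 : ℂ) • (c 1 - c 2)) :=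
  ⟨h.T_fst, h.T_snd, h.T_trd, h.S_fst, h.S_snd, h.S_trd, ⟨_, (hp 0).sub (hp 1)⟩,
    ⟨_, ((hp 1).add (hp 2)).const_mul 8⟩⟩

theorem ThetaLaw.vadd_one {k : ℤ} {c : Fin 3 → ℍ → ℂ} (h : ThetaLaw k c) (τ : ℍ) :
    c 0 ((1 : ℝ) +ᵥ τ) = c 0 τ ∧ c 1 ((1 : ℝ) +ᵥ τ) = c 1 τ ∧ c 2 ((1 : ℝ) +ᵥ τ) = -c 2 τ := by
  have h1 := h.T_fst τ
  have h2 := h.T_snd τ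
  have h3 := h.T_trd τ
  simp only [Pi.sub_apply, Pi.smul_apply, Pi.add_apply, smul_eq_mul] at h1 h2 h3
  refine ⟨?_, ?_, ?_⟩
  · linear_combination h1 + (h2 + h3) / 16
  · linear_combination (h2 + h3) / 16
  · linear_combination (h2 - h3) / 16

/-- The coefficients of a Jacobi form are polynomials in `G₂` and `G₄`, up to `1`, `G₄` and
`G₄^{1/2}`. -/
theorem ThetaLaw.exists_polynomials {n : ℕ} {c : Fin 3 → ℍ → ℂ} (h : ThetaLaw (2 * n) c)
    {p : Fin 3 → PowerSeries ℚ} (hp : ∀ j, HasRatExp (p j) (c j))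
    (h1 : PowerSeries.constantCoeff (p 1) = 0) :
    ∃ A : Fin 3 → MvPolynomial (Fin 3) ℚ, (∀ j, MvPolynomial.pderiv 0 (A j) = 0) ∧
      ∀ j τ, c j τ = weightForm j τ * evalAt (A j) τ := by
  obtain ⟨κ, A, E, O, hA, hE, hO, ha, hb, hc⟩ :=
    (h.triple hp).exists_polynomials ((hp 0).sub (hp 1))
  simp only [Pi.sub_apply, Pi.smul_apply, Pi.add_apply, smul_eq_mul] at ha hb hc
  obtain ⟨x, hx, hx2⟩ := exists_hasRatExp_gTwo
  obtain ⟨y, hy, -⟩ := exists_hasRatExp_gFour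
  obtain ⟨z, hz, -⟩ := exists_hasRatExp_evalAt E
  -- The mean of the two conjugates is 8 c₁, with zero constant term, whereas κ G₂ⁿ contributes κ
  -- 2ⁿ. This is what makes c₁ divisible by G₄.
  have hκ : κ = 0 := by
    have e1 : HasRatExp (PowerSeries.C 8 * p 1) (fun τ => 8 * c 1 τ) := by
      have := (HasRatExp.const 8).mul (hp 1)
      rw [Rat.cast_ofNat] at this
      exact this
    have e2 := (((HasRatExp.const κ).mul (hx.pow n)).add (hy.mul hz))
    have he : (fun _ => (κ : ℂ)) * gTwo ^ n + gFour * evalAt E = fun τ => 8 * c 1 τ :=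
      funext fun τ => by
        simp only [Pi.add_apply, Pi.mul_apply, Pi.pow_apply]
        linear_combination -(hb τ + hc τ) / 2
    rw [he] at e2
    have e3 := congrArg PowerSeries.constantCoeff
      (HasRatExp.map_injective (HasExp.unique e1 e2))
    simpa [h1, hx2] using e3
  subst hκ
  refine ⟨![A + MvPolynomial.C (1 / 8) * g4 * E, MvPolynomial.C (1 / 8) * E,
    MvPolynomial.C (1 / 8) * O], fun j => ?_, fun j τ => ?_⟩
  · have h2 : MvPolynomial.pderiv 0 g4 = 0 := MvPolynomial.pderiv_X_of_ne (by decide)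
    match j with
    | 0 => simp [hA, hE, h2]
    | 1 => simp [hE]
    | 2 => simp [hO]
  · have h8 : ∀ Q : MvPolynomial (Fin 3) ℚ,
        evalAt (MvPolynomial.C (1 / 8) * Q) τ = evalAt Q τ / 8 := fun Q => by
      rw [evalAt, map_mul, MvPolynomial.algHom_C, eq_ratCast]
      push_cast
      rw [← evalAt]
      ring
    have h9 : evalAt (g4 * E) τ = gFour τ * evalAt E τ := by
      rw [evalAt, map_mul, MvPolynomial.aeval_X]; rfl
    have h10 : evalAt (A + MvPolynomial.C (1 / 8) * (g4 * E)) τ =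
        evalAt A τ + evalAt (MvPolynomial.C (1 / 8) * (g4 * E)) τ := map_add _ _ _
    have ha := ha τ
    have hb := hb τ
    have hc := hc τ
    rw [Rat.cast_zero, zero_mul, zero_add] at hb hc
    match j with
    | 0 =>
      simp only [weightForm, Matrix.cons_val, Pi.one_apply]
      rw [mul_assoc, h10, h8, h9]
      linear_combination ha + (hb + hc) / 16
    | 1 =>
      simp only [weightForm, Matrix.cons_val]
      rw [h8]
      linear_combination (hb + hc) / 16
    | 2 =>
      simp only [weightForm, Matrix.cons_val]
      rw [h8]
      linear_combination (hb - hc) / 16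

/-- A Jacobi form whose coefficients vanish to high order is zero. -/
theorem ThetaLaw.eq_zero {k : ℤ} {c : Fin 3 → ℍ → ℂ} (h : ThetaLaw k c)
    {p0 p1 p2 : PowerSeries ℚ} (h0 : HasRatExp p0 (c 0))
    (h1 : HasRatExp (PowerSeries.X ^ 2 * p1) (c 1))
    (h2 : HasRatExp (PowerSeries.X ^ 1 * p2) (c 2)) (c0 : PowerSeries.constantCoeff p0 = 0)
    (c2 : PowerSeries.constantCoeff p2 = 0)
    (hk : k < 12 ∨ PowerSeries.constantCoeff p1 = 0 ∧ k < 16) : c = 0 := by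
  have ht := h.triple (p := fun j => ![p0, PowerSeries.X ^ 2 * p1,
    PowerSeries.X ^ 1 * p2] j |>.map (algebraMap ℚ ℂ)) fun j => by
      match j with
      | 0 => exact h0
      | 1 => exact h1
      | 2 => exact h2
  have e1 := h1
  rw [HasRatExp, map_mul, map_pow, PowerSeries.map_X] at e1
  obtain ⟨a, ha⟩ := X_sq_dvd (HasExp.sub h0 h1) ht.T_fst (by
    rw [map_sub, constantCoeff_map, constantCoeff_map, c0]; simp)
  have hA := HasExp.sub h0 h1
  rw [ha] at hA
  -- Translation changes the sign of c₂, so only odd powers of q^{1/2} occur. With the first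
  -- coefficient gone, the order is at least 3.
  obtain ⟨b, hb⟩ : ∃ b, (PowerSeries.X ^ 1 * p2).map (algebraMap ℚ ℂ) = PowerSeries.X ^ 3 * b := by
    refine PowerSeries.X_pow_dvd_iff.mpr fun m hm => ?_
    interval_cases m
    · exact HasExp.coeff_eq_zero_of_odd h2 (fun τ => (h.vadd_one τ).2.2) (by decide)
    · rw [PowerSeries.coeff_map]
      have := PowerSeries.coeff_X_pow_mul p2 1 0
      rw [zero_add] at this
      rw [this, PowerSeries.coeff_zero_eq_constantCoeff_apply, c2, map_zero]
    · exact HasExp.coeff_eq_zero_of_odd h2 (fun τ => (h.vadd_one τ).2.2) (by decide)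
  have hB : HasExp (PowerSeries.X ^ 3 * b) (c 2) := hb ▸ h2
  have key : c 0 - c 1 = 0 := by
    -- The orders are (2, 2, 2), so the product vanishes to order 3 in q and k < 12 suffices. If the
    -- leading coefficient of c₁ vanishes too, they are (2, 3, 3), giving order 4 and k < 16.
    rcases hk with hk | ⟨c1, hk⟩
    · have hs := ((e1.add hB).const_mul 8)
      have hs' := ((e1.sub hB).const_mul 8)
      rw [show (8 : ℂ) • (PowerSeries.X ^ 2 * p1.map (algebraMap ℚ ℂ) + PowerSeries.X ^ 3 * b) =
        PowerSeries.X ^ 2 * ((8 : ℂ) • (p1.map (algebraMap ℚ ℂ) + PowerSeries.X * b)) by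
          rw [mul_smul_comm]; ring_nf] at hs
      rw [show (8 : ℂ) • (PowerSeries.X ^ 2 * p1.map (algebraMap ℚ ℂ) - PowerSeries.X ^ 3 * b) =
        PowerSeries.X ^ 2 * ((8 : ℂ) • (p1.map (algebraMap ℚ ℂ) - PowerSeries.X * b)) by
          rw [mul_smul_comm]; ring_nf] at hs'
      exact ht.eq_zero_of_order (m := 3) hA hs hs' (by norm_num) (by push_cast; omega)
    · obtain ⟨v, rfl⟩ := PowerSeries.X_dvd_iff.mpr c1
      rw [map_mul, PowerSeries.map_X] at e1
      have hs := ((e1.add hB).const_mul 8)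
      have hs' := ((e1.sub hB).const_mul 8)
      rw [show (8 : ℂ) • (PowerSeries.X ^ 2 * (PowerSeries.X * v.map (algebraMap ℚ ℂ)) +
          PowerSeries.X ^ 3 * b) =
        PowerSeries.X ^ 3 * ((8 : ℂ) • (v.map (algebraMap ℚ ℂ) + b)) by
          rw [mul_smul_comm]; ring_nf] at hs
      rw [show (8 : ℂ) • (PowerSeries.X ^ 2 * (PowerSeries.X * v.map (algebraMap ℚ ℂ)) -
          PowerSeries.X ^ 3 * b) =
        PowerSeries.X ^ 3 * ((8 : ℂ) • (v.map (algebraMap ℚ ℂ) - b)) by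
          rw [mul_smul_comm]; ring_nf] at hs'
      exact ht.eq_zero_of_order (m := 4) hA hs hs' (by norm_num) (by push_cast; omega)
  obtain ⟨hb0, hc0⟩ := ht.eq_zero_of_fst key
  funext j τ
  have k0 := congrFun key τ
  have k1 := congrFun hb0 τ
  have k2 := congrFun hc0 τ
  simp only [Pi.sub_apply, Pi.smul_apply, Pi.add_apply, smul_eq_mul, Pi.zero_apply] at k0 k1 k2
  match j with
  | 0 => rw [Pi.zero_apply, Pi.zero_apply]; linear_combination k0 + (k1 + k2) / 16
  | 1 => rw [Pi.zero_apply, Pi.zero_apply]; linear_combination (k1 + k2) / 16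
  | 2 => rw [Pi.zero_apply, Pi.zero_apply]; linear_combination (k1 - k2) / 16

/-! ### The recursion in level two -/

section LevelTwo

variable {G : ℕ} {N : ℕ → H2 → ℚ} {Φ : ℕ → ℕ → Polynomial Fun}

/-- The general case of the recursion for the generating series of level two. -/
theorem level_two_general (hN : IsSolution G 2 N) (hΦ : SolvesAnomaly G N Φ) {g : ℕ} (hg : g ≤ G)
    {R : Fin 3 → MvPolynomial (Fin 3) ℚ}
    (hder : Polynomial.derivative (Φ g 2) = levelTwoSeries R) :
    ∃ Q, Φ g 2 = levelTwoSeries Q := by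
  choose P hP hP0 using fun j => exists_antiderivative (R j)
  have hzero : ∀ j τ, constPart (P j) τ = 0 := fun j τ => hP0 j _ _
  obtain ⟨hΨ, hlaw⟩ := level_two_step hN hΦ hg (P := P) (by rw [hder]; simp only [hP]) (by
    simp only [hzero, mul_zero]
    refine ⟨?_, ?_, ?_, ?_, ?_, ?_⟩ <;> intro τ <;> simp)
  obtain ⟨⟨p0, h0, -⟩, ⟨p1, h1, -⟩, ⟨p2, h2, -⟩⟩ := exists_hasRatExp_defect hN hΦ hg P
  have hlaw' : ThetaLaw (2 * ((g + 3 : ℕ) : ℤ)) (defect N g P) := by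
    rwa [show (2 * ((g + 3 : ℕ) : ℤ)) = 2 * g + 6 by push_cast; ring]
  obtain ⟨A, hA, hA'⟩ := hlaw'.exists_polynomials
    (p := ![p0, PowerSeries.X ^ 2 * p1, PowerSeries.X ^ 1 * p2]) (fun j => by
      match j with
      | 0 => exact h0
      | 1 => exact h1
      | 2 => exact h2) (by simp)
  refine ⟨P + A, ?_⟩
  rw [hΨ, levelTwoSeries_add, levelTwoSeries_of_pderiv_eq_zero hA]
  simp only [hA']

/-- In genus at most three the generating series is given by the explicit polynomials. -/
theorem level_two_explicit (hN : IsSolution G 2 N) (hΦ : SolvesAnomaly G N Φ) {g : ℕ} (hg : g ≤ G)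
    {i : Fin 4} (hi : g = i)
    (hder : Polynomial.derivative (Φ g 2) =
      levelTwoSeries fun j => MvPolynomial.pderiv 0 (explicitFamily i j))
    (h1 : g = 0 ∨ N 0 (levelTwoWeight 1) = -2) :
    Φ g 2 = levelTwoSeries (explicitFamily i) ∧ defect N g (explicitFamily i) = 0 := by
  subst hi
  obtain ⟨hΨ, hlaw⟩ := level_two_step hN hΦ hg hder (thetaLaw_explicitFamily i)
  obtain ⟨⟨p0, e0, c0⟩, ⟨p1, e1, c1⟩, ⟨p2, e2, c2⟩⟩ :=
    exists_hasRatExp_defect hN hΦ hg (explicitFamily i)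
  obtain ⟨a0, a1, a2⟩ := aeval_explicitFamily i
  have hz : defect N i (explicitFamily i) = 0 := by
    refine hlaw.eq_zero e0 e1 e2 (by rw [c0, a0, sub_self]) (by rw [c2, a2]; simp) ?_
    -- The weight is 2g + 6. For g = 0 it is 6 and nothing need be known about N₀(λ₁). Otherwise the
    -- value -2 cancels the leading coefficient of c₁, which allows weights up to 12.
    rcases h1 with h1 | h1
    · left; omega
    · right
      refine ⟨by rw [c1, a1, h1]; ring, by omega⟩
  refine ⟨?_, hz⟩
  rw [hΨ, hz]
  have : (fun (τ : ℍ) (u : E8C) => ∑ j, (0 : Fin 3 → ℍ → ℂ) j τ * thetaType j τ u) = 0 := by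
    funext τ u
    simp
  rw [this, Polynomial.C_0, add_zero]

end LevelTwo

section LevelTwo

variable {G : ℕ} {N : ℕ → H2 → ℚ} {Φ : ℕ → ℕ → Polynomial Fun} {F : ℕ → MvPolynomial (Fin 3) ℚ}

theorem derivative_level_two_zero (hΦ : SolvesAnomaly G N Φ)
    (hF : ∀ m ≤ G, Φ m 1 = toFun (F m) * Polynomial.C thetaFun)
    (hF3 : ∀ m ≤ G, m ≤ 3 → F m = levelOnePoly m) :
    Polynomial.derivative (Φ 0 2) =
      levelTwoSeries fun j => MvPolynomial.pderiv 0 (explicitFamily 0 j) := by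
  rw [derivative_level_two hΦ (Nat.zero_le G) hF (Q := 0) (fun _ => rfl) fun h => absurd rfl h,
    anomalyPoly_congr fun m hm => hF3 m (by omega) (by omega)]
  simp only [pderiv_explicitFamily_zero]

/-- In genus 0 the defect vanishes without knowledge of this number. Its leading coefficient for λ₁
is N₀(λ₁) + 2. -/
theorem N_zero_weight_one (hN : IsSolution G 2 N) (hΦ : SolvesAnomaly G N Φ)
    (hF : ∀ m ≤ G, Φ m 1 = toFun (F m) * Polynomial.C thetaFun)
    (hF3 : ∀ m ≤ G, m ≤ 3 → F m = levelOnePoly m) : N 0 (levelTwoWeight 1) = -2 := by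
  obtain ⟨-, h0⟩ := level_two_explicit hN hΦ (Nat.zero_le G) (i := 0) rfl
    (derivative_level_two_zero hΦ hF hF3) (Or.inl rfl)
  obtain ⟨-, ⟨p, hp, hc⟩, -⟩ := exists_hasRatExp_defect hN hΦ (Nat.zero_le G) (explicitFamily 0)
  rw [h0] at hp
  have h1 := HasExp.unique hp HasExp.zero
  rw [map_eq_zero_iff _ HasRatExp.map_injective, mul_eq_zero] at h1
  have h2 := h1.resolve_left (pow_ne_zero _ PowerSeries.X_ne_zero)
  have h3 : 256 * _ = -2 * gvC 0 0 := (aeval_explicitFamily 0).2.1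
  rw [h2, h3, gvC_zero_right] at hc
  rw [map_zero] at hc
  linarith

theorem exists_level_two_poly (hN : IsSolution G 2 N) (hΦ : SolvesAnomaly G N Φ)
    (hF : ∀ m ≤ G, Φ m 1 = toFun (F m) * Polynomial.C thetaFun)
    (hF3 : ∀ m ≤ G, m ≤ 3 → F m = levelOnePoly m) :
    ∀ g ≤ G, ∃ Q, Φ g 2 = levelTwoSeries Q ∧ ∀ i : Fin 4, g = i → Q = explicitFamily i := by
  intro g
  induction g with
  | zero =>
    intro hg
    refine ⟨explicitFamily 0, (level_two_explicit hN hΦ hg rfl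
      (derivative_level_two_zero hΦ hF hF3) (Or.inl rfl)).1, fun i hi => ?_⟩
    rw [show i = 0 from Fin.ext hi.symm]
  | succ g ih =>
    intro hg
    obtain ⟨Q, hQ, hQ3⟩ := ih (by omega)
    have hder := derivative_level_two hΦ hg hF (Q := Q) (fun h => absurd h g.succ_ne_zero)
      fun _ => hQ
    by_cases h3 : g < 3
    · have hg3 : Q = explicitFamily (Fin.castSucc ⟨g, h3⟩) := hQ3 _ rfl
      rw [anomalyPoly_congr (fun m hm => hF3 m (by omega) (by omega)), hg3] at hder
      refine ⟨explicitFamily (Fin.succ ⟨g, h3⟩), (level_two_explicit hN hΦ hg rfl ?_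
        (Or.inr (N_zero_weight_one hN hΦ hF hF3))).1, fun i hi => ?_⟩
      · rw [hder]
        congr 1
        funext j
        exact (pderiv_explicitFamily_succ ⟨g, h3⟩ j).symm
      · rw [show i = Fin.succ ⟨g, h3⟩ from Fin.ext hi.symm]
    · obtain ⟨Q', hQ'⟩ := level_two_general hN hΦ hg hder
      exact ⟨Q', hQ', fun i hi => by omega⟩

/-! ### Orbit characters and the orbit-wise anomaly equation -/

theorem levelTwoSeries_coeff_unique {c c' : Fin 3 → ℂ} {τ : ℍ}
    (h : ∀ u, ∑ j, c j * thetaType j τ u = ∑ j, c' j * thetaType j τ u) (j : Fin 3) :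
    c j = c' j := by
  refine sub_eq_zero.mp (thetaType_independent (w := fun j => c j - c' j) (τ := τ) (fun u => ?_) j)
  simp only [sub_mul, Finset.sum_sub_distrib, h u, sub_self]

/-- The exponents `(λ, λ)` of the leading powers of `q^{1/2}`. -/
theorem exp_weightNorm (j : Fin 3) (τ : ℍ) :
    Complex.exp (-(Real.pi * Complex.I * weightNorm j * τ)) = (nome τ ^ (![0, 2, 1] j : ℕ))⁻¹ := by
  rw [Complex.exp_neg, nome, ← Complex.exp_nat_mul]
  congr 2
  match j with
  | 0 => simp [weightNorm]
  | 1 => simp [weightNorm]; ring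
  | 2 => simp [weightNorm]

theorem prefactor_eq (j : Fin 3) (τ : ℍ) :
    prefactor j τ = nome τ ^ (![0, 2, 1] j : ℕ) * (etaProd τ ^ 24)⁻¹ * weightForm j τ := by
  have h : ModularForm.eta τ ^ 24 = nome τ ^ 2 * etaProd τ ^ 24 := by
    rw [show 24 = 12 * 2 from rfl, pow_mul, eta_pow_twelve, mul_pow, ← pow_mul]
  have h1 := nome_ne_zero τ
  have h2 := etaProd_ne_zero τ
  match j with
  | 0 =>
    simp only [prefactor, weightForm, Matrix.cons_val, Pi.one_apply, h]
    rw [qPow_eq_nome 1 2 (by norm_num)]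
    field_simp
  | 1 =>
    simp only [prefactor, weightForm, Matrix.cons_val, h]
    rw [qPow_eq_nome 2 4 (by norm_num)]
    field_simp
  | 2 =>
    simp only [prefactor, weightForm, Matrix.cons_val, h]
    rw [qPow_eq_nome (3 / 2) 3 (by norm_num)]
    field_simp

/-- Explains C_λ: it divides out the number of cosets of the type in the multiplicity function, and
supplies q to the half norm of the weight to match the normalisations of the character and of the
multiplicity function. -/
theorem anomalyCoeff_mul (j : Fin 3) (τ : ℍ) :
    anomalyCoeff j τ * orbitCard j = (nome τ ^ (![0, 2, 1] j : ℕ)) ^ 2 := by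
  match j with
  | 0 => simp [anomalyCoeff, orbitCard]
  | 1 =>
    simp only [anomalyCoeff, orbitCard, Matrix.cons_val]
    rw [qPow_eq_nome 2 4 (by norm_num)]
    push_cast
    ring
  | 2 =>
    simp only [anomalyCoeff, orbitCard, Matrix.cons_val]
    rw [qPow_eq_nome 1 2 (by norm_num)]
    push_cast
    ring

theorem orbitChar_level_two (hN : IsSolution G 2 N) (hΦ : SolvesAnomaly G N Φ) {g : ℕ}
    (hg : g ≤ G) {Q : Fin 3 → MvPolynomial (Fin 3) ℚ} (hQ : Φ g 2 = levelTwoSeries Q)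
    (j : Fin 3) (τ : ℍ) :
    orbitChar N g (levelTwoWeight j) τ = prefactor j τ * evalAt (Q j) τ := by
  have h := levelTwoSeries_coeff_unique (c := fun j => shiftedChar N g j τ)
    (c' := fun j => (etaProd τ ^ 24)⁻¹ * (weightForm j τ * evalAt (Q j) τ)) (τ := τ) (fun u => by
      rw [level_two_eval hN hΦ hg, hQ, eval_levelTwoSeries, Finset.mul_sum]
      exact Finset.sum_congr rfl fun j _ => (mul_assoc _ _ _).symm) j
  simp only [shiftedChar, exp_weightNorm] at h
  rw [mul_inv_eq_iff_eq_mul₀ (pow_ne_zero _ (nome_ne_zero τ))] at h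
  rw [h, prefactor_eq]
  ring

/-- Comparison of the coefficients of θⱼ in the anomaly equation. The coset theta constant there is
the multiplicity function up to a power of q and the number of cosets. -/
theorem anomaly_level_two (hN : IsSolution G 2 N) (hΦ : SolvesAnomaly G N Φ)
    (hF : ∀ m ≤ G, Φ m 1 = toFun (F m) * Polynomial.C thetaFun) {g : ℕ}
    (hg : g ≤ G) {Q Q' : Fin 3 → MvPolynomial (Fin 3) ℚ} (hQ : Φ g 2 = levelTwoSeries Q)
    (hQ0 : g = 0 → Q' = 0) (hQ' : g ≠ 0 → Φ (g - 1) 2 = levelTwoSeries Q') (j : Fin 3) (τ : ℍ) :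
    prefactor j τ * evalAt (MvPolynomial.pderiv 0 (Q j)) τ =
      anomalyCoeff j τ / 24 * (∑ p ∈ Finset.HasAntidiagonal.antidiagonal g,
        orbitChar N p.1 (e 9) τ * orbitChar N p.2 (e 9) τ) * orbitMult (levelTwoWeight j) τ
      + if g = 0 then 0 else 1 / 4 * orbitChar N (g - 1) (levelTwoWeight j) τ := by
  have hder := derivative_level_two hΦ hg hF hQ0 hQ'
  rw [hQ, derivative_levelTwoSeries] at hder
  have h := levelTwoSeries_coeff_unique (τ := τ) (fun u => by
    have := congrArg (fun P : Polynomial Fun => P.eval (lift EisensteinSeries.E2) τ u) hder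
    simp only [eval_levelTwoSeries] at this
    exact this) j
  have hsum : ∑ p ∈ Finset.HasAntidiagonal.antidiagonal g,
      orbitChar N p.1 (e 9) τ * orbitChar N p.2 (e 9) τ = (etaProd τ ^ 24)⁻¹ *
        evalAt (∑ p ∈ Finset.HasAntidiagonal.antidiagonal g, F p.1 * F p.2) τ := by
    rw [evalAt, map_sum, Finset.mul_sum]
    refine Finset.sum_congr rfl fun p hp => ?_
    have := Finset.HasAntidiagonal.mem_antidiagonal.mp hp
    rw [orbitChar_level_one hN hΦ (by omega) (hF p.1 (by omega)),
      orbitChar_level_one hN hΦ (by omega) (hF p.2 (by omega)), map_mul, ← evalAt, ← evalAt,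
      div_mul_div_comm, ← pow_add, div_eq_inv_mul]
  have hchar : (if g = 0 then 0 else 1 / 4 * orbitChar N (g - 1) (levelTwoWeight j) τ) =
      1 / 4 * (prefactor j τ * evalAt (Q' j) τ) := by
    split_ifs with h0
    · rw [hQ0 h0]; simp [evalAt]
    · rw [orbitChar_level_two hN hΦ (by omega) (hQ' h0)]
  have hR : evalAt (anomalyPoly F g Q' j) τ = 1 / 24 *
      (evalAt (∑ p ∈ Finset.HasAntidiagonal.antidiagonal g, F p.1 * F p.2) τ *
        evalAt (squarePoly j) τ) + 1 / 4 * evalAt (Q' j) τ := by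
    simp only [evalAt, anomalyPoly, map_add, map_mul, MvPolynomial.algHom_C, eq_ratCast]
    push_cast
    rfl
  rw [hsum, hchar, orbitMult_levelTwoWeight, exp_weightNorm, thetaType_zero, thetaCoset_weightVec,
    prefactor_eq]
  rw [hR] at h
  have hC := anomalyCoeff_mul j τ
  have hn : nome τ ^ (![0, 2, 1] j : ℕ) ≠ 0 := pow_ne_zero _ (nome_ne_zero τ)
  generalize nome τ ^ (![0, 2, 1] j : ℕ) = x at *
  have hC' : anomalyCoeff j τ * orbitCard j * x⁻¹ = x := by rw [hC]; field_simp
  linear_combination (x * (etaProd τ ^ 24)⁻¹) * h - (1 / 24 * (etaProd τ ^ 24)⁻¹ *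
    evalAt (∑ p ∈ Finset.HasAntidiagonal.antidiagonal g, F p.1 * F p.2) τ *
      weightForm j τ * evalAt (squarePoly j) τ) * hC'

end LevelTwo

end HalfK3

end

/-! ### The proposition -/

theorem proposition3p2 (G : ℕ) (N : ℕ → HalfK3.H2 → ℚ) (hN : HalfK3.IsSolution G 2 N) :
    HalfK3.minimalDominant 2 = Set.range HalfK3.levelTwoWeight ∧
    ∀ g ≤ G, ∀ j : Fin 3, ∃ Q : MvPolynomial (Fin 3) ℚ,
      (∀ τ : UpperHalfPlane, HasSum (HalfK3.orbitTerm N g (HalfK3.levelTwoWeight j) τ)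
        (HalfK3.prefactor j τ * HalfK3.evalAt Q τ)) ∧
      (∀ τ : UpperHalfPlane,
        HalfK3.prefactor j τ * HalfK3.evalAt (MvPolynomial.pderiv 0 Q) τ =
          HalfK3.anomalyCoeff j τ / 24 *
            (∑ p ∈ Finset.HasAntidiagonal.antidiagonal g,
              HalfK3.orbitChar N p.1 (HalfK3.e 9) τ * HalfK3.orbitChar N p.2 (HalfK3.e 9) τ) *
            HalfK3.orbitMult (HalfK3.levelTwoWeight j) τ
          + if g = 0 then 0 else
              1 / 4 * HalfK3.orbitChar N (g - 1) (HalfK3.levelTwoWeight j) τ) ∧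
      (∀ i : Fin 4, g = i → Q = HalfK3.explicitPoly j i) := by
  refine ⟨HalfK3.minimalDominant_two, fun g hg j => ?_⟩
  obtain ⟨Φ, hΦ⟩ := hN.anomaly
  replace hΦ : HalfK3.SolvesAnomaly G N Φ := hΦ
  choose! F hF using HalfK3.exists_level_one_poly hN hΦ
  have hF1 := fun m hm => (hF m hm).1
  have hF3 := fun m hm => (hF m hm).2
  obtain ⟨Q, hQ, hQ3⟩ := HalfK3.exists_level_two_poly hN hΦ hF1 hF3 g hg
  -- The polynomials of genus g - 1, replaced by zero in genus 0 in accordance with Z₋₁ = 0.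
  obtain ⟨Q', hQ0, hQ'⟩ : ∃ Q' : Fin 3 → MvPolynomial (Fin 3) ℚ, (g = 0 → Q' = 0) ∧
      (g ≠ 0 → Φ (g - 1) 2 = HalfK3.levelTwoSeries Q') := by
    by_cases h0 : g = 0
    · exact ⟨0, fun _ => rfl, fun h => absurd h0 h⟩
    · obtain ⟨Q', hQ', -⟩ := HalfK3.exists_level_two_poly hN hΦ hF1 hF3 (g - 1) (by omega)
      exact ⟨Q', fun h => absurd h h0, fun _ => hQ'⟩
  refine ⟨Q j, fun τ => ?_, HalfK3.anomaly_level_two hN hΦ hF1 hg hQ hQ0 hQ' j, fun i hi => ?_⟩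
  · rw [← HalfK3.orbitChar_level_two hN hΦ hg hQ]
    exact (HalfK3.summable_level_two hN hΦ hg j τ).hasSum
  · rw [hQ3 i hi]
    rfl
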